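/- For a small category $S$ let $\mathrm{sd}'(S)$ be its morphism category: its objects are the morphisms of $S$, and a morphism $f\to g$ is a pair $(h,k)$ of morphisms of $S$ with $k\circ g\circ h=f$. For an object $b$ of $S$ let $(b\downarrow S)$ be the category of objects of $S$ under $b$. Let $K$ be a category with binary products and colimits, $N:\mathbf{Cat}\to K$ a functor on the category of small categories, and $A:S\to K$ a diagram. The $N$-limit of $A$ is the colimit in $K$ of the diagram over $\mathrm{sd}'(S)$ that sends $f:a\to b$ to $N(b\downarrow S)\times A(a)$ and sends $(h,k):f\to g$ to $N(k^*)\times A(h)$, where $k^*$ is composition with $k$. Let $\Delta:\mathbf{Cat}\to\mathbf{Top}$ be the realization functor (geometric realization of the nerve). The poset limit $\mathrm{Dl}\,D$ of a diagram $D:S\to\mathbf{Cat}$ is its $N$-limit for $N=\mathrm{id}$ and $K=\mathbf{Cat}$; the homotopy limit $\mathrm{holim}\,X$ of a diagram $X:S\to\mathbf{Top}$ is its $N$-limit for $N=\Delta$ and $K=\mathbf{Top}$. **Corollary.** For every small category $S$ and every diagram $D:S\to\mathbf{Cat}$ of small categories there is a homotopy equivalence $$\mathrm{holim}(\Delta\circ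 D)\;\simeq\;\Delta(\mathrm{Dl}\,D).$$ -/

import Mathlib

open CategoryTheory CategoryTheory.Limits

universe u v w

/-- An object of the morphism category `sd'(S)` of a category `S`: a morphism of `S`. -/
structure MorphismCat (S : Type u) [Category.{v} S] where
  /-- the source of the morphism -/
  dom : S
  /-- the target of the morphism -/
  cod : S
  /-- the morphism -/
  arr : dom ⟶ cod

namespace MorphismCat

variable {S : Type u} [Category.{v} S]

/-- A morphism `f ⟶ g` of the morphism category: a pair `(h, k)` with `k ∘ g ∘ h = f`. -/
@[ext]
structure Hom (f g : MorphismCat S) where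
  /-- the component on sources -/
  h : f.dom ⟶ g.dom
  /-- the component on targets (note the direction) -/
  k : g.cod ⟶ f.cod
  /-- the factorization `k ∘ g ∘ h = f` -/
  w : h ≫ g.arr ≫ k = f.arr

instance : Category (MorphismCat S) where
  Hom f g := Hom f g
  id f := ⟨𝟙 f.dom, 𝟙 f.cod, by simp⟩
  comp a b := ⟨a.h ≫ b.h, b.k ≫ a.k, by
    rw [← a.w, ← b.w]; simp only [Category.assoc]⟩
  id_comp _ := Hom.ext (Category.id_comp _) (Category.comp_id _)
  comp_id _ := Hom.ext (Category.comp_id _) (Category.id_comp _)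
  assoc _ _ _ := Hom.ext (Category.assoc _ _ _) (Category.assoc _ _ _).symm

end MorphismCat

/-- The subdivision `sd A` of a diagram `A : S ⥤ K`: the diagram over the morphism category of `S`
with values in `Cat × K` that sends `f : a ⟶ b` to `((b ↓ S), A a)`.  Here `(b ↓ S)` is the
category of objects under `b`, and a morphism `(h, k) : f ⟶ g` acts on it by composition with
`k`, and acts on `A a` by `A h`. -/
def subdivision {S : Type u} [Category.{v} S] {K : Type w} [Category.{u} K] (A : S ⥤ K) :
    MorphismCat S ⥤ Cat.{v, max u v} × K where
  obj f := (Cat.of (Under f.cod), A.obj f.dom)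
  map m := Prod.mkHom ((Under.mapFunctor S).map m.k.op) (A.map m.h)
  map_id f := Prod.ext ((Under.mapFunctor S).map_id (Opposite.op f.cod)) (A.map_id f.dom)
  map_comp a b := Prod.ext ((Under.mapFunctor S).map_comp a.k.op b.k.op) (A.map_comp a.h b.h)

/-- For a functor `N : Cat ⥤ K`, the `N`-limit of a diagram `A : S ⥤ K` over a small category: the
colimit of the diagram `f ↦ N (cod f ↓ S) × A (dom f)` over the morphism category of `S`. -/
noncomputable def nLim {K : Type w} [Category.{u} K] [HasBinaryProducts K]
    [HasColimitsOfSize.{u, u} K] (N : Cat.{u, u} ⥤ K)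
    {S : Type u} [SmallCategory S] (A : S ⥤ K) : K :=
  colimit (subdivision A ⋙ N.prod (𝟭 K) ⋙ Functor.uncurry.obj prod.functor)

/-- The realization functor `Δ`: the geometric realization of the nerve of a small category. -/
noncomputable def realization : Cat.{u, u} ⥤ TopCat.{u} :=
  nerveFunctor.{u, u} ⋙ SSet.toTop.{u}

/-- The poset limit `Dl D` of a diagram of small categories: the `N`-limit for `N = id`. -/
noncomputable def posetLimit {S : Type u} [SmallCategory S] (D : S ⥤ Cat.{u, u}) : Cat.{u, u} :=
  nLim (𝟭 Cat.{u, u}) D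

/-- The homotopy limit of a diagram of topological spaces: the `N`-limit for `N = Δ`. -/
noncomputable def holim {S : Type u} [SmallCategory S] (X : S ⥤ TopCat.{u}) : TopCat.{u} :=
  nLim realization.{u} X

/-!
Write `C_f = (cod f ↓ S) × D (dom f)` for an object `f` of the morphism category, and
`prodDiagram D` for the diagram `f ↦ C_f` of categories, of which the poset limit is the colimit
in `Cat`. The proof connects three spaces.

*The homotopy limit and the colimit of the spaces `Δ (C_f)`.* The homotopy limit is the colimit of
`Δ (cod f ↓ S) × Δ (D (dom f))` in `Top`, with the product topology. As `Δ` need not preserve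
products in `Top`, the natural map `Δ (C × C') ⟶ Δ C × Δ C'` is a continuous bijection whose
inverse `crossPt` is only continuous over each closed cell of `Δ C`. The collar homotopy `collar`
deforms the identity of a realization `|X|`: it pushes each cell away from its barycenter into the
lower skeleta. Its end maps a neighbourhood of each point into a single closed cell
(`continuous_collar_one`), so that composing `crossPt` with it gives a continuous homotopy
inverse. The collar homotopy commutes with maps which preserve nondegenerate simplices, and the
functors `(b ↓ S) ⥤ (a ↓ S)` reflect identities. Hence all of this is natural in `f` and passes to
the colimits (`homotopyEquiv_of_isColimit`, `holim_homotopyEquiv`).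

*The poset limit and the Grothendieck construction.* The colimit of `prodDiagram D` in `Cat` is
the Grothendieck construction `Gr D`, with the functors `C_f ⥤ Gr D` that send `(g, x)` to
`(cod g, D (f ≫ g) x)` (`isColimitTotalCocone`, `posetLimitIso`).

*The colimit of the nerves and the nerve of the colimit.* As realization of simplicial sets is a
left adjoint, the colimit of the spaces `Δ (C_f)` is the realization of the colimit `W` of the
nerves, and it remains to see that `W ⟶ N (Gr D)` realizes to a homotopy equivalence
(`nerveComparison_homotopyEquiv`). The inverse is defined on the edgewise subdivision
`sd N (Gr D)`, whose realization is homeomorphic to that of `N (Gr D)` (`sdIso`): a chain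
`x₀ ⟶ ⋯ ⟶ xₙ ⟶ y₀ ⟶ ⋯ ⟶ yₙ` of `Gr D` gives a chain under the projection of `y₀`, namely that of
the `yᵢ`, and a chain in the fiber over it, namely that of the `xᵢ` pushed forward along `xᵢ ⟶ y₀`
(`fromSd`). Both composites differ from the restriction of a simplex to its second half by natural
transformations, so that they are homotopic to it, and it is homotopic to the homeomorphism
`|sd X| ≅ |X|` by a straight-line homotopy (`sdIso_hom_homotopic`).

Both `|Δ[n] × Δ[m]| ≅ Δⁿ × Δᵐ` and `|sd Δ[n]| ≅ Δⁿ` come from the monotone coupling of two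
probability measures on finite chains: it is the unique coupling supported on a chain.
-/

/-! ### Points of the realization of a simplicial set -/

section Points

open Simplicial Opposite

namespace Realization

/-- The topological `n`-simplex. -/
abbrev TopSimplex (n : ℕ) : Type := stdSimplex ℝ (Fin (n + 1))

/-- A copy of `α` with the indiscrete topology.  Every function to it is continuous, so that
set-theoretic data on a realization can be defined by its universal property. -/
def Indiscrete (α : Type u) : Type u := α

instance (α : Type u) : TopologicalSpace (Indiscrete α) := ⊤

variable {X Y : SSet.{u}}

/-- The characteristic map `Δⁿ → |X|` of an `n`-simplex `x` of `X`. -/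
noncomputable def pt (X : SSet.{u}) {n : ℕ} (x : X _⦋n⦌) :
    C(TopSimplex n, SSet.toTop.obj X) :=
  TopCat.toSSetObjEquiv _ (op ⦋n⦌) ((sSetTopAdj.unit.app X).app (op ⦋n⦌) x)

lemma pt_map {m n : ℕ} (θ : ⦋m⦌ ⟶ ⦋n⦌) (x : X _⦋n⦌) (t : TopSimplex m) :
    pt X (X.map θ.op x) t = pt X x (stdSimplex.map θ t) := by
  have h := ConcreteCategory.congr_hom ((sSetTopAdj.unit.app X).naturality θ.op) x
  unfold pt
  simp only [ConcreteCategory.comp_apply] at h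
  erw [h]
  exact TopCat.toSSetObjEquiv_naturality_apply _ _ _

lemma toTop_map_pt (f : X ⟶ Y) {n : ℕ} (x : X _⦋n⦌) (t : TopSimplex n) :
    SSet.toTop.map f (pt X x t) = pt Y (f.app _ x) t := by
  have h := ConcreteCategory.congr_hom (congr_app (sSetTopAdj.unit.naturality f) (op ⦋n⦌)) x
  have h2 := congrArg (fun z => TopCat.toSSetObjEquiv _ (op ⦋n⦌) z t) h
  exact h2.symm

/-- The map `X ⟶ Sing Z` corresponding to a compatible family of singular simplices of `Z`. -/
noncomputable def singOfPt {Z : TopCat.{u}}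
    (φ : ∀ n : ℕ, X _⦋n⦌ → C(TopSimplex n, Z))
    (hφ : ∀ (m n : ℕ) (θ : ⦋m⦌ ⟶ ⦋n⦌) (x : X _⦋n⦌) (t : TopSimplex m),
      φ m (X.map θ.op x) t = φ n x (stdSimplex.map θ t)) : X ⟶ TopCat.toSSet.obj Z where
  app n := ↾fun x => (TopCat.toSSetObjEquiv Z n).symm (φ n.unop.len x)
  naturality := by
    intro a b f
    ext x
    apply (TopCat.toSSetObjEquiv Z b).injective
    ext t
    have h1 := TopCat.toSSetObjEquiv_naturality_apply (X := Z) f.unop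
      ((TopCat.toSSetObjEquiv Z a).symm (φ a.unop.len x)) t
    refine Eq.trans ?_ h1.symm
    refine Eq.trans (congrArg (fun z : C(TopSimplex _, Z) => z t)
      ((TopCat.toSSetObjEquiv Z b).apply_symm_apply _)) ?_
    refine Eq.trans (hφ _ _ f.unop x t) ?_
    exact (congrArg (fun z : C(TopSimplex _, Z) => z (stdSimplex.map f.unop t))
      ((TopCat.toSSetObjEquiv Z a).apply_symm_apply _)).symm

/-- A continuous map out of `|X|` given on simplices. -/
noncomputable def ptDesc {Z : TopCat.{u}}
    (φ : ∀ n : ℕ, X _⦋n⦌ → C(TopSimplex n, Z))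
    (hφ : ∀ (m n : ℕ) (θ : ⦋m⦌ ⟶ ⦋n⦌) (x : X _⦋n⦌) (t : TopSimplex m),
      φ m (X.map θ.op x) t = φ n x (stdSimplex.map θ t)) :
    SSet.toTop.obj X ⟶ Z :=
  (sSetTopAdj.homEquiv X Z).symm (singOfPt φ hφ)

lemma ptDesc_pt {Z : TopCat.{u}}
    (φ : ∀ n : ℕ, X _⦋n⦌ → C(TopSimplex n, Z))
    (hφ : ∀ (m n : ℕ) (θ : ⦋m⦌ ⟶ ⦋n⦌) (x : X _⦋n⦌) (t : TopSimplex m),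
      φ m (X.map θ.op x) t = φ n x (stdSimplex.map θ t))
    {n : ℕ} (x : X _⦋n⦌) (t : TopSimplex n) :
    ptDesc φ hφ (pt X x t) = φ n x t := by
  have h := (sSetTopAdj.homEquiv X Z).apply_symm_apply (singOfPt φ hφ)
  rw [Adjunction.homEquiv_unit] at h
  have h2 := ConcreteCategory.congr_hom (congr_app h (op ⦋n⦌)) x
  have h3 := congrArg (fun z => TopCat.toSSetObjEquiv Z (op ⦋n⦌) z t) h2
  exact h3.trans (congrArg (fun z : C(TopSimplex _, Z) => z t)
      ((TopCat.toSSetObjEquiv Z (op ⦋n⦌)).apply_symm_apply _))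

lemma pt_surjective (p : SSet.toTop.obj X) :
    ∃ (n : ℕ) (x : X _⦋n⦌) (t : TopSimplex n), pt X x t = p := by
  -- two maps to an indiscrete space agree once they agree on the simplices
  let Z : TopCat.{u} := TopCat.of (Indiscrete (ULift.{u} Prop))
  have hZ : ∀ {A : Type u} [TopologicalSpace A] (f : A → Indiscrete (ULift.{u} Prop)),
      Continuous f :=
    fun f => continuous_top
  let f : SSet.toTop.obj X ⟶ Z := TopCat.ofHom ⟨fun q => ⟨∃ (n : ℕ) (x : X _⦋n⦌)
    (t : TopSimplex n), pt X x t = q⟩, hZ _⟩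
  let g : SSet.toTop.obj X ⟶ Z := TopCat.ofHom ⟨fun _ => ⟨True⟩, hZ _⟩
  have hfg : f = g := by
    apply (sSetTopAdj.homEquiv X Z).injective
    rw [Adjunction.homEquiv_unit, Adjunction.homEquiv_unit]
    ext n x
    apply (TopCat.toSSetObjEquiv Z (op ⦋n.unop.len⦌)).injective
    ext t
    have : f (pt X x t) = g (pt X x t) := by
      apply ULift.ext
      change (∃ _, _) = True
      exact eq_true ⟨_, x, t, rfl⟩
    exact this
  have := congrArg ULift.down (ConcreteCategory.congr_hom hfg p)
  exact of_eq_true this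

lemma isOpen_iff_pt {U : Set (SSet.toTop.obj X)} :
    IsOpen U ↔ ∀ (n : ℕ) (x : X _⦋n⦌), IsOpen (pt X x ⁻¹' U) := by
  refine ⟨fun h n x => h.preimage (pt X x).continuous, fun h => ?_⟩
  -- `U` is open when its characteristic map to the Sierpinski space is continuous
  let d : SSet.toTop.obj X ⟶ TopCat.of (ULift.{u} Prop) :=
    ptDesc (fun n x => ⟨fun t => ⟨pt X x t ∈ U⟩,
      continuous_uliftUp.comp (isOpen_iff_continuous_mem.1 (h n x))⟩)
      (fun m n θ x t => by simp [pt_map])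
  have hd : ∀ p, d p = ⟨p ∈ U⟩ := fun p => by
    obtain ⟨n, x, t, rfl⟩ := pt_surjective p
    exact ptDesc_pt _ _ x t
  rw [isOpen_iff_continuous_mem]
  have : (fun p => p ∈ U) = ULift.down ∘ d := funext fun p => by simp [hd]
  rw [this]
  exact continuous_uliftDown.comp d.hom.continuous

lemma isQuotientMap_pt (X : SSet.{u}) : Topology.IsQuotientMap
    (fun p : Σ (n : ℕ) (_ : X _⦋n⦌), TopSimplex n => pt X p.2.1 p.2.2) := by
  refine (Topology.isQuotientMap_iff _).2 ⟨Topology.isCoinducing_iff.2 fun U => ?_, fun p => ?_⟩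
  · rw [isOpen_iff_pt, isOpen_sigma_iff]
    refine forall_congr' fun n => ?_
    rw [isOpen_sigma_iff]
    rfl
  · obtain ⟨n, x, t, h⟩ := pt_surjective p
    exact ⟨⟨n, x, t⟩, h⟩

lemma continuous_iff_pt {Z : Type*} [TopologicalSpace Z] {f : SSet.toTop.obj X → Z} :
    Continuous f ↔ ∀ (n : ℕ) (x : X _⦋n⦌), Continuous (fun t => f (pt X x t)) := by
  rw [(isQuotientMap_pt X).continuous_iff, continuous_sigma_iff]
  refine forall_congr' fun n => ?_
  rw [continuous_sigma_iff]
  rfl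

/-- Continuity on `|X| × K` may be tested on simplices when `K` is locally compact. -/
lemma continuous_prod_iff_pt {K Z : Type*} [TopologicalSpace K] [LocallyCompactSpace K]
    [TopologicalSpace Z] {f : SSet.toTop.obj X × K → Z} :
    Continuous f ↔ ∀ (n : ℕ) (x : X _⦋n⦌),
      Continuous (fun p : TopSimplex n × K => f (pt X x p.1, p.2)) := by
  refine ⟨fun h n x => by fun_prop, fun h => ?_⟩
  have h1 : ∀ p, Continuous (fun k => f (p, k)) := fun p => by
    obtain ⟨n, x, t, rfl⟩ := pt_surjective p
    exact (h n x).comp (by fun_prop : Continuous fun k => (t, k))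
  have h2 : Continuous (fun p => (⟨fun k => f (p, k), h1 p⟩ : C(K, Z))) :=
    continuous_iff_pt.2 fun n x => (ContinuousMap.curry ⟨_, h n x⟩).continuous
  exact ContinuousMap.continuous_uncurry_of_continuous ⟨_, h2⟩

end Realization

end Points

/-! ### Normal forms of points of the realization -/

section Canonical

open Simplicial Opposite

namespace Realization

lemma map_apply {X Y : Type*} [Fintype X] [Fintype Y] [DecidableEq Y] (f : X → Y)
    (t : stdSimplex ℝ X) (j : Y) : stdSimplex.map f t j = ∑ i with f i = j, t i := by
  rw [stdSimplex.map_coe, FunOnFinite.linearMap_apply_apply]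

lemma map_injective_apply {X Y : Type*} [Fintype X] [Fintype Y] {f : X → Y}
    (hf : Function.Injective f) (t : stdSimplex ℝ X) (i : X) :
    stdSimplex.map f t (f i) = t i := by
  classical
  rw [map_apply, Finset.sum_eq_single i]
  · intro b hb hbi
    exact absurd (hf (Finset.mem_filter.1 hb).2) hbi
  · simp

lemma map_apply_notMem_range {X Y : Type*} [Fintype X] [Fintype Y] {f : X → Y}
    (t : stdSimplex ℝ X) {j : Y} (hj : j ∉ Set.range f) :
    stdSimplex.map f t j = 0 := by
  classical
  rw [map_apply, Finset.sum_eq_zero]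
  intro i hi
  exact absurd ⟨i, (Finset.mem_filter.1 hi).2⟩ hj

lemma map_pos_of_surjective {X Y : Type*} [Fintype X] [Fintype Y] {f : X → Y}
    (hf : Function.Surjective f) {t : stdSimplex ℝ X} (ht : ∀ i, 0 < t i) (j : Y) :
    0 < stdSimplex.map f t j := by
  classical
  rw [map_apply]
  obtain ⟨i, hi⟩ := hf j
  exact Finset.sum_pos (fun i _ => ht i) ⟨i, by simp [hi]⟩

lemma map_hom_comp {k m n : ℕ} (θ : ⦋k⦌ ⟶ ⦋m⦌) (η : ⦋m⦌ ⟶ ⦋n⦌) (t : TopSimplex k) :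
    stdSimplex.map (θ ≫ η) t = stdSimplex.map η (stdSimplex.map θ t) :=
  (stdSimplex.map_comp_apply (S := ℝ) θ η t).symm

lemma injective_of_mono {m n : ℕ} (θ : ⦋m⦌ ⟶ ⦋n⦌) [Mono θ] : Function.Injective θ :=
  SimplexCategory.mono_iff_injective.1 inferInstance

lemma surjective_of_epi {m n : ℕ} (θ : ⦋m⦌ ⟶ ⦋n⦌) [Epi θ] : Function.Surjective θ :=
  SimplexCategory.epi_iff_surjective.1 inferInstance

/-- The face of a point of a simplex with a vanishing coordinate. -/
def dropCoord {n : ℕ} (i : Fin (n + 2)) (t : TopSimplex (n + 1)) (h : t i = 0) : TopSimplex n :=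
  ⟨fun j => t (i.succAbove j), fun j => t.2.1 _, by
    have := stdSimplex.sum_eq_one t
    rw [Fin.sum_univ_succAbove _ i, h, zero_add] at this
    exact this⟩

lemma map_dropCoord {n : ℕ} (i : Fin (n + 2)) (t : TopSimplex (n + 1)) (h : t i = 0) :
    stdSimplex.map (SimplexCategory.δ i) (dropCoord i t h) = t := by
  ext j
  by_cases hj : j = i
  · subst hj
    rw [h, map_apply_notMem_range]
    rintro ⟨k, hk⟩
    exact Fin.succAbove_ne j k hk
  · obtain ⟨k, rfl⟩ := Fin.exists_succAbove_eq hj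
    exact map_injective_apply (f := SimplexCategory.δ i) Fin.succAbove_right_injective
      (dropCoord i t h) k

/-- Every point of a simplex lies in the interior of a face. -/
lemma exists_support (n : ℕ) (t : TopSimplex n) :
    ∃ (k : ℕ) (δ : ⦋k⦌ ⟶ ⦋n⦌) (_ : Mono δ) (w : TopSimplex k),
      (∀ i, 0 < w i) ∧ stdSimplex.map δ w = t := by
  induction n with
  | zero =>
    refine ⟨0, 𝟙 _, inferInstance, t, fun i => ?_, stdSimplex.map_id_apply t⟩
    have h := stdSimplex.sum_eq_one t
    rw [Fin.sum_univ_one] at h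
    rw [Fin.fin_one_eq_zero i, h]
    exact one_pos
  | succ n ih =>
    by_cases h : ∃ i, t i = 0
    · obtain ⟨i, hi⟩ := h
      obtain ⟨k, δ, hδ, w, hw, e⟩ := ih (dropCoord i t hi)
      refine ⟨k, δ ≫ SimplexCategory.δ i, mono_comp _ _, w, hw, ?_⟩
      rw [← map_dropCoord i t hi, ← e, map_hom_comp]
    · push Not at h
      exact ⟨n + 1, 𝟙 _, inferInstance, t,
        fun i => lt_of_le_of_ne (stdSimplex.zero_le t i) (Ne.symm (h i)),
        stdSimplex.map_id_apply t⟩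

lemma range_of_interior {k n : ℕ} {δ : ⦋k⦌ ⟶ ⦋n⦌} [Mono δ] {w : TopSimplex k}
    (hw : ∀ i, 0 < w i) : Set.range δ = {j | stdSimplex.map δ w j ≠ 0} := by
  ext j
  constructor
  · rintro ⟨i, rfl⟩
    change stdSimplex.map δ w (δ i) ≠ 0
    rw [map_injective_apply (injective_of_mono δ)]
    exact (hw i).ne'
  · intro hj
    by_contra h
    exact hj (map_apply_notMem_range w h)

lemma support_unique {k k' n : ℕ} {δ : ⦋k⦌ ⟶ ⦋n⦌} [Mono δ] {w : TopSimplex k}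
    (hw : ∀ i, 0 < w i) {δ' : ⦋k'⦌ ⟶ ⦋n⦌} [Mono δ'] {w' : TopSimplex k'}
    (hw' : ∀ i, 0 < w' i) (h : stdSimplex.map δ w = stdSimplex.map δ' w') :
    (⟨k, δ, w⟩ : Σ k : ℕ, (⦋k⦌ ⟶ ⦋n⦌) × TopSimplex k) = ⟨k', δ', w'⟩ := by
  have i1 : Function.Injective δ := injective_of_mono δ
  have i2 : Function.Injective δ' := injective_of_mono δ'
  have hr : Set.range δ = Set.range δ' := by
    rw [range_of_interior hw, range_of_interior hw', h]
  have hk : k = k' := by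
    have h1 := Set.card_range_of_injective i1
    have h2 := Set.card_range_of_injective i2
    have h3 : Fintype.card (Set.range δ) = Fintype.card (Set.range δ') :=
      Fintype.card_congr (Equiv.setCongr hr)
    rw [h1, h2] at h3
    simpa using h3
  subst hk
  have hδ : δ = δ' := by
    apply SimplexCategory.Hom.ext
    apply OrderHom.ext
    exact (StrictMono.range_inj (δ.toOrderHom.monotone.strictMono_of_injective i1)
      (δ'.toOrderHom.monotone.strictMono_of_injective i2)).1 hr
  subst hδ
  have hww : w = w' := by
    ext i
    rw [← map_injective_apply i1 w, ← map_injective_apply i1 w', h]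
  rw [hww]

lemma exists_epi_mono {m n : ℕ} (θ : ⦋m⦌ ⟶ ⦋n⦌) :
    ∃ (k : ℕ) (ε : ⦋m⦌ ⟶ ⦋k⦌) (δ : ⦋k⦌ ⟶ ⦋n⦌), Epi ε ∧ Mono δ ∧ ε ≫ δ = θ :=
  ⟨(image θ).len, factorThruImage θ, image.ι θ, inferInstance, inferInstance, image.fac θ⟩

variable (X : SSet.{u})

/-- Candidates for the normal form of a point of `|X|`: a nondegenerate simplex and a point of
the corresponding topological simplex. -/
abbrev Canon : Type u := Σ n : ℕ, X.nonDegenerate n × TopSimplex n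

variable {X}

/-- `IsNormalForm x t c` holds when `c` is obtained from `(x, t)` by restricting `x` to the
support of `t` and collapsing the resulting simplex to its nondegenerate quotient. -/
def IsNormalForm {n : ℕ} (x : X _⦋n⦌) (t : TopSimplex n) (c : Canon X) : Prop :=
  ∃ (k : ℕ) (δ : ⦋k⦌ ⟶ ⦋n⦌) (_ : Mono δ) (w : TopSimplex k) (ε : ⦋k⦌ ⟶ ⦋c.1⦌) (_ : Epi ε),
    (∀ i, 0 < w i) ∧ stdSimplex.map δ w = t ∧ X.map δ.op x = X.map ε.op c.2.1 ∧
      stdSimplex.map ε w = c.2.2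

lemma exists_isNormalForm {n : ℕ} (x : X _⦋n⦌) (t : TopSimplex n) :
    ∃ c, IsNormalForm x t c := by
  obtain ⟨k, δ, hδ, w, hw, e⟩ := exists_support n t
  obtain ⟨m, f, hf, y, hy⟩ := X.exists_nonDegenerate (X.map δ.op x)
  exact ⟨⟨m, y, stdSimplex.map f w⟩, k, δ, hδ, w, f, hf, hw, e, hy, rfl⟩

lemma IsNormalForm.unique {n : ℕ} {x : X _⦋n⦌} {t : TopSimplex n} {c c' : Canon X}
    (h : IsNormalForm x t c) (h' : IsNormalForm x t c') : c = c' := by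
  obtain ⟨k, δ, hδ, w, ε, hε, hw, e1, e2, e3⟩ := h
  obtain ⟨k', δ', hδ', w', ε', hε', hw', e1', e2', e3'⟩ := h'
  have := support_unique hw hw' (e1.trans e1'.symm)
  obtain rfl : k = k' := congrArg Sigma.fst this
  obtain ⟨rfl, rfl⟩ : δ = δ' ∧ w = w' := by simpa using this
  obtain ⟨m, y, s⟩ := c
  obtain ⟨m', y', s'⟩ := c'
  dsimp only at *
  obtain rfl := X.unique_nonDegenerate_dim _ ε y e2 ε' y' e2'
  obtain rfl := X.unique_nonDegenerate_simplex _ ε y e2 ε' y' e2'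
  obtain rfl := X.unique_nonDegenerate_map _ ε y e2 ε' y e2'
  rw [← e3, ← e3']

lemma IsNormalForm.of_map {m n : ℕ} {θ : ⦋m⦌ ⟶ ⦋n⦌} {x : X _⦋n⦌} {t : TopSimplex m}
    {c : Canon X} (h : IsNormalForm (X.map θ.op x) t c) :
    IsNormalForm x (stdSimplex.map θ t) c := by
  obtain ⟨k, δ, hδ, w, ε, hε, hw, rfl, e2, e3⟩ := h
  obtain ⟨k', ε', δ', hε', hδ', e⟩ := exists_epi_mono (δ ≫ θ)
  obtain ⟨m', ε'', hε'', y, hy⟩ := X.exists_nonDegenerate (X.map δ'.op x)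
  have key : X.map δ.op (X.map θ.op x) = X.map (ε' ≫ ε'').op y := by
    rw [op_comp, Functor.map_comp_apply, ← hy, ← Functor.map_comp_apply,
      ← Functor.map_comp_apply, ← op_comp, ← op_comp, e]
  obtain ⟨d, z, s⟩ := c
  dsimp only at *
  have : Epi (ε' ≫ ε'') := epi_comp _ _
  obtain rfl := X.unique_nonDegenerate_dim _ ε z e2 (ε' ≫ ε'') y key
  obtain rfl := X.unique_nonDegenerate_simplex _ ε z e2 (ε' ≫ ε'') y key
  obtain rfl := X.unique_nonDegenerate_map _ ε z e2 (ε' ≫ ε'') z key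
  refine ⟨k', δ', hδ', stdSimplex.map ε' w, ε'', hε'', ?_, ?_, hy, ?_⟩
  · exact map_pos_of_surjective (surjective_of_epi ε') hw
  · rw [← map_hom_comp, ← map_hom_comp, e]
  · rw [← e3, map_hom_comp]

/-- The normal form of a point of `|X|`, as a map to an indiscrete space. -/
noncomputable def normalForm (X : SSet.{u}) : SSet.toTop.obj X ⟶ TopCat.of (Indiscrete (Canon X)) :=
  ptDesc (fun _ x => ⟨fun t => (exists_isNormalForm x t).choose, continuous_top⟩)
    (fun _ _ θ x t => (exists_isNormalForm x _).choose_spec.unique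
      (exists_isNormalForm (X.map θ.op x) t).choose_spec.of_map |>.symm)

lemma normalForm_pt {n : ℕ} (x : X.nonDegenerate n) {t : TopSimplex n} (ht : ∀ i, 0 < t i) :
    normalForm X (pt X x.1 t) = (⟨n, x, t⟩ : Canon X) := by
  refine (ptDesc_pt _ _ _ _).trans ?_
  refine (exists_isNormalForm x.1 t).choose_spec.unique
    ⟨n, 𝟙 _, inferInstance, t, 𝟙 _, inferInstance, ht, ?_, rfl, ?_⟩ <;>
  exact stdSimplex.map_id_apply t

/-- The dimension of the open cell of `|X|` containing a point. -/
noncomputable def cellDim (p : SSet.toTop.obj X) : ℕ := Sigma.fst (normalForm X p : Canon X)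

/-- The nondegenerate simplex whose open cell contains a given point. -/
noncomputable def cell (p : SSet.toTop.obj X) : X _⦋cellDim p⦌ :=
  (Sigma.snd (normalForm X p : Canon X)).1.1

/-- The barycentric coordinates of a point in its open cell. -/
noncomputable def coord (p : SSet.toTop.obj X) : TopSimplex (cellDim p) :=
  (Sigma.snd (normalForm X p : Canon X)).2

lemma pt_degenerate {n : ℕ} {x : X _⦋n⦌} (hx : x ∉ X.nonDegenerate n) :
    ∃ (m : ℕ) (_ : m < n) (θ : ⦋n⦌ ⟶ ⦋m⦌) (y : X _⦋m⦌), x = X.map θ.op y := by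
  obtain ⟨m, hm, θ, y, rfl⟩ := (X.mem_degenerate_iff_notMem_nonDegenerate x).2 hx
  exact ⟨m, hm, θ, y, rfl⟩

/-- Every point of `|X|` lies in the interior of a nondegenerate simplex. -/
lemma exists_interior (p : SSet.toTop.obj X) :
    ∃ (n : ℕ) (x : X _⦋n⦌) (t : TopSimplex n), x ∈ X.nonDegenerate n ∧ (∀ i, 0 < t i) ∧
      pt X x t = p := by
  obtain ⟨n, x, t, rfl⟩ := pt_surjective p
  obtain ⟨k, δ, hδ, w, hw, rfl⟩ := exists_support n t
  obtain ⟨m, f, hf, y, hy⟩ := X.exists_nonDegenerate (X.map δ.op x)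
  refine ⟨m, y.1, stdSimplex.map f w, y.2,
    map_pos_of_surjective (surjective_of_epi f) hw, ?_⟩
  rw [← pt_map, ← hy, pt_map]

lemma coord_pos (p : SSet.toTop.obj X) (i) : 0 < coord p i := by
  obtain ⟨n, x, t, hx, ht, rfl⟩ := exists_interior p
  have := normalForm_pt ⟨x, hx⟩ ht
  unfold coord
  revert i
  unfold cellDim
  rw [this]
  exact ht

lemma pt_cell_coord (p : SSet.toTop.obj X) : pt X (cell p) (coord p) = p := by
  obtain ⟨n, x, t, hx, ht, rfl⟩ := exists_interior p
  have := normalForm_pt ⟨x, hx⟩ ht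
  have key : ∀ c : Canon X, c = ⟨n, ⟨x, hx⟩, t⟩ → pt X c.2.1.1 c.2.2 = pt X x t := by
    rintro _ rfl
    rfl
  exact key _ this

/-- Case analysis on the open cell of a point: a statement about `cell p` and `coord p` may be
proved for the given normal form. -/
lemma cell_cases {n : ℕ} {x : X _⦋n⦌} (hx : x ∈ X.nonDegenerate n) {t : TopSimplex n}
    (ht : ∀ i, 0 < t i) {P : (m : ℕ) → X _⦋m⦌ → TopSimplex m → Prop} (h : P n x t) :
    P (cellDim (pt X x t)) (cell (pt X x t)) (coord (pt X x t)) := by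
  have key : ∀ c : Canon X, c = ⟨n, ⟨x, hx⟩, t⟩ → P c.1 c.2.1.1 c.2.2 := by
    rintro _ rfl
    exact h
  exact key _ (normalForm_pt ⟨x, hx⟩ ht)

lemma cellDim_pt {n : ℕ} {x : X _⦋n⦌} (hx : x ∈ X.nonDegenerate n) {t : TopSimplex n}
    (ht : ∀ i, 0 < t i) : cellDim (pt X x t) = n :=
  cell_cases hx ht (P := fun m _ _ => m = n) rfl

lemma cellDim_pt_le {n : ℕ} (x : X _⦋n⦌) (t : TopSimplex n) : cellDim (pt X x t) ≤ n := by
  obtain ⟨k, δ, hδ, w, hw, rfl⟩ := exists_support n t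
  obtain ⟨m, f, hf, y, hy⟩ := X.exists_nonDegenerate (X.map δ.op x)
  rw [← pt_map, hy, pt_map, cellDim_pt y.2
    (map_pos_of_surjective (surjective_of_epi f) hw)]
  exact (SimplexCategory.len_le_of_epi f).trans (SimplexCategory.len_le_of_mono δ)

lemma cellDim_pt_lt {n : ℕ} (x : X _⦋n⦌) {t : TopSimplex n} {i} (ht : t i = 0) :
    cellDim (pt X x t) < n := by
  cases n with
  | zero =>
    have h := stdSimplex.sum_eq_one t
    rw [Fin.sum_univ_one, ← Fin.fin_one_eq_zero i, ht] at h
    exact absurd h zero_ne_one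
  | succ n =>
    rw [← map_dropCoord i t ht, ← pt_map]
    exact Nat.lt_succ_of_le (cellDim_pt_le _ _)

end Realization

end Canonical

/-! ### The collar homotopy -/

section Collar

open Simplicial Opposite

namespace Realization

/-- The smallest barycentric coordinate. -/
noncomputable def minCoord {n : ℕ} (t : TopSimplex n) : ℝ :=
  Finset.univ.inf' Finset.univ_nonempty t

lemma minCoord_le {n : ℕ} (t : TopSimplex n) (i) : minCoord t ≤ t i :=
  Finset.inf'_le _ (Finset.mem_univ i)

lemma exists_eq_minCoord {n : ℕ} (t : TopSimplex n) : ∃ i, t i = minCoord t := by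
  obtain ⟨i, -, h⟩ := Finset.exists_mem_eq_inf' (Finset.univ_nonempty (α := Fin (n + 1))) t
  exact ⟨i, h.symm⟩

lemma minCoord_nonneg {n : ℕ} (t : TopSimplex n) : 0 ≤ minCoord t := by
  obtain ⟨i, h⟩ := exists_eq_minCoord t
  rw [← h]
  exact stdSimplex.zero_le t i

lemma continuous_coord {n : ℕ} (i : Fin (n + 1)) : Continuous (fun t : TopSimplex n => t i) :=
  (continuous_apply i).comp continuous_subtype_val

lemma continuous_minCoord {n : ℕ} : Continuous (minCoord (n := n)) :=
  Continuous.finset_inf'_apply _ fun i _ => continuous_coord i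

/-- The smallest barycentric coordinate, normalized to be `1` at the barycenter.  It vanishes
exactly on the boundary. -/
noncomputable def depth {n : ℕ} (t : TopSimplex n) : ℝ := (n + 1) * minCoord t

lemma depth_nonneg {n : ℕ} (t : TopSimplex n) : 0 ≤ depth t :=
  mul_nonneg (by positivity) (minCoord_nonneg t)

lemma depth_pos {n : ℕ} {t : TopSimplex n} (ht : ∀ i, 0 < t i) : 0 < depth t := by
  obtain ⟨i, h⟩ := exists_eq_minCoord t
  exact mul_pos (by positivity) (h ▸ ht i)

lemma depth_eq_zero {n : ℕ} {t : TopSimplex n} (ht : ¬ ∀ i, 0 < t i) : depth t = 0 := by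
  push Not at ht
  obtain ⟨i, hi⟩ := ht
  have : minCoord t = 0 := le_antisymm ((minCoord_le t i).trans hi) (minCoord_nonneg t)
  simp [depth, this]

lemma continuous_depth {n : ℕ} : Continuous (depth (n := n)) :=
  continuous_const.mul continuous_minCoord

lemma depth_zero (t : TopSimplex 0) : depth t = 1 := by
  obtain ⟨i, h⟩ := exists_eq_minCoord t
  have h' := stdSimplex.sum_eq_one t
  rw [Fin.sum_univ_one, ← Fin.fin_one_eq_zero i] at h'
  simp [depth, ← h, h']

/-- The amount by which `shrink s t` lowers the depth before rescaling: `s`, cut off at the depth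
itself and at `1 / 2`. -/
noncomputable def clip {n : ℕ} (s : ℝ) (t : TopSimplex n) : ℝ :=
  max 0 (min s (min (depth t) (1 / 2)))

lemma clip_nonneg {n : ℕ} (s : ℝ) (t : TopSimplex n) : 0 ≤ clip s t := le_max_left _ _

lemma clip_le_depth {n : ℕ} (s : ℝ) (t : TopSimplex n) : clip s t ≤ depth t :=
  max_le (depth_nonneg t) ((min_le_right _ _).trans (min_le_left _ _))

lemma clip_le_half {n : ℕ} (s : ℝ) (t : TopSimplex n) : clip s t ≤ 1 / 2 :=
  max_le (by norm_num) ((min_le_right _ _).trans (min_le_right _ _))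

/-- Move a point of the simplex away from the barycenter, along the ray issued from it, lowering
each coordinate by the same amount before rescaling; the point never leaves the simplex, and the
motion is stopped before the barycenter would need infinite rescaling. -/
noncomputable def shrink {n : ℕ} (s : ℝ) (t : TopSimplex n) : TopSimplex n :=
  ⟨fun i => (t i - clip s t / (n + 1)) / (1 - clip s t), fun i => by
    have h1 := clip_le_depth s t
    have h2 := clip_le_half s t
    have h3 := minCoord_le t i
    have h4 : clip s t / (n + 1) ≤ minCoord t := by
      rw [div_le_iff₀ (by positivity)]
      unfold depth at h1
      linarith
    exact div_nonneg (by linarith) (by linarith), by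
    have h2 := clip_le_half s t
    rw [← Finset.sum_div, Finset.sum_sub_distrib]
    have := stdSimplex.sum_eq_one t
    have h3 : (1 - clip s t) ≠ 0 := by linarith
    change (∑ x, t x - _) / _ = _
    rw [this]
    simp only [Finset.sum_const, Finset.card_univ, Fintype.card_fin, nsmul_eq_mul]
    push_cast
    field_simp⟩

lemma shrink_apply {n : ℕ} (s : ℝ) (t : TopSimplex n) (i) :
    shrink s t i = (t i - clip s t / (n + 1)) / (1 - clip s t) := rfl

lemma continuous_clip {n : ℕ} : Continuous (fun p : ℝ × TopSimplex n => clip p.1 p.2) := by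
  unfold clip
  have := continuous_depth (n := n)
  fun_prop

lemma continuous_shrink {n : ℕ} : Continuous (fun p : ℝ × TopSimplex n => shrink p.1 p.2) := by
  refine Continuous.subtype_mk (continuous_pi fun i => ?_) _
  have := continuous_clip (n := n)
  refine Continuous.div ?_ (by fun_prop) fun p => ?_
  · exact ((continuous_coord i).comp continuous_snd).sub (by fun_prop)
  · have := clip_le_half p.1 p.2
    linarith

lemma shrink_of_clip_eq_zero {n : ℕ} {s : ℝ} {t : TopSimplex n} (h : clip s t = 0) :
    shrink s t = t := by
  ext i
  simp [shrink_apply, h]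

lemma shrink_of_depth_eq_zero {n : ℕ} (s : ℝ) {t : TopSimplex n} (h : depth t = 0) :
    shrink s t = t :=
  shrink_of_clip_eq_zero (le_antisymm (h ▸ clip_le_depth s t) (clip_nonneg s t))

lemma shrink_zero {n : ℕ} (t : TopSimplex n) : shrink 0 t = t :=
  shrink_of_clip_eq_zero (max_eq_left (min_le_left _ _))

/-- A point which is shrunk by at least its depth lands on the boundary. -/
lemma shrink_eq_zero {n : ℕ} {s : ℝ} {t : TopSimplex n} (h : depth t ≤ s) (hs : s ≤ 1 / 2) {i}
    (hi : t i = minCoord t) : shrink s t i = 0 := by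
  have : clip s t = depth t := by
    unfold clip
    rw [min_eq_left (h.trans hs), min_eq_right h, max_eq_right (depth_nonneg t)]
  rw [shrink_apply, this, hi, depth]
  field_simp
  simp

/-- The time left after a point of depth `q` has been pushed into the boundary, reparametrized: it
is `0` for `s ≤ 2 * q` and `s` for `s ≥ 4 * q`, so that the faces see the whole homotopy on a
neighbourhood of the boundary. -/
noncomputable def timeLeft (q : ℝ) (s : unitInterval) : unitInterval :=
  ⟨max 0 (min s (2 * s - 4 * q)), le_max_left _ _,
    max_le zero_le_one ((min_le_left _ _).trans s.2.2)⟩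

lemma continuous_timeLeft : Continuous (fun p : ℝ × unitInterval => timeLeft p.1 p.2) :=
  Continuous.subtype_mk (by fun_prop) _

lemma timeLeft_zero (s : unitInterval) : timeLeft 0 s = s := by
  apply Subtype.ext
  have := s.2.1
  simp only [timeLeft, mul_zero, sub_zero]
  rw [min_eq_left (by linarith), max_eq_right this]

lemma timeLeft_eq_zero {q : ℝ} {s : unitInterval} (h : s ≤ 2 * q) : timeLeft q s = 0 := by
  apply Subtype.ext
  simp only [timeLeft]
  exact max_eq_left ((min_le_right _ _).trans (by linarith))

lemma timeLeft_one {q : ℝ} (h : 4 * q ≤ 1) : timeLeft q 1 = 1 := by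
  apply Subtype.ext
  simp only [timeLeft, Set.Icc.coe_one]
  rw [min_eq_left (by linarith)]
  simp

variable {X Y : SSet.{u}}

lemma cellDim_shrink_lt {n : ℕ} (x : X _⦋n⦌) {s : ℝ} {t : TopSimplex n} (h : depth t ≤ s)
    (hs : s ≤ 1 / 2) : cellDim (pt X x (shrink s t)) < n := by
  obtain ⟨i, hi⟩ := exists_eq_minCoord t
  exact cellDim_pt_lt x (shrink_eq_zero h hs hi)

/-- The collar homotopy of `|X|`: at time `s`, a point of an open cell is pushed away from the
barycenter of the cell; if it reaches the boundary, it is moved further by the collar homotopy at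
the remaining time. -/
noncomputable def collar (s : unitInterval) (p : SSet.toTop.obj X) : SSet.toTop.obj X :=
  open Classical in
  if h : 2 * depth (coord p) ≤ s then
    have : cellDim (pt X (cell p) (shrink (s / 2) (coord p))) < cellDim p :=
      cellDim_shrink_lt _ (by linarith) (by have := s.2.2; linarith)
    collar (timeLeft (depth (coord p)) s) (pt X (cell p) (shrink (s / 2) (coord p)))
  else pt X (cell p) (shrink (s / 2) (coord p))
termination_by cellDim p

lemma collar_zero (p : SSet.toTop.obj X) : collar 0 p = p := by
  rw [collar, dif_neg]
  · simp only [Set.Icc.coe_zero, zero_div, shrink_zero]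
    exact pt_cell_coord p
  · have := depth_pos (coord_pos p)
    simp only [Set.Icc.coe_zero]
    linarith

lemma collar_pt {n : ℕ} {x : X _⦋n⦌} (hx : x ∈ X.nonDegenerate n) (t : TopSimplex n)
    (s : unitInterval) :
    collar s (pt X x t) = collar (timeLeft (depth t) s) (pt X x (shrink (s / 2) t)) := by
  by_cases ht : ∀ i, 0 < t i
  · rw [collar]
    refine cell_cases hx ht (P := fun m y r =>
      (if h : 2 * depth r ≤ s then
        collar (timeLeft (depth r) s) (pt X y (shrink (s / 2) r))
      else pt X y (shrink (s / 2) r)) =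
      collar (timeLeft (depth t) s) (pt X x (shrink (s / 2) t))) ?_
    split_ifs with h
    · rfl
    · rw [timeLeft_eq_zero (by linarith), collar_zero]
  · rw [depth_eq_zero ht, timeLeft_zero, shrink_of_depth_eq_zero _ (depth_eq_zero ht)]

/-- The collar homotopy is continuous on each simplex, even after composition with a function
which is only continuous simplexwise, and with a parameter space `E`. -/
lemma continuous_collar_pt {E Z : Type*} [TopologicalSpace E] [TopologicalSpace Z]
    (g : SSet.toTop.obj X → E → Z)
    (hg : ∀ (n : ℕ) (x : X _⦋n⦌), Continuous (fun p : TopSimplex n × E => g (pt X x p.1) p.2))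
    (n : ℕ) (x : X _⦋n⦌) :
    Continuous (fun p : TopSimplex n × unitInterval × E =>
      g (collar p.2.1 (pt X x p.1)) p.2.2) := by
  induction n using Nat.strong_induction_on with
  | _ n ih =>
  by_cases hx : x ∈ X.nonDegenerate n
  · have hcp : (fun p : TopSimplex n × unitInterval × E => g (collar p.2.1 (pt X x p.1)) p.2.2) =
        fun p => g (collar (timeLeft (depth p.1) p.2.1) (pt X x (shrink (p.2.1 / 2) p.1))) p.2.2 :=
      funext fun p => by rw [collar_pt hx]
    rw [hcp]
    let S : Option (Fin (n + 1)) → Set (TopSimplex n × unitInterval × E) := fun o =>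
      o.elim {p | (p.2.1 : ℝ) ≤ 2 * depth p.1}
        (fun i => {p | 2 * depth p.1 ≤ p.2.1 ∧ p.1 i ≤ minCoord p.1})
    have hq : Continuous (fun p : TopSimplex n × unitInterval × E => depth p.1) :=
      continuous_depth.comp continuous_fst
    have hs : Continuous (fun p : TopSimplex n × unitInterval × E => (p.2.1 : ℝ)) := by fun_prop
    have hsh : Continuous (fun p : TopSimplex n × unitInterval × E =>
        shrink ((p.2.1 : ℝ) / 2) p.1) :=
      continuous_shrink.comp (by fun_prop : Continuous fun p : TopSimplex n × unitInterval × E =>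
        ((p.2.1 : ℝ) / 2, p.1))
    refine LocallyFinite.continuous (f := S) (locallyFinite_of_finite S) ?_ ?_ ?_
    · refine Set.eq_univ_of_forall fun p => Set.mem_iUnion.2 ?_
      rcases le_total (p.2.1 : ℝ) (2 * depth p.1) with h | h
      · exact ⟨none, h⟩
      · obtain ⟨i, hi⟩ := exists_eq_minCoord p.1
        exact ⟨some i, h, hi.le⟩
    · rintro (_ | i)
      · exact isClosed_le hs (continuous_const.mul hq)
      · exact (isClosed_le (continuous_const.mul hq) hs).inter
          (isClosed_le ((continuous_coord i).comp continuous_fst)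
            (continuous_minCoord.comp continuous_fst))
    · rintro (_ | i)
      · refine ContinuousOn.congr (f := fun p => g (pt X x (shrink ((p.2.1 : ℝ) / 2) p.1)) p.2.2)
          (Continuous.continuousOn ?_) fun p hp => ?_
        · exact (hg n x).comp (hsh.prodMk (by fun_prop : Continuous
            fun p : TopSimplex n × unitInterval × E => p.2.2))
        · simp only
          rw [timeLeft_eq_zero hp, collar_zero]
      · cases n with
        | zero =>
          have : S (some i) = ∅ := by
            refine Set.eq_empty_of_forall_notMem fun p hp => ?_
            have h1 := hp.1
            have h2 := p.2.1.2.2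
            rw [depth_zero] at h1
            linarith
          rw [this]
          exact continuousOn_empty _
        | succ n =>
          rw [continuousOn_iff_continuous_domRestrict]
          have hz : ∀ p : S (some i), shrink ((p.1.2.1 : ℝ) / 2) p.1.1 i = 0 := fun p =>
            shrink_eq_zero (by have := p.2.1; linarith)
              (by have := p.1.2.1.2.2; linarith) (le_antisymm p.2.2 (minCoord_le _ _))
          have hd : Continuous (fun p : S (some i) => dropCoord i _ (hz p)) := by
            refine Continuous.subtype_mk (continuous_pi fun j => ?_) _
            exact (continuous_coord (i.succAbove j)).comp (hsh.comp continuous_subtype_val)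
          have := (ih n (Nat.lt_succ_self n) (X.map (SimplexCategory.δ i).op x)).comp
            (hd.prodMk ((continuous_timeLeft.comp ((hq.comp continuous_subtype_val).prodMk
              (by fun_prop : Continuous fun p : S (some i) => p.1.2.1))).prodMk
              (by fun_prop : Continuous fun p : S (some i) => p.1.2.2)))
          convert this using 1
          ext p
          simp only [Function.comp, Set.domRestrict_apply]
          rw [pt_map, map_dropCoord]
  · obtain ⟨m, hm, θ, y, rfl⟩ := pt_degenerate hx
    simp only [pt_map]
    exact (ih m hm y).comp (((stdSimplex.continuous_map θ).comp continuous_fst).prodMk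
      continuous_snd)

/-- The collar homotopy is continuous. -/
lemma continuous_collar :
    Continuous (fun p : SSet.toTop.obj X × unitInterval => collar p.2 p.1) := by
  refine continuous_prod_iff_pt.2 fun n x => ?_
  exact (continuous_collar_pt (E := Unit) (fun p _ => p)
    (fun n x => (pt X x).continuous.comp continuous_fst) n x).comp
    (by fun_prop : Continuous fun p : TopSimplex n × unitInterval => (p.1, p.2, ()))

/-- The collar homotopy commutes with maps preserving nondegenerate simplices. -/
lemma toTop_map_collar (f : X ⟶ Y)
    (hf : ∀ (n : ℕ) (x : X _⦋n⦌), x ∈ X.nonDegenerate n → f.app _ x ∈ Y.nonDegenerate n)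
    (s : unitInterval) (p : SSet.toTop.obj X) :
    SSet.toTop.map f (collar s p) = collar s (SSet.toTop.map f p) := by
  induction h : cellDim p using Nat.strong_induction_on generalizing s p with
  | _ d ih =>
  obtain ⟨n, x, t, hx, ht, rfl⟩ := exists_interior p
  rw [cellDim_pt hx ht] at h
  subst h
  rw [toTop_map_pt, collar_pt hx, collar_pt (hf n x hx)]
  by_cases hs : 2 * depth t ≤ s
  · rw [ih _ (cellDim_shrink_lt x (s := s / 2) (by linarith) (by have := s.2.2; linarith))
      _ _ rfl, toTop_map_pt]
  · rw [timeLeft_eq_zero (by linarith), collar_zero, collar_zero, toTop_map_pt]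

/-- The normal form of a point of `|X|` is unique. -/
lemma canon_eq {n n' : ℕ} {x : X _⦋n⦌} {x' : X _⦋n'⦌} (hx : x ∈ X.nonDegenerate n)
    (hx' : x' ∈ X.nonDegenerate n') {t : TopSimplex n} {t' : TopSimplex n'} (ht : ∀ i, 0 < t i)
    (ht' : ∀ i, 0 < t' i) (h : pt X x t = pt X x' t') :
    (⟨n, ⟨x, hx⟩, t⟩ : Canon X) = ⟨n', ⟨x', hx'⟩, t'⟩ :=
  (normalForm_pt ⟨x, hx⟩ ht).symm.trans
    ((congrArg (normalForm X) h).trans (normalForm_pt ⟨x', hx'⟩ ht'))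

end Realization

end Collar

namespace Realization

/-- The points which the collar pushes, through the successive skeleta, into the subset `N` of
the cell of `x`. -/
inductive CollarNhd {X : SSet.{u}} {n : ℕ} (x : X.obj (Opposite.op (SimplexCategory.mk n)))
    (N : Set (TopSimplex n)) : SSet.toTop.obj X → Prop where
  | base (t : TopSimplex n) : t ∈ N → CollarNhd x N (pt X x t)
  | step {m : ℕ} (y : X.obj (Opposite.op (SimplexCategory.mk m))) (t : TopSimplex m) :
      y ∈ X.nonDegenerate m → (∀ i, 0 < t i) → n < m → 4 * depth t < 1 →
      CollarNhd x N (pt X y (shrink (1 / 2) t)) → CollarNhd x N (pt X y t)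

end Realization

section Collar

open Simplicial Opposite

namespace Realization

variable {X Y : SSet.{u}}

section CollarNhd

variable {n : ℕ} {x : X _⦋n⦌} {N : Set (TopSimplex n)}

lemma CollarNhd.exists_collar_eq {p : SSet.toTop.obj X} (h : CollarNhd x N p) :
    ∃ t ∈ N, collar 1 p = collar 1 (pt X x t) := by
  induction h with
  | base t ht => exact ⟨t, ht, rfl⟩
  | step y t hy _ _ hq _ ih =>
    obtain ⟨r, hr, e⟩ := ih
    refine ⟨r, hr, ?_⟩
    rw [collar_pt hy, timeLeft_one hq.le, Set.Icc.coe_one, e]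

lemma collarNhd_iff_of_lt {m : ℕ} {y : X _⦋m⦌} (hy : y ∈ X.nonDegenerate m) (hm : n < m)
    (t : TopSimplex m) :
    CollarNhd x N (pt X y t) ↔ 4 * depth t < 1 ∧ CollarNhd x N (pt X y (shrink (1 / 2) t)) := by
  by_cases ht : ∀ i, 0 < t i
  · refine ⟨fun h => ?_, fun h => .step y t hy ht hm h.1 h.2⟩
    generalize hp : pt X y t = p at h
    cases h with
    | base t' ht' =>
      have h1 := cellDim_pt_le x t'
      rw [← hp, cellDim_pt hy ht] at h1
      omega
    | step y' t' hy' ht' hm' hq' h' =>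
      have := canon_eq hy hy' ht ht' hp
      obtain rfl := congrArg Sigma.fst this
      obtain ⟨rfl, rfl⟩ : y = y' ∧ t = t' := by simpa using this
      exact ⟨hq', h'⟩
  · have := depth_eq_zero ht
    rw [shrink_of_depth_eq_zero _ this, this]
    simp

variable (hx : x ∈ X.nonDegenerate n) (hN : ∀ t ∈ N, ∀ i, 0 < t i)
include hx hN

lemma le_cellDim_of_collarNhd {p : SSet.toTop.obj X} (h : CollarNhd x N p) : n ≤ cellDim p := by
  cases h with
  | base t ht => rw [cellDim_pt hx (hN t ht)]
  | step y t hy ht hm hq h' =>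
    rw [cellDim_pt hy ht]
    exact hm.le

lemma collarNhd_iff_of_eq {y : X _⦋n⦌} (hy : y ∈ X.nonDegenerate n) (t : TopSimplex n) :
    CollarNhd x N (pt X y t) ↔ y = x ∧ t ∈ N := by
  constructor
  · intro h
    have ht : ∀ i, 0 < t i := by
      by_contra hc
      push Not at hc
      obtain ⟨i, hi⟩ := hc
      have h1 := cellDim_pt_lt y (le_antisymm hi (stdSimplex.zero_le t i))
      have h2 := le_cellDim_of_collarNhd hx hN h
      omega
    generalize hp : pt X y t = p at h
    cases h with
    | base t' ht' =>
      have := canon_eq hy hx ht (hN t' ht') hp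
      obtain ⟨rfl, rfl⟩ : y = x ∧ t = t' := by simpa using this
      exact ⟨rfl, ht'⟩
    | step y' t' hy' ht' hm' hq' h' =>
      have := congrArg Sigma.fst (canon_eq hy hy' ht ht' hp)
      dsimp only at this
      omega
  · rintro ⟨rfl, h⟩
    exact .base t h

lemma isOpen_collarNhd (hNo : IsOpen N) : IsOpen {p | CollarNhd x N p} := by
  rw [isOpen_iff_pt]
  intro m y
  induction m using Nat.strong_induction_on with
  | _ m ih =>
  by_cases hy : y ∈ X.nonDegenerate m
  · rcases lt_trichotomy m n with h | rfl | h
    · convert isOpen_empty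
      refine Set.eq_empty_of_forall_notMem fun t ht => ?_
      have h1 := cellDim_pt_le y t
      have h2 := le_cellDim_of_collarNhd hx hN ht
      omega
    · have : (pt X y) ⁻¹' {p | CollarNhd x N p} = {t | y = x ∧ t ∈ N} :=
        Set.ext fun t => collarNhd_iff_of_eq hx hN hy t
      rw [this]
      exact isOpen_const.and hNo
    · obtain ⟨m, rfl⟩ : ∃ k, m = k + 1 := ⟨m - 1, by omega⟩
      -- the complement is a finite union of closed sets, one for each face
      rw [← isClosed_compl_iff]
      let F : Fin (m + 2) → Set (TopSimplex (m + 1)) := fun i =>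
        {t | 4 * depth t ≤ 1 ∧ t i ≤ minCoord t ∧ ¬ CollarNhd x N (pt X y (shrink (1 / 2) t))}
      have hc : (pt X y ⁻¹' {p | CollarNhd x N p})ᶜ = {t | 1 ≤ 4 * depth t} ∪ ⋃ i, F i := by
        ext t
        simp only [Set.mem_compl_iff, Set.mem_preimage, Set.mem_ofPred_eq, Set.mem_union,
          Set.mem_iUnion]
        rw [collarNhd_iff_of_lt hy h]
        constructor
        · intro hn
          by_cases hq : 1 ≤ 4 * depth t
          · exact Or.inl hq
          · push Not at hq
            obtain ⟨i, hi⟩ := exists_eq_minCoord t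
            exact Or.inr ⟨i, hq.le, hi.le, fun hk => hn ⟨hq, hk⟩⟩
        · rintro (hq | ⟨i, -, -, hk⟩) ⟨h1, h2⟩
          · linarith
          · exact hk h2
      rw [hc]
      refine (isClosed_le continuous_const (continuous_const.mul continuous_depth)).union
        (isClosed_iUnion_of_finite fun i => ?_)
      let A : Set (TopSimplex (m + 1)) := {t | 4 * depth t ≤ 1 ∧ t i ≤ minCoord t}
      have hA : IsClosed A :=
        (isClosed_le (continuous_const.mul continuous_depth) continuous_const).inter
          (isClosed_le (continuous_coord i) continuous_minCoord)
      have hz : ∀ t : A,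
          shrink (1 / 2) t.1 i = 0 := fun t =>
        shrink_eq_zero (by have := t.2.1; have := depth_nonneg t.1; linarith) le_rfl
          (le_antisymm t.2.2 (minCoord_le _ _))
      have hd : Continuous (fun t : A => dropCoord i _ (hz t)) := by
        refine Continuous.subtype_mk (continuous_pi fun j => ?_) _
        exact (continuous_coord (i.succAbove j)).comp (continuous_shrink.comp
          (by fun_prop : Continuous fun t : A => ((1 / 2 : ℝ), t.1)))
      have hcl := ((ih m (Nat.lt_succ_self m)
        (X.map (SimplexCategory.δ i).op y)).isClosed_compl.preimage hd).trans hA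
      convert hcl using 1
      ext t
      simp only [F, Set.mem_ofPred_eq, Set.mem_image, Set.mem_preimage, Set.mem_compl_iff]
      constructor
      · rintro ⟨h1, h2, h3⟩
        refine ⟨⟨t, h1, h2⟩, ?_, rfl⟩
        rwa [pt_map, map_dropCoord]
      · rintro ⟨r, hr, rfl⟩
        rw [pt_map, map_dropCoord] at hr
        exact ⟨r.2.1, r.2.2, hr⟩
  · obtain ⟨k, hk, θ, z, rfl⟩ := pt_degenerate hy
    have := (ih k hk z).preimage (stdSimplex.continuous_map (S := ℝ) θ)
    convert this using 1
    ext t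
    simp only [Set.mem_preimage, pt_map]

end CollarNhd

/-- At the end of the collar homotopy, each point has a neighbourhood which is mapped into the
image of a single closed cell.  This is why a function which is only continuous simplexwise on
`|X| × E`, for an arbitrary space `E`, becomes continuous for the product topology. -/
lemma continuous_collar_one {E Z : Type*} [TopologicalSpace E] [TopologicalSpace Z]
    (g : SSet.toTop.obj X → E → Z)
    (hg : ∀ (n : ℕ) (x : X _⦋n⦌), Continuous (fun p : TopSimplex n × E => g (pt X x p.1) p.2)) :
    Continuous (fun p : SSet.toTop.obj X × E => g (collar 1 p.1) p.2) := by
  rw [continuous_iff_continuousAt]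
  rintro ⟨p, e⟩ V hV
  obtain ⟨n, x, t, hx, ht, rfl⟩ := exists_interior p
  have h1 : Continuous (fun q : TopSimplex n × E => g (collar 1 (pt X x q.1)) q.2) :=
    (continuous_collar_pt g hg n x).comp
      (by fun_prop : Continuous fun q : TopSimplex n × E => (q.1, (1 : unitInterval), q.2))
  have h2 := h1.continuousAt (x := (t, e)) hV
  rw [Filter.mem_map, nhds_prod_eq, Filter.mem_prod_iff] at h2
  obtain ⟨N, hN, B, hB, hNB⟩ := h2
  have hpos : IsOpen (⋂ i, (fun r : TopSimplex n => r i) ⁻¹' Set.Ioi 0) :=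
    isOpen_iInter_of_finite fun i => isOpen_Ioi.preimage (continuous_coord i)
  obtain ⟨N', hN'sub, hN'o, hN't⟩ := mem_nhds_iff.1
    (Filter.inter_mem hN (hpos.mem_nhds (Set.mem_iInter.2 ht)))
  have hU := isOpen_collarNhd hx (fun r hr i => Set.mem_iInter.1 (hN'sub hr).2 i) hN'o
  rw [Filter.mem_map, nhds_prod_eq]
  refine Filter.mem_of_superset (Filter.prod_mem_prod (hU.mem_nhds (.base t hN't)) hB) ?_
  rintro ⟨p', e'⟩ ⟨hp', he'⟩
  obtain ⟨r, hr, hre⟩ := CollarNhd.exists_collar_eq hp'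
  have := @hNB (r, e') ⟨(hN'sub hr).1, he'⟩
  rw [Set.mem_preimage] at this ⊢
  rw [hre]
  exact this

end Realization

end Collar

/-! ### Simplicial sets of chains in a finite poset -/

section FinitePoset

open Simplicial Opposite

namespace Realization

lemma sum_map {X Y : Type*} [Fintype X] [Fintype Y] (f : X → Y) (t : stdSimplex ℝ X)
    (p : Y → Prop) [DecidablePred p] :
    ∑ y with p y, stdSimplex.map f t y = ∑ x with p (f x), t x := by
  classical
  simp only [map_apply]
  rw [← Finset.sum_fiberwise_of_maps_to (s := Finset.univ.filter fun x => p (f x))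
    (t := Finset.univ.filter p) (g := f) (fun x hx => by simpa using hx)]
  refine Finset.sum_congr rfl fun y hy => ?_
  rw [Finset.filter_filter]
  refine Finset.sum_congr ?_ fun _ _ => rfl
  ext x
  have : p y := by simpa using hy
  simp only [Finset.mem_filter, Finset.mem_univ, true_and]
  exact ⟨fun h => ⟨h ▸ this, h⟩, fun h => h.2⟩

/-- A function on a finite poset is determined by its sums over principal lower sets. -/
lemma eq_of_sum_le_eq {P : Type*} [Fintype P] [PartialOrder P] [DecidableLE P] {f g : P → ℝ}
    (h : ∀ p, ∑ q with q ≤ p, f q = ∑ q with q ≤ p, g q) : f = g := by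
  classical
  ext p
  induction p using WellFoundedLT.induction with
  | _ p ih =>
  have key : ∀ k : P → ℝ, ∑ q with q ≤ p, k q = k p + ∑ q with q < p, k q := fun k => by
    have : (Finset.univ.filter fun q => q ≤ p) = insert p (Finset.univ.filter fun q => q < p) := by
      ext q
      simp [le_iff_eq_or_lt]
    rw [this, Finset.sum_insert (by simp)]
  have h1 := h p
  rw [key, key, Finset.sum_congr rfl fun q hq => ih q (by simpa using hq)] at h1
  linarith

/-- A probability measure on a finite poset which is supported on a chain comes from a point in
the interior of a simplex. -/
lemma exists_chain {P : Type*} [Fintype P] [PartialOrder P] (μ : stdSimplex ℝ P)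
    (hμ : ∀ p q, 0 < μ p → 0 < μ q → p ≤ q ∨ q ≤ p) :
    ∃ (k : ℕ) (c : Fin (k + 1) →o P) (w : TopSimplex k),
      (∀ i, 0 < μ (c i)) ∧ stdSimplex.map c w = μ := by
  classical
  let S := {p // 0 < μ p}
  let _ : LinearOrder S :=
    { (inferInstance : PartialOrder S) with
      le_total := fun a b => hμ a b a.2 b.2
      toDecidableLE := Classical.decRel _ }
  have hsum : ∑ p : S, μ p.1 = 1 := by
    rw [← stdSimplex.sum_eq_one μ,
      ← Finset.sum_subtype (Finset.univ.filter fun p => 0 < μ p) (by simp) μ,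
      Finset.sum_filter_of_ne]
    intro p _ hp
    exact lt_of_le_of_ne (stdSimplex.zero_le μ p) (Ne.symm hp)
  have hne : Nonempty S := by
    by_contra hc
    rw [not_nonempty_iff] at hc
    simp at hsum
  obtain ⟨k, hk⟩ : ∃ k, Fintype.card S = k + 1 :=
    ⟨Fintype.card S - 1, by have := Fintype.card_pos (α := S); omega⟩
  let e := Fintype.orderIsoFinOfCardEq S hk
  let c : Fin (k + 1) →o P := ⟨fun i => (e i).1, fun i j h => e.monotone h⟩
  have hc : StrictMono c := fun i j h => e.strictMono h
  refine ⟨k, c, ⟨fun i => μ (c i), fun i => stdSimplex.zero_le μ _, ?_⟩, fun i => (e i).2, ?_⟩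
  · rw [← hsum]
    exact Fintype.sum_equiv e.toEquiv _ _ fun i => rfl
  · ext p
    by_cases hp : 0 < μ p
    · have : p = c (e.symm ⟨p, hp⟩) := by
        change p = (e (e.symm ⟨p, hp⟩)).1
        rw [OrderIso.apply_symm_apply]
      rw [this, map_injective_apply hc.injective]
      rfl
    · rw [map_apply_notMem_range]
      · exact le_antisymm (stdSimplex.zero_le μ p) (not_lt.1 hp)
      · rintro ⟨i, rfl⟩
        exact hp (e i).2

section VertexMap

variable {Y : SSet.{u}} {P : Type} [Fintype P] [PartialOrder P]
  (v : ∀ k : ℕ, Y _⦋k⦌ → (Fin (k + 1) →o P))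
  (hv : ∀ {k l : ℕ} (θ : ⦋k⦌ ⟶ ⦋l⦌) (y : Y _⦋l⦌) (i : Fin (k + 1)),
    v k (Y.map θ.op y) i = v l y (θ i))
  (hinj : ∀ k : ℕ, Function.Injective (v k))

include hv

/-- If each simplex of `Y` has vertices forming a chain in the finite poset `P`, then the
realization of `Y` maps to the probability measures on `P`: the barycentric coordinates of a point
are the masses of the vertices. -/
noncomputable def toMeasure : SSet.toTop.obj Y ⟶ TopCat.of (ULift.{u} (stdSimplex ℝ P)) :=
  ptDesc (fun _ y => ⟨fun t => ⟨stdSimplex.map (v _ y) t⟩,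
      continuous_uliftUp.comp (stdSimplex.continuous_map _)⟩) (fun m n θ x t => by
    apply ULift.ext
    change stdSimplex.map (v _ (Y.map θ.op x)) t = stdSimplex.map (v _ x) (stdSimplex.map θ t)
    rw [stdSimplex.map_comp_apply]
    exact congrArg (fun f => stdSimplex.map f t) (funext fun i => hv θ x i))

lemma toMeasure_pt {n : ℕ} (y : Y _⦋n⦌) (t : TopSimplex n) :
    (toMeasure v hv (pt Y y t)).down = stdSimplex.map (v _ y) t :=
  congrArg ULift.down (ptDesc_pt _ _ y t)

include hinj

omit [Fintype P] in
lemma strictMono_of_nonDegenerate {n : ℕ} {y : Y _⦋n⦌} (hy : y ∈ Y.nonDegenerate n) :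
    StrictMono (v _ y) := by
  cases n with
  | zero => exact fun i j h => absurd h (by have := i.2; have := j.2; omega)
  | succ n =>
    rw [Fin.strictMono_iff_lt_succ]
    intro i
    refine lt_of_le_of_ne ((v _ y).monotone i.castSucc_le_succ) fun h => ?_
    refine hy ⟨n, Nat.lt_succ_self n, SimplexCategory.σ i,
      Y.map (SimplexCategory.δ i.succ).op y, hinj _ ?_⟩
    ext j : 2
    rw [hv, hv]
    change v _ y (i.succ.succAbove (i.predAbove j)) = v _ y j
    by_cases hj : j = i.succ
    · subst hj
      rw [Fin.predAbove_succ_self, Fin.succAbove_succ_self, h]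
    · rw [Fin.succ_succAbove_predAbove hj]

/-- If simplices are determined by their vertices, then points of the realization are determined by
their barycentric coordinates. -/
lemma toMeasure_injective : Function.Injective (toMeasure v hv) := by
  classical
  intro p q h
  obtain ⟨n, x, t, hx, ht, rfl⟩ := exists_interior p
  obtain ⟨n', x', t', hx', ht', rfl⟩ := exists_interior q
  have h1 := strictMono_of_nonDegenerate v hv hinj hx
  have h2 := strictMono_of_nonDegenerate v hv hinj hx'
  have h := congrArg ULift.down h
  rw [toMeasure_pt, toMeasure_pt] at h
  have hrange : ∀ {k : ℕ} (c : Fin (k + 1) →o P) (hc : StrictMono c) (w : TopSimplex k)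
      (_ : ∀ i, 0 < w i), Set.range c = {p | stdSimplex.map c w p ≠ 0} := by
    intro k c hc w hw
    ext p
    constructor
    · rintro ⟨i, rfl⟩
      change stdSimplex.map c w (c i) ≠ 0
      rw [map_injective_apply hc.injective]
      exact (hw i).ne'
    · intro hp
      by_contra hn
      exact hp (map_apply_notMem_range w hn)
  have hr : Set.range (v _ x) = Set.range (v _ x') := by
    rw [hrange _ h1 t ht, hrange _ h2 t' ht', h]
  have hn : n = n' := by
    have h3 := Set.card_range_of_injective h1.injective
    have h4 := Set.card_range_of_injective h2.injective
    have h5 : Fintype.card (Set.range (v _ x)) = Fintype.card (Set.range (v _ x')) :=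
      Fintype.card_congr (Equiv.setCongr hr)
    rw [h3, h4] at h5
    simpa using h5
  subst hn
  have hx : v _ x = v _ x' := OrderHom.ext _ _ ((StrictMono.range_inj h1 h2).1 hr)
  obtain rfl := hinj _ hx
  have : t = t' := by
    ext i
    rw [← map_injective_apply h1.injective t, ← map_injective_apply h1.injective t', h]
  rw [this]

lemma compactSpace_of_vertexMap : CompactSpace (SSet.toTop.obj Y) := by
  classical
  have hfin : ∀ k : ℕ, Finite (Y _⦋k⦌) := fun k =>
    Finite.of_injective (fun y => (v k y : Fin (k + 1) → P))
      (DFunLike.coe_injective.comp (hinj k))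
  have hcov : (Set.univ : Set (SSet.toTop.obj Y)) =
      ⋃ k : Fin (Fintype.card P), ⋃ y : Y _⦋(k : ℕ)⦌, Set.range (pt Y y) := by
    refine (Set.eq_univ_of_forall fun p => ?_).symm
    obtain ⟨n, x, t, hx, ht, rfl⟩ := exists_interior p
    have h1 := strictMono_of_nonDegenerate v hv hinj hx
    have h2 := Fintype.card_le_of_injective _ h1.injective
    rw [Fintype.card_fin] at h2
    exact Set.mem_iUnion.2 ⟨⟨n, h2⟩, Set.mem_iUnion.2 ⟨x, t, rfl⟩⟩
  refine ⟨?_⟩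
  rw [hcov]
  exact isCompact_iUnion fun k => isCompact_iUnion fun y => isCompact_range (pt Y y).continuous

end VertexMap

/-! ### Couplings of probability measures on finite chains -/

/-- The mass of the first `k` points. -/
noncomputable def cdf {n : ℕ} (t : TopSimplex n) (k : ℕ) : ℝ :=
  ∑ i : Fin (n + 1) with i.val < k, t i

lemma cdf_zero {n : ℕ} (t : TopSimplex n) : cdf t 0 = 0 := by simp [cdf]

lemma cdf_last {n : ℕ} (t : TopSimplex n) : cdf t (n + 1) = 1 := by
  rw [← stdSimplex.sum_eq_one t, cdf]
  exact Finset.sum_congr (Finset.filter_true_of_mem fun i _ => i.2) fun _ _ => rfl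

lemma cdf_succ {n : ℕ} (t : TopSimplex n) (i : Fin (n + 1)) :
    cdf t (i.val + 1) = cdf t i.val + t i := by
  have : (Finset.univ.filter fun j : Fin (n + 1) => j.val < i.val + 1) =
      insert i (Finset.univ.filter fun j : Fin (n + 1) => j.val < i.val) := by
    ext j
    simp only [Finset.mem_filter, Finset.mem_univ, true_and, Finset.mem_insert, Fin.ext_iff]
    omega
  rw [cdf, this, Finset.sum_insert (by simp), cdf, add_comm]

lemma cdf_mono {n : ℕ} (t : TopSimplex n) : Monotone (cdf t) := fun k l h =>
  Finset.sum_le_sum_of_subset_of_nonneg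
    (fun i hi => by
      simp only [Finset.mem_filter, Finset.mem_univ, true_and] at hi ⊢
      omega) fun i _ _ => stdSimplex.zero_le t i

lemma sum_telescope {n : ℕ} (t : TopSimplex n) (g : ℝ → ℝ) :
    ∑ i : Fin (n + 1), (g (cdf t (i.val + 1)) - g (cdf t i.val)) = g 1 - g 0 := by
  rw [Fin.sum_univ_eq_sum_range (fun k => g (cdf t (k + 1)) - g (cdf t k)) (n + 1),
    Finset.sum_range_sub (fun k => g (cdf t k)), cdf_last, cdf_zero]

lemma cdf_mem {n : ℕ} (t : TopSimplex n) {k : ℕ} (hk : k ≤ n + 1) : 0 ≤ cdf t k ∧ cdf t k ≤ 1 := by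
  rw [← cdf_zero t, ← cdf_last t]
  exact ⟨cdf_mono t (Nat.zero_le k), cdf_mono t hk⟩

/-- The length of the intersection of the intervals `[a, b]` and `[c, d]`. -/
noncomputable def overlap (a b c d : ℝ) : ℝ := max 0 (min b d - max a c)

lemma overlap_comm (a b c d : ℝ) : overlap a b c d = overlap c d a b := by
  rw [overlap, overlap, min_comm, max_comm a c]

lemma overlap_eq {a b c d : ℝ} (h : a ≤ b) (h' : c ≤ d) :
    overlap a b c d = max a (min d b) - max a (min c b) := by
  unfold overlap
  rcases le_total b d with h1 | h1 <;> rcases le_total a c with h2 | h2 <;>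
  rcases le_total c b with h3 | h3 <;> rcases le_total a d with h4 | h4 <;>
  simp only [min_eq_left, min_eq_right, max_eq_left, max_eq_right, h1, h2, h3, h4, h] <;>
  first
  | (apply max_eq_right; linarith)
  | (rw [max_eq_left (by linarith)]; linarith)

lemma sum_overlap {n : ℕ} (t : TopSimplex n) {a b : ℝ} (h : a ≤ b) (ha : 0 ≤ a) (hb : b ≤ 1) :
    ∑ i : Fin (n + 1), overlap a b (cdf t i.val) (cdf t (i.val + 1)) = b - a := by
  rw [Finset.sum_congr rfl fun i _ => overlap_eq h (cdf_mono t (Nat.le_succ _)),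
    sum_telescope t fun x => max a (min x b)]
  rw [min_eq_right hb, min_eq_left (by linarith), max_eq_right h, max_eq_left ha]

/-- The monotone coupling of two probability measures on finite chains: the mass of `(i, j)` is
the length of the intersection of the `i`-th interval of the first subdivision of `[0, 1]` with
the `j`-th interval of the second. -/
noncomputable def coupling {n m : ℕ} (t : TopSimplex n) (s : TopSimplex m) :
    stdSimplex ℝ (Fin (n + 1) × Fin (m + 1)) :=
  ⟨fun p => overlap (cdf t p.1.val) (cdf t (p.1.val + 1)) (cdf s p.2.val) (cdf s (p.2.val + 1)),
    fun p => le_max_left _ _, by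
    rw [Fintype.sum_prod_type, ← stdSimplex.sum_eq_one t]
    refine Finset.sum_congr rfl fun i _ => ?_
    change ∑ j : Fin (m + 1), overlap _ _ (cdf s j.val) (cdf s (j.val + 1)) = t i
    rw [sum_overlap s (cdf_mono t (Nat.le_succ _)) (cdf_mem t i.2.le).1 (cdf_mem t i.2).2,
      cdf_succ]
    ring⟩

lemma coupling_apply {n m : ℕ} (t : TopSimplex n) (s : TopSimplex m) (p) : coupling t s p =
    overlap (cdf t p.1.val) (cdf t (p.1.val + 1)) (cdf s p.2.val) (cdf s (p.2.val + 1)) := rfl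

lemma map_fst_coupling {n m : ℕ} (t : TopSimplex n) (s : TopSimplex m) :
    stdSimplex.map Prod.fst (coupling t s) = t := by
  ext i
  rw [map_apply, Finset.sum_filter, Fintype.sum_prod_type, Finset.sum_eq_single i]
  · simp only [if_true, coupling_apply]
    rw [sum_overlap s (cdf_mono t (Nat.le_succ _)) (cdf_mem t i.2.le).1 (cdf_mem t i.2).2,
      cdf_succ]
    ring
  · intro j _ hj
    simp [hj]
  · simp

lemma map_snd_coupling {n m : ℕ} (t : TopSimplex n) (s : TopSimplex m) :
    stdSimplex.map Prod.snd (coupling t s) = s := by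
  ext i
  rw [map_apply, Finset.sum_filter, Fintype.sum_prod_type_right, Finset.sum_eq_single i]
  · simp only [if_true, coupling_apply, overlap_comm (cdf t _)]
    rw [sum_overlap t (cdf_mono s (Nat.le_succ _)) (cdf_mem s i.2.le).1 (cdf_mem s i.2).2,
      cdf_succ]
    ring
  · intro j _ hj
    simp [hj]
  · simp

/-- The support of the monotone coupling is a chain. -/
lemma coupling_chain {n m : ℕ} (t : TopSimplex n) (s : TopSimplex m)
    (p q : Fin (n + 1) × Fin (m + 1)) (hp : 0 < coupling t s p) (hq : 0 < coupling t s q) :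
    p ≤ q ∨ q ≤ p := by
  -- two intervals of a subdivision which overlap with a third one cannot be interchanged
  have key : ∀ p q : Fin (n + 1) × Fin (m + 1), 0 < coupling t s p → 0 < coupling t s q →
      p.1 < q.1 → p.2 ≤ q.2 := by
    intro p q hp hq h
    by_contra hc
    push Not at hc
    rw [coupling_apply, overlap, lt_max_iff] at hp hq
    simp only [lt_irrefl, false_or, sub_pos, max_lt_iff, lt_min_iff] at hp hq
    have h1 := cdf_mono t (show p.1.val + 1 ≤ q.1.val from h)
    have h2 := cdf_mono s (show q.2.val + 1 ≤ p.2.val from hc)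
    linarith [hp.1.1, hp.1.2, hp.2.1, hp.2.2, hq.1.1, hq.1.2, hq.2.1, hq.2.2]
  rcases lt_trichotomy p.1 q.1 with h | h | h
  · exact Or.inl ⟨h.le, key p q hp hq h⟩
  · rcases le_total p.2 q.2 with h' | h'
    · exact Or.inl ⟨h.le, h'⟩
    · exact Or.inr ⟨h.ge, h'⟩
  · exact Or.inr ⟨h.le, key q p hq hp h⟩

lemma fst_pos_of_pos {n m : ℕ} {μ : stdSimplex ℝ (Fin (n + 1) × Fin (m + 1))} {p} (hp : 0 < μ p) :
    0 < stdSimplex.map Prod.fst μ p.1 := by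
  rw [map_apply]
  exact Finset.sum_pos' (fun q _ => stdSimplex.zero_le μ q) ⟨p, by simp, hp⟩

lemma snd_pos_of_pos {n m : ℕ} {μ : stdSimplex ℝ (Fin (n + 1) × Fin (m + 1))} {p} (hp : 0 < μ p) :
    0 < stdSimplex.map Prod.snd μ p.2 := by
  rw [map_apply]
  exact Finset.sum_pos' (fun q _ => stdSimplex.zero_le μ q) ⟨p, by simp, hp⟩

/-- A chain-supported measure on a product of two chains gives a principal lower set the smaller
of the masses given by its marginals, and is therefore determined by the marginals. -/
lemma eq_of_marginals_eq {n m k l : ℕ} (c : Fin (k + 1) →o Fin (n + 1) × Fin (m + 1))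
    (d : Fin (l + 1) →o Fin (n + 1) × Fin (m + 1)) (w : TopSimplex k) (z : TopSimplex l)
    (h1 : stdSimplex.map Prod.fst (stdSimplex.map c w) =
      stdSimplex.map Prod.fst (stdSimplex.map d z))
    (h2 : stdSimplex.map Prod.snd (stdSimplex.map c w) =
      stdSimplex.map Prod.snd (stdSimplex.map d z)) :
    stdSimplex.map c w = stdSimplex.map d z := by
  have key : ∀ {k : ℕ} (c : Fin (k + 1) →o Fin (n + 1) × Fin (m + 1)) (w : TopSimplex k)
      (p : Fin (n + 1) × Fin (m + 1)), ∑ q with q ≤ p, stdSimplex.map c w q =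
      min (∑ i with i ≤ p.1, stdSimplex.map Prod.fst (stdSimplex.map c w) i)
        (∑ j with j ≤ p.2, stdSimplex.map Prod.snd (stdSimplex.map c w) j) := by
    intro k c w p
    rw [sum_map, sum_map, sum_map, sum_map, sum_map]
    -- the two lower sets of the chain are nested
    by_cases hn : ∀ x, (c x).1 ≤ p.1 → (c x).2 ≤ p.2
    · rw [min_eq_left]
      · refine Finset.sum_congr (Finset.filter_congr fun x _ => ?_) fun _ _ => rfl
        exact ⟨fun h => h.1, fun h => ⟨h, hn x h⟩⟩
      · refine Finset.sum_le_sum_of_subset_of_nonneg (fun x hx => ?_)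
          fun i _ _ => stdSimplex.zero_le w i
        simp only [Finset.mem_filter, Finset.mem_univ, true_and] at hx ⊢
        exact hn x hx
    · push Not at hn
      obtain ⟨x₀, h3, h4⟩ := hn
      have hn' : ∀ x, (c x).2 ≤ p.2 → (c x).1 ≤ p.1 := fun x hx => by
        rcases le_total x x₀ with h | h
        · exact (c.monotone h).1.trans h3
        · exact absurd ((c.monotone h).2.trans hx) (not_le.2 h4)
      rw [min_eq_right]
      · refine Finset.sum_congr (Finset.filter_congr fun x _ => ?_) fun _ _ => rfl
        exact ⟨fun h => h.2, fun h => ⟨hn' x h, h⟩⟩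
      · refine Finset.sum_le_sum_of_subset_of_nonneg (fun x hx => ?_)
          fun i _ _ => stdSimplex.zero_le w i
        simp only [Finset.mem_filter, Finset.mem_univ, true_and] at hx ⊢
        exact hn' x hx
  apply stdSimplex.ext
  apply eq_of_sum_le_eq
  intro p
  rw [key, key, h1, h2]

end Realization

end FinitePoset

/-! ### Realizations of products -/

section Product

open Simplicial Opposite MonoidalCategory CartesianMonoidalCategory

namespace Realization

/-- The `k`-simplices of `Δ[n] ⊗ Δ[m]` as monotone maps to a product of chains. -/
def pairVertex (n m k : ℕ) (y : (Δ[n] ⊗ Δ[m] : SSet.{u}) _⦋k⦌) :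
    Fin (k + 1) →o Fin (n + 1) × Fin (m + 1) :=
  (SSet.stdSimplex.objEquiv y.1).toOrderHom.prod (SSet.stdSimplex.objEquiv y.2).toOrderHom

lemma pairVertex_map (n m : ℕ) {k l : ℕ} (θ : ⦋k⦌ ⟶ ⦋l⦌) (y : (Δ[n] ⊗ Δ[m] : SSet.{u}) _⦋l⦌)
    (i : Fin (k + 1)) : pairVertex n m k ((Δ[n] ⊗ Δ[m] : SSet.{u}).map θ.op y) i =
      pairVertex n m l y (θ i) := rfl

lemma pairVertex_injective (n m k : ℕ) : Function.Injective (pairVertex.{u} n m k) := by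
  intro y z h
  refine Prod.ext ?_ ?_
  · apply SSet.stdSimplex.ext
    intro i
    exact congrArg (fun f : Fin (k + 1) →o Fin (n + 1) × Fin (m + 1) => (f i).1) h
  · apply SSet.stdSimplex.ext
    intro i
    exact congrArg (fun f : Fin (k + 1) →o Fin (n + 1) × Fin (m + 1) => (f i).2) h

/-- The simplex of `Δ[n] ⊗ Δ[m]` with given components. -/
def pairSimplex {n m k : ℕ} (α : ⦋k⦌ ⟶ ⦋n⦌) (β : ⦋k⦌ ⟶ ⦋m⦌) : (Δ[n] ⊗ Δ[m] : SSet.{u}) _⦋k⦌ :=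
  (SSet.stdSimplex.objEquiv.symm α, SSet.stdSimplex.objEquiv.symm β)

lemma exists_refinement {n m : ℕ} (t : TopSimplex n) (s : TopSimplex m) :
    ∃ (k : ℕ) (α : ⦋k⦌ ⟶ ⦋n⦌) (β : ⦋k⦌ ⟶ ⦋m⦌) (w : TopSimplex k),
      stdSimplex.map α w = t ∧ stdSimplex.map β w = s := by
  obtain ⟨k, c, w, -, hc⟩ := exists_chain (coupling t s) (coupling_chain t s)
  refine ⟨k, SimplexCategory.mkHom (OrderHom.fst.comp c),
    SimplexCategory.mkHom (OrderHom.snd.comp c), w, ?_, ?_⟩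
  · rw [← map_fst_coupling t s, ← hc, stdSimplex.map_comp_apply]
    rfl
  · rw [← map_snd_coupling t s, ← hc, stdSimplex.map_comp_apply]
    rfl

/-- The comparison of the realization of `Δ[n] ⊗ Δ[m]` with the product of simplices. -/
noncomputable def pairMap (n m : ℕ) (p : SSet.toTop.obj (Δ[n] ⊗ Δ[m] : SSet.{u})) :
    TopSimplex n × TopSimplex m :=
  let μ := (toMeasure (pairVertex n m) (pairVertex_map n m) p).down
  (stdSimplex.map Prod.fst μ, stdSimplex.map Prod.snd μ)

lemma continuous_pairMap (n m : ℕ) : Continuous (pairMap.{u} n m) := by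
  have h := continuous_uliftDown.comp
    (toMeasure (pairVertex.{u} n m) (pairVertex_map n m)).hom.continuous
  exact ((stdSimplex.continuous_map _).comp h).prodMk ((stdSimplex.continuous_map _).comp h)

lemma pairMap_pt {n m k : ℕ} (α : ⦋k⦌ ⟶ ⦋n⦌) (β : ⦋k⦌ ⟶ ⦋m⦌) (w : TopSimplex k) :
    pairMap.{u} n m (pt _ (pairSimplex α β) w) = (stdSimplex.map α w, stdSimplex.map β w) := by
  unfold pairMap
  rw [toMeasure_pt]
  simp only [stdSimplex.map_comp_apply]
  rfl

lemma pairMap_bijective (n m : ℕ) : Function.Bijective (pairMap.{u} n m) := by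
  constructor
  · intro p q h
    apply toMeasure_injective (pairVertex n m) (pairVertex_map n m) (pairVertex_injective n m)
    apply ULift.ext
    obtain ⟨k, x, w, rfl⟩ := pt_surjective p
    obtain ⟨l, y, z, rfl⟩ := pt_surjective q
    have h1 := congrArg Prod.fst h
    have h2 := congrArg Prod.snd h
    unfold pairMap at h1 h2
    rw [toMeasure_pt, toMeasure_pt] at h1 h2
    rw [toMeasure_pt, toMeasure_pt]
    exact eq_of_marginals_eq _ _ w z h1 h2
  · rintro ⟨t, s⟩
    obtain ⟨k, α, β, w, rfl, rfl⟩ := exists_refinement t s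
    exact ⟨_, pairMap_pt α β w⟩

/-- The realization of `Δ[n] ⊗ Δ[m]` is the product of two topological simplices: the map is a
continuous bijection from a compact space to a Hausdorff space. -/
noncomputable def pairHomeo (n m : ℕ) :
    SSet.toTop.obj (Δ[n] ⊗ Δ[m] : SSet.{u}) ≃ₜ TopSimplex n × TopSimplex m :=
  haveI : CompactSpace (SSet.toTop.obj (Δ[n] ⊗ Δ[m] : SSet.{u})) :=
    compactSpace_of_vertexMap _ (pairVertex_map n m) (pairVertex_injective n m)
  Continuous.homeoOfEquivCompactToT2 (f := Equiv.ofBijective _ (pairMap_bijective n m))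
    (continuous_pairMap n m)

lemma pairHomeo_symm_apply {n m k : ℕ} (α : ⦋k⦌ ⟶ ⦋n⦌) (β : ⦋k⦌ ⟶ ⦋m⦌) (w : TopSimplex k) :
    (pairHomeo.{u} n m).symm (stdSimplex.map α w, stdSimplex.map β w) =
      pt _ (pairSimplex α β) w := by
  rw [Homeomorph.symm_apply_eq]
  exact (pairMap_pt α β w).symm

variable {A B A' B' : SSet.{u}}

/-- The simplex of `A ⊗ B` with given components. -/
def pairMk {n : ℕ} (a : A _⦋n⦌) (b : B _⦋n⦌) : (A ⊗ B) _⦋n⦌ := (a, b)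

/-- The product of two simplices of `A` and `B`, as a map to the realization of `A ⊗ B`. -/
noncomputable def cross {n m : ℕ} (a : A _⦋n⦌) (b : B _⦋m⦌) :
    C(TopSimplex n × TopSimplex m, SSet.toTop.obj (A ⊗ B)) :=
  (SSet.toTop.map (SSet.yonedaEquiv.symm a ⊗ₘ SSet.yonedaEquiv.symm b)).hom.comp
    (pairHomeo n m).symm

lemma cross_map {n m k : ℕ} (a : A _⦋n⦌) (b : B _⦋m⦌) (α : ⦋k⦌ ⟶ ⦋n⦌) (β : ⦋k⦌ ⟶ ⦋m⦌)
    (w : TopSimplex k) : cross a b (stdSimplex.map α w, stdSimplex.map β w) =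
      pt (A ⊗ B) (pairMk (A.map α.op a) (B.map β.op b)) w := by
  have h1 : cross a b (stdSimplex.map α w, stdSimplex.map β w) =
      SSet.toTop.map (SSet.yonedaEquiv.symm a ⊗ₘ SSet.yonedaEquiv.symm b)
        ((pairHomeo n m).symm (stdSimplex.map α w, stdSimplex.map β w)) := rfl
  rw [h1, pairHomeo_symm_apply, toTop_map_pt]
  congr 1

lemma cross_map_left {n n' m : ℕ} (θ : ⦋n'⦌ ⟶ ⦋n⦌) (a : A _⦋n⦌) (b : B _⦋m⦌) (t : TopSimplex n')
    (s : TopSimplex m) : cross (A.map θ.op a) b (t, s) = cross a b (stdSimplex.map θ t, s) := by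
  obtain ⟨k, α, β, w, rfl, rfl⟩ := exists_refinement t s
  rw [cross_map, ← map_hom_comp, cross_map, op_comp, Functor.map_comp_apply]

lemma cross_map_right {n m m' : ℕ} (θ : ⦋m'⦌ ⟶ ⦋m⦌) (a : A _⦋n⦌) (b : B _⦋m⦌) (t : TopSimplex n)
    (s : TopSimplex m') : cross a (B.map θ.op b) (t, s) = cross a b (t, stdSimplex.map θ s) := by
  obtain ⟨k, α, β, w, rfl, rfl⟩ := exists_refinement t s
  rw [cross_map, ← map_hom_comp, cross_map, op_comp, Functor.map_comp_apply]

/-- The product of a simplex of `A` with the realization of `B`. -/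
noncomputable def crossRight {n : ℕ} (a : A _⦋n⦌) (B : SSet.{u}) :
    SSet.toTop.obj B ⟶ TopCat.of C(TopSimplex n, SSet.toTop.obj (A ⊗ B)) :=
  ptDesc (fun _ b => ((cross a b).comp ⟨Prod.swap, continuous_swap⟩).curry)
    (fun _ _ θ b s => ContinuousMap.ext fun t => cross_map_right θ a b t s)

lemma crossRight_pt {n m : ℕ} (a : A _⦋n⦌) (b : B _⦋m⦌) (t : TopSimplex n) (s : TopSimplex m) :
    (crossRight a B (pt B b s) : C(TopSimplex n, SSet.toTop.obj (A ⊗ B))) t = cross a b (t, s) := by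
  have h := ptDesc_pt (Z := TopCat.of C(TopSimplex n, SSet.toTop.obj (A ⊗ B)))
    (fun _ b => ((cross a b).comp ⟨Prod.swap, continuous_swap⟩).curry)
    (fun _ _ θ b s => ContinuousMap.ext fun t => cross_map_right θ a b t s) b s
  exact congrArg (fun f : C(TopSimplex n, SSet.toTop.obj (A ⊗ B)) => f t) h

/-- The inverse bijection of the comparison map `|A ⊗ B| → |A| × |B|`.  It is not continuous in
general, but its restriction to each closed cell of `|A|` is, by `continuous_crossPt`. -/
noncomputable def crossPt (x : SSet.toTop.obj A) (y : SSet.toTop.obj B) :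
    SSet.toTop.obj (A ⊗ B) :=
  (ptDesc (fun _ a => (crossRight a B y : C(_, SSet.toTop.obj (A ⊗ B)))) (fun _ _ θ a t => by
    obtain ⟨m, b, s, rfl⟩ := pt_surjective y
    rw [crossRight_pt, crossRight_pt, cross_map_left]) :
    SSet.toTop.obj A ⟶ SSet.toTop.obj (A ⊗ B)) x

lemma crossPt_pt_left {n : ℕ} (a : A _⦋n⦌) (t : TopSimplex n) (y : SSet.toTop.obj B) :
    crossPt (pt A a t) y = (crossRight a B y : C(_, SSet.toTop.obj (A ⊗ B))) t :=
  ptDesc_pt _ _ a t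

lemma crossPt_pt {n m : ℕ} (a : A _⦋n⦌) (b : B _⦋m⦌) (t : TopSimplex n) (s : TopSimplex m) :
    crossPt (pt A a t) (pt B b s) = cross a b (t, s) := by
  rw [crossPt_pt_left, crossRight_pt]

lemma continuous_crossPt {n : ℕ} (a : A _⦋n⦌) :
    Continuous (fun p : TopSimplex n × SSet.toTop.obj B => crossPt (pt A a p.1) p.2) := by
  simp only [crossPt_pt_left]
  exact (ContinuousMap.continuous_uncurry_of_continuous (crossRight a B).hom).comp continuous_swap

lemma toTop_map_fst_crossPt (x : SSet.toTop.obj A) (y : SSet.toTop.obj B) :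
    SSet.toTop.map (fst A B) (crossPt x y) = x := by
  obtain ⟨n, a, t, rfl⟩ := pt_surjective x
  obtain ⟨m, b, s, rfl⟩ := pt_surjective y
  obtain ⟨k, α, β, w, rfl, rfl⟩ := exists_refinement t s
  rw [crossPt_pt, cross_map]
  exact (toTop_map_pt _ _ w).trans (pt_map _ _ w)

lemma toTop_map_snd_crossPt (x : SSet.toTop.obj A) (y : SSet.toTop.obj B) :
    SSet.toTop.map (snd A B) (crossPt x y) = y := by
  obtain ⟨n, a, t, rfl⟩ := pt_surjective x
  obtain ⟨m, b, s, rfl⟩ := pt_surjective y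
  obtain ⟨k, α, β, w, rfl, rfl⟩ := exists_refinement t s
  rw [crossPt_pt, cross_map]
  exact (toTop_map_pt _ _ w).trans (pt_map _ _ w)

lemma crossPt_fst_snd (p : SSet.toTop.obj (A ⊗ B)) :
    crossPt (SSet.toTop.map (fst A B) p) (SSet.toTop.map (snd A B) p) = p := by
  obtain ⟨n, x, w, rfl⟩ := pt_surjective p
  rw [toTop_map_pt, toTop_map_pt, crossPt_pt]
  have := cross_map ((fst A B).app _ x) ((snd A B).app _ x) (𝟙 _) (𝟙 _) w
  rw [op_id, Functor.map_id_apply, Functor.map_id_apply] at this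
  have hid : stdSimplex.map (𝟙 ⦋n⦌ : ⦋n⦌ ⟶ ⦋n⦌) w = w := stdSimplex.map_id_apply w
  rw [hid] at this
  exact this

lemma tensorHom_app_pairMk (f : A ⟶ A') (g : B ⟶ B') {n : ℕ} (a : A _⦋n⦌) (b : B _⦋n⦌) :
    (f ⊗ₘ g).app _ (pairMk a b) = pairMk (f.app _ a) (g.app _ b) := rfl

lemma toTop_map_tensor_crossPt (f : A ⟶ A') (g : B ⟶ B') (x : SSet.toTop.obj A)
    (y : SSet.toTop.obj B) : SSet.toTop.map (f ⊗ₘ g) (crossPt x y) =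
      crossPt (SSet.toTop.map f x) (SSet.toTop.map g y) := by
  obtain ⟨n, a, t, rfl⟩ := pt_surjective x
  obtain ⟨m, b, s, rfl⟩ := pt_surjective y
  obtain ⟨k, α, β, w, rfl, rfl⟩ := exists_refinement t s
  rw [toTop_map_pt, toTop_map_pt, crossPt_pt, crossPt_pt, cross_map, cross_map, toTop_map_pt]
  rw [tensorHom_app_pairMk, NatTrans.naturality_apply, NatTrans.naturality_apply]

/-- After the collar homotopy of `|A|`, the inverse of the comparison map becomes continuous. -/
lemma continuous_crossPt_collar_one :
    Continuous (fun p : SSet.toTop.obj A × SSet.toTop.obj B => crossPt (collar 1 p.1) p.2) := by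
  have h := continuous_collar_one (X := A) (E := SSet.toTop.obj B) (Z := SSet.toTop.obj (A ⊗ B))
    (fun x y => crossPt x y) (fun n a => continuous_crossPt a)
  exact h

/-- The collar homotopy of `|A|` lifts to a homotopy of `|A ⊗ B|`. -/
lemma continuous_crossPt_collar :
    Continuous (fun p : SSet.toTop.obj (A ⊗ B) × unitInterval =>
      crossPt (collar p.2 (SSet.toTop.map (fst A B) p.1)) (SSet.toTop.map (snd A B) p.1)) := by
  rw [continuous_prod_iff_pt]
  intro n x
  have h := (continuous_collar_pt (X := A) (E := SSet.toTop.obj B) (Z := SSet.toTop.obj (A ⊗ B))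
    (fun x y => crossPt x y) (fun n a => continuous_crossPt a) n ((fst A B).app _ x)).comp
    (by fun_prop : Continuous fun p : TopSimplex n × unitInterval =>
      (p.1, p.2, pt B ((snd A B).app _ x) p.1))
  have e : (fun p : TopSimplex n × unitInterval => crossPt
      (collar p.2 (SSet.toTop.map (fst A B) (pt _ x p.1)))
      (SSet.toTop.map (snd A B) (pt _ x p.1))) = fun p => crossPt
      (collar p.2 (pt A ((fst A B).app _ x) p.1)) (pt B ((snd A B).app _ x) p.1) :=
    funext fun p => by rw [toTop_map_pt, toTop_map_pt]
  rw [e]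
  exact h

end Realization

end Product

/-! ### Colimits of diagrams and homotopies -/

section Colimits

/-- The `N`-limit, computed from any choice of products `N (cod f ↓ S) × A (dom f)` and any choice
of a colimit. -/
noncomputable def nLimIso {K : Type w} [Category.{u} K] [HasBinaryProducts K]
    [HasColimitsOfSize.{u, u} K] (N : Cat.{u, u} ⥤ K) {S : Type u} [SmallCategory S] (A : S ⥤ K)
    (P : MorphismCat S ⥤ K) (p : ∀ f, P.obj f ⟶ N.obj (Cat.of (Under f.cod)))
    (q : ∀ f, P.obj f ⟶ A.obj f.dom)
    (hp : ∀ {f g : MorphismCat S} (m : f ⟶ g),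
      P.map m ≫ p g = p f ≫ N.map ((Under.mapFunctor S).map m.k.op))
    (hq : ∀ {f g : MorphismCat S} (m : f ⟶ g), P.map m ≫ q g = q f ≫ A.map m.h)
    (hl : ∀ f, IsLimit (BinaryFan.mk (p f) (q f))) (c : Cocone P) (hc : IsColimit c) :
    nLim N A ≅ c.pt :=
  let e : P ≅ subdivision A ⋙ N.prod (𝟭 K) ⋙ Functor.uncurry.obj prod.functor :=
    NatIso.ofComponents (fun f => ((hl f).conePointUniqueUpToIso (limit.isLimit _) :
      P.obj f ≅ N.obj (Cat.of (Under f.cod)) ⨯ A.obj f.dom)) (fun {f g} m => by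
        have h1 : ∀ f, ((hl f).conePointUniqueUpToIso (limit.isLimit _) :
            P.obj f ≅ N.obj (Cat.of (Under f.cod)) ⨯ A.obj f.dom).hom = prod.lift (p f) (q f) :=
          fun f => by
            apply Limits.prod.hom_ext
            · rw [prod.lift_fst]
              exact (hl f).conePointUniqueUpToIso_hom_comp (limit.isLimit _) ⟨WalkingPair.left⟩
            · rw [prod.lift_snd]
              exact (hl f).conePointUniqueUpToIso_hom_comp (limit.isLimit _) ⟨WalkingPair.right⟩
        have h2 : (subdivision A ⋙ N.prod (𝟭 K) ⋙ Functor.uncurry.obj prod.functor).map m =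
            prod.map (N.map ((Under.mapFunctor S).map m.k.op)) (A.map m.h) := by
          change prod.map _ (𝟙 _) ≫ prod.map (𝟙 _) _ = _
          rw [prod.map_map, Category.comp_id, Category.id_comp]
          rfl
        have h3 : P.map m ≫ prod.lift (p g) (q g) = prod.lift (p f) (q f) ≫
            prod.map (N.map ((Under.mapFunctor S).map m.k.op)) (A.map m.h) := by
          rw [prod.comp_lift, prod.lift_map, hp, hq]
          rfl
        rw [h1, h1, h2]
        exact h3)
  (HasColimit.isoOfNatIso e).symm ≪≫ (colimit.isColimit P).coconePointUniqueUpToIso hc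

variable {J : Type v} [Category.{w} J]

/-- Compatible homotopies on the terms of a diagram of spaces induce a homotopy of maps on the
colimit. -/
lemma homotopic_of_isColimit {F : J ⥤ TopCat.{u}} {c : Cocone F} (hc : IsColimit c)
    {Y : TopCat.{u}} (f g : c.pt ⟶ Y)
    (h : ∀ j, ContinuousMap.Homotopy (c.ι.app j ≫ f).hom (c.ι.app j ≫ g).hom)
    (hh : ∀ {i j : J} (m : i ⟶ j) (t : unitInterval) (x : F.obj i),
      h j (t, F.map m x) = h i (t, x)) : f.hom.Homotopic g.hom := by
  let s : Cocone F :=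
    { pt := TopCat.of C(unitInterval, Y)
      ι :=
        { app := fun j => TopCat.ofHom
            ((h j).toContinuousMap.comp ⟨Prod.swap, continuous_swap⟩).curry
          naturality := fun i j m => by
            ext x
            exact ContinuousMap.ext fun t => hh m t x } }
  let d : C(c.pt, C(unitInterval, Y)) := (hc.desc s).hom
  have hd : ∀ (j : J) (x : F.obj j) (t : unitInterval), d (c.ι.app j x) t = h j (t, x) := by
    intro j x t
    exact congrArg (fun a : C(unitInterval, Y) => a t)
      (ConcreteCategory.congr_hom (hc.fac s j) x)
  have hext : ∀ (a b : C(c.pt, Y)), (∀ j (x : F.obj j), a (c.ι.app j x) = b (c.ι.app j x)) →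
      a = b := fun a b hab => by
    have : TopCat.ofHom a = TopCat.ofHom b := hc.hom_ext fun j => by
      ext x
      exact hab j x
    exact congrArg TopCat.Hom.hom this
  have h0 : (⟨fun x => d x 0, by fun_prop⟩ : C(c.pt, Y)) = f.hom :=
    hext _ _ fun j x => (hd j x 0).trans ((h j).apply_zero x)
  have h1 : (⟨fun x => d x 1, by fun_prop⟩ : C(c.pt, Y)) = g.hom :=
    hext _ _ fun j x => (hd j x 1).trans ((h j).apply_one x)
  exact ⟨⟨⟨fun p => d p.2 p.1, by fun_prop⟩, fun x => DFunLike.congr_fun h0 x,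
    fun x => DFunLike.congr_fun h1 x⟩⟩

/-- Two natural transformations between diagrams of spaces that are mutually inverse up to
compatible homotopies induce a homotopy equivalence of the colimits. -/
lemma homotopyEquiv_of_isColimit {F G : J ⥤ TopCat.{u}} {c : Cocone F} {d : Cocone G}
    (hc : IsColimit c) (hd : IsColimit d) (a : F ⟶ G) (b : G ⟶ F)
    (h : ∀ j, ContinuousMap.Homotopy (ContinuousMap.id _) (a.app j ≫ b.app j).hom)
    (hh : ∀ {i j : J} (m : i ⟶ j) (t : unitInterval) (x : F.obj i),
      h j (t, F.map m x) = F.map m (h i (t, x)))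
    (k : ∀ j, ContinuousMap.Homotopy (ContinuousMap.id _) (b.app j ≫ a.app j).hom)
    (hk : ∀ {i j : J} (m : i ⟶ j) (t : unitInterval) (x : G.obj i),
      k j (t, G.map m x) = G.map m (k i (t, x))) :
    Nonempty (ContinuousMap.HomotopyEquiv c.pt d.pt) := by
  have key : ∀ {F G : J ⥤ TopCat.{u}} {c : Cocone F} {d : Cocone G} (hc : IsColimit c)
      (hd : IsColimit d) (a : F ⟶ G) (b : G ⟶ F)
      (h : ∀ j, ContinuousMap.Homotopy (ContinuousMap.id _) (a.app j ≫ b.app j).hom)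
      (_ : ∀ {i j : J} (m : i ⟶ j) (t : unitInterval) (x : F.obj i),
        h j (t, F.map m x) = F.map m (h i (t, x))),
      (hc.map d a ≫ hd.map c b).hom.Homotopic (ContinuousMap.id _) := by
    intro F G c d hc hd a b h hh
    refine (homotopic_of_isColimit hc (𝟙 _) (hc.map d a ≫ hd.map c b) (fun j =>
      (((ContinuousMap.Homotopy.refl (c.ι.app j).hom).comp (h j))).cast ?_ ?_) ?_).symm
    · ext x; rfl
    · rw [IsColimit.ι_map_assoc, IsColimit.ι_map, ← Category.assoc]; rfl
    · intro i j m t x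
      change c.ι.app j (h j (t, F.map m x)) = c.ι.app i (h i (t, x))
      rw [hh]
      exact ConcreteCategory.congr_hom (c.w m) _
  exact ⟨⟨(hc.map d a).hom, (hd.map c b).hom, key hc hd a b h hh, key hd hc b a k hk⟩⟩

end Colimits

section NerveProduct

open Simplicial Opposite MonoidalCategory CartesianMonoidalCategory

namespace Realization

variable {C C' E E' : Type u} [Category.{u} C] [Category.{u} C'] [Category.{u} E] [Category.{u} E']

/-- Functors connected by a natural transformation consisting of identities are equal. -/
lemma functor_eq_of_app_eq_eqToHom {E : Type v} [Category.{w} E] {X Y : E ⥤ C} (φ : X ⟶ Y)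
    (h : ∀ j, ∃ e : X.obj j = Y.obj j, φ.app j = eqToHom e) : X = Y := by
  choose e he using h
  refine CategoryTheory.Functor.ext e fun i j f => ?_
  have := φ.naturality f
  rw [he, he] at this
  rw [← Category.assoc, ← this, Category.assoc, eqToHom_trans, eqToHom_refl, Category.comp_id]

/-- A simplex of the nerve is degenerate when one of its morphisms is an identity. -/
lemma nerve_mem_range_σ_iff {n : ℕ} (i : Fin (n + 1)) (x : ComposableArrows C (n + 1)) :
    (x : (nerve C) _⦋n + 1⦌) ∈ Set.range ((nerve C).σ i) ↔ ∃ e : x.obj i.castSucc =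
      x.obj i.succ, x.map (homOfLE i.castSucc_le_succ) = eqToHom e := by
  constructor
  · rintro ⟨z : ComposableArrows C n, rfl⟩
    have e : i.predAbove i.castSucc = i.predAbove i.succ := by simp
    refine ⟨congrArg (fun j => z.obj j) e, ?_⟩
    have key : ∀ (j k : Fin (n + 1)) (h : j = k) (f : j ⟶ k), z.map f =
        eqToHom (congrArg z.obj h) := by
      rintro j _ rfl f
      rw [Subsingleton.elim f (𝟙 j), z.map_id, eqToHom_refl]
    exact key _ _ e _
  · rintro ⟨e, he⟩
    let θ : Fin (n + 2) →o Fin (n + 2) := (Fin.succAboveOrderEmb i.castSucc).toOrderHom.comp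
      (Fin.predAboveOrderHom i)
    have hθ : ∀ j, j ≠ i.castSucc → θ j = j := fun j hj => by
      change i.castSucc.succAbove (i.predAbove j) = j
      exact Fin.succAbove_predAbove hj
    have hθi : θ i.castSucc = i.succ := by
      change i.castSucc.succAbove (i.predAbove i.castSucc) = _
      simp
    have hle : ∀ j, j ≤ θ j := fun j => by
      by_cases hj : j = i.castSucc
      · subst hj
        rw [hθi]
        exact i.castSucc_le_succ
      · rw [hθ j hj]
    let y : Fin (n + 2) ⥤ C := θ.monotone.functor ⋙ x
    have hxy : (x : Fin (n + 2) ⥤ C) = y := by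
      refine functor_eq_of_app_eq_eqToHom (X := (x : Fin (n + 2) ⥤ C)) (Y := y)
        { app := fun j => x.map (homOfLE (hle j))
          naturality := fun j k f => ?_ } fun j => ?_
      · change x.map _ ≫ x.map _ = x.map _ ≫ x.map _
        rw [← Functor.map_comp, ← Functor.map_comp]
        rfl
      · change ∃ e : x.obj j = x.obj (θ j),
          x.map (homOfLE (hle j)) = eqToHom e
        have key : ∀ k (hk : j ≤ k), (k = j ∨ (j = i.castSucc ∧ k = i.succ)) →
            ∃ e : x.obj j = x.obj k,
              x.map (homOfLE hk) = eqToHom e := by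
          rintro k hk (rfl | ⟨rfl, rfl⟩)
          · exact ⟨rfl, x.map_id k⟩
          · exact ⟨e, he⟩
        refine key _ _ ?_
        by_cases hj : j = i.castSucc
        · exact Or.inr ⟨hj, hj ▸ hθi⟩
        · exact Or.inl (hθ j hj)
    exact ⟨(nerve C).δ i.castSucc x, hxy.symm⟩

/-- A functor that reflects identities preserves nondegenerate simplices of the nerve. -/
lemma nerveMap_mem_nonDegenerate (F : C ⥤ C')
    (hF : ∀ (X Y : C) (f : X ⟶ Y) (h : F.obj X = F.obj Y), F.map f = eqToHom h →
      ∃ h' : X = Y, f = eqToHom h')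
    {n : ℕ} (x : (nerve C) _⦋n⦌) (hx : x ∈ (nerve C).nonDegenerate n) :
    (nerveMap F).app (op ⦋n⦌) x ∈ (nerve C').nonDegenerate n := by
  obtain _ | n := n
  · simp
  · rw [SSet.mem_nonDegenerate_iff_notMem_degenerate, SSet.degenerate_eq_iUnion_range_σ] at hx ⊢
    intro h
    obtain ⟨i, hi⟩ := Set.mem_iUnion.1 h
    obtain ⟨e, he⟩ := (nerve_mem_range_σ_iff i _).1 hi
    exact hx (Set.mem_iUnion.2 ⟨i, (nerve_mem_range_σ_iff i x).2 (hF _ _ _ e he)⟩)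

/-- The comparison `N C × N C' ⟶ N (C × C')`. -/
def nerveProd (C C' : Type u) [Category.{u} C] [Category.{u} C'] :
    nerve C ⊗ nerve C' ⟶ nerve (C × C') where
  app n := ↾fun x => CategoryTheory.Functor.prod' x.1 x.2

lemma lift_nerveProd : lift (nerveMap (CategoryTheory.Prod.fst C C'))
    (nerveMap (CategoryTheory.Prod.snd C C')) ≫ nerveProd C C' = 𝟙 _ := rfl

lemma nerveProd_fst : nerveProd C C' ≫ nerveMap (CategoryTheory.Prod.fst C C') = fst _ _ := rfl

lemma nerveProd_snd : nerveProd C C' ≫ nerveMap (CategoryTheory.Prod.snd C C') = snd _ _ := rfl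

lemma nerveProd_naturality (F : C ⥤ E) (G : C' ⥤ E') :
    nerveProd C C' ≫ nerveMap (F.prod G) = (nerveMap F ⊗ₘ nerveMap G) ≫ nerveProd E E' := rfl

end Realization

end NerveProduct

/-! ### The homotopy limit of realizations -/

section ProductDiagram

open Simplicial Opposite MonoidalCategory CartesianMonoidalCategory

namespace Realization

lemma toTop_map_congr {X Y Y' Z : SSet.{u}} {f : X ⟶ Y} {g : Y ⟶ Z} {f' : X ⟶ Y'} {g' : Y' ⟶ Z}
    (h : f ≫ g = f' ≫ g') (p : SSet.toTop.obj X) :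
    SSet.toTop.map g (SSet.toTop.map f p) = SSet.toTop.map g' (SSet.toTop.map f' p) := by
  rw [← ConcreteCategory.comp_apply, ← ConcreteCategory.comp_apply, ← Functor.map_comp,
    ← Functor.map_comp, h]

variable {S : Type u} [SmallCategory S] (D : S ⥤ Cat.{u, u})

/-- The diagram `f ↦ (cod f ↓ S) × D (dom f)` of categories. -/
def prodDiagram : MorphismCat S ⥤ Cat.{u, u} where
  obj f := Cat.of (Under f.cod × D.obj f.dom)
  map m := ((Under.map m.k).prod (D.map m.h).toFunctor).toCatHom
  map_id f := by
    have h1 := Under.mapId_eq f.cod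
    have h2 := D.map_id f.dom
    refine Cat.ext ?_
    change (Under.map (𝟙 f.cod)).prod (D.map (𝟙 f.dom)).toFunctor = _
    rw [h1, h2]
    rfl
  map_comp a b := by
    have h1 := Under.mapComp_eq b.k a.k
    have h2 := D.map_comp a.h b.h
    refine Cat.ext ?_
    change (Under.map (b.k ≫ a.k)).prod (D.map (a.h ≫ b.h)).toFunctor = _
    rw [h1, h2]
    rfl

/-- The diagram `f ↦ Δ (cod f ↓ S) × Δ (D (dom f))` of spaces. -/
noncomputable def prodSpaceDiagram : MorphismCat S ⥤ TopCat.{u} where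
  obj f := TopCat.of (SSet.toTop.obj (nerve (Under f.cod)) × SSet.toTop.obj (nerve (D.obj f.dom)))
  map m := TopCat.ofHom (ContinuousMap.prodMap
    (SSet.toTop.map (nerveMap (Under.map m.k))).hom
    (SSet.toTop.map (nerveMap (D.map m.h).toFunctor)).hom)
  map_id f := by
    have h1 : nerveMap (Under.map (𝟙 f.cod)) = 𝟙 _ := by rw [Under.mapId_eq]; rfl
    have h2 : nerveMap (D.map (𝟙 f.dom)).toFunctor = 𝟙 _ := by rw [D.map_id]; rfl
    change TopCat.ofHom (ContinuousMap.prodMap (SSet.toTop.map (nerveMap (Under.map (𝟙 f.cod)))).hom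
      (SSet.toTop.map (nerveMap (D.map (𝟙 f.dom)).toFunctor)).hom) = _
    rw [h1, h2, CategoryTheory.Functor.map_id, CategoryTheory.Functor.map_id]
    rfl
  map_comp a b := by
    have h1 : nerveMap (Under.map (b.k ≫ a.k)) =
        nerveMap (Under.map a.k) ≫ nerveMap (Under.map b.k) := by rw [Under.mapComp_eq]; rfl
    have h2 : nerveMap (D.map (a.h ≫ b.h)).toFunctor =
        nerveMap (D.map a.h).toFunctor ≫ nerveMap (D.map b.h).toFunctor := by rw [D.map_comp]; rfl
    change TopCat.ofHom (ContinuousMap.prodMap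
      (SSet.toTop.map (nerveMap (Under.map (b.k ≫ a.k)))).hom
      (SSet.toTop.map (nerveMap (D.map (a.h ≫ b.h)).toFunctor)).hom) = _
    rw [h1, h2, Functor.map_comp, Functor.map_comp]
    rfl

/-- Composition with `k` reflects identities, so that `N (b ↓ S) ⟶ N (a ↓ S)` preserves
nondegenerate simplices and commutes with the collar homotopy. -/
lemma underMap_reflects_id {a b : S} (k : a ⟶ b) (X Y : Under b) (f : X ⟶ Y)
    (h : (Under.map k).obj X = (Under.map k).obj Y) (hf : (Under.map k).map f = eqToHom h) :
    ∃ h' : X = Y, f = eqToHom h' := by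
  have hr : X.right = Y.right := congrArg (fun Z : Under a => Z.right) h
  have hfr : f.right = eqToHom hr := by
    have h1 : ((Under.map k).map f).right = eqToHom hr := by
      rw [hf]
      have : ∀ (A B : Under a) (e : A = B), (eqToHom e).right =
          eqToHom (congrArg (fun Z : Under a => Z.right) e) := by
        rintro A _ rfl
        rfl
      exact this _ _ h
    exact h1
  have hXY : X = Y := by
    have hw := Under.w f
    obtain ⟨⟨⟨⟩⟩, x, p⟩ := X
    obtain ⟨⟨⟨⟩⟩, y, q⟩ := Y
    obtain rfl : x = y := hr
    have : p ≫ f.right = q := hw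
    rw [hfr] at this
    obtain rfl : p = q := by simpa using this
    rfl
  subst hXY
  exact ⟨rfl, Under.UnderMorphism.ext (by simpa using hfr)⟩

/-- The projections from the realization of a product of categories. -/
noncomputable def toProd : prodDiagram D ⋙ realization ⟶ prodSpaceDiagram D where
  app f := TopCat.ofHom (ContinuousMap.prodMk
    (SSet.toTop.map (nerveMap (CategoryTheory.Prod.fst (Under f.cod) (D.obj f.dom)))).hom
    (SSet.toTop.map (nerveMap (CategoryTheory.Prod.snd (Under f.cod) (D.obj f.dom)))).hom)
  naturality f g m := by
    ext p
    refine Prod.ext ?_ ?_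
    · exact toTop_map_congr (f := nerveMap ((Under.map m.k).prod (D.map m.h).toFunctor))
        (g := nerveMap (CategoryTheory.Prod.fst _ _)) (f' := nerveMap (CategoryTheory.Prod.fst _ _))
        (g' := nerveMap (Under.map m.k)) rfl p
    · exact toTop_map_congr (f := nerveMap ((Under.map m.k).prod (D.map m.h).toFunctor))
        (g := nerveMap (CategoryTheory.Prod.snd _ _)) (f' := nerveMap (CategoryTheory.Prod.snd _ _))
        (g' := nerveMap (D.map m.h).toFunctor) rfl p

variable {D} in
lemma prodDiagram_map_crossPt {f g : MorphismCat S} (m : f ⟶ g) (s : unitInterval)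
    (x : SSet.toTop.obj (nerve (Under f.cod))) (y : SSet.toTop.obj (nerve (D.obj f.dom))) :
    SSet.toTop.map (nerveMap ((Under.map m.k).prod (D.map m.h).toFunctor))
      (SSet.toTop.map (nerveProd _ _) (crossPt (collar s x) y)) =
    SSet.toTop.map (nerveProd _ _) (crossPt
      (collar s (SSet.toTop.map (nerveMap (Under.map m.k)) x))
      (SSet.toTop.map (nerveMap (D.map m.h).toFunctor) y)) := by
  rw [← toTop_map_collar _
      (fun n z hz => nerveMap_mem_nonDegenerate _ (underMap_reflects_id m.k) z hz),
    ← toTop_map_tensor_crossPt, ← ConcreteCategory.comp_apply, ← Functor.map_comp,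
    nerveProd_naturality, Functor.map_comp, ConcreteCategory.comp_apply]

/-- The homotopy inverse of the projections: the discontinuous inverse bijection, composed with the
end of the collar homotopy of `Δ (cod f ↓ S)`. -/
noncomputable def ofProd : prodSpaceDiagram D ⟶ prodDiagram D ⋙ realization where
  app f := TopCat.ofHom ⟨fun p => SSet.toTop.map (nerveProd _ _) (crossPt (collar 1 p.1) p.2),
    (SSet.toTop.map (nerveProd _ _)).hom.continuous.comp continuous_crossPt_collar_one⟩
  naturality f g m := by
    ext p
    exact (prodDiagram_map_crossPt m 1 p.1 p.2).symm

/-- The collar homotopy of `Δ C`, lifted to `Δ (C × C')`. -/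
noncomputable def collarLift (C C' : Type u) [Category.{u} C] [Category.{u} C'] :
    C(unitInterval × SSet.toTop.obj (nerve (C × C')), SSet.toTop.obj (nerve (C × C'))) where
  toFun q := SSet.toTop.map (nerveProd C C') (crossPt
    (collar q.1 (SSet.toTop.map (nerveMap (CategoryTheory.Prod.fst C C')) q.2))
    (SSet.toTop.map (nerveMap (CategoryTheory.Prod.snd C C')) q.2))
  continuous_toFun := by
    let i : nerve (C × C') ⟶ nerve C ⊗ nerve C' := lift (nerveMap (CategoryTheory.Prod.fst C C'))
      (nerveMap (CategoryTheory.Prod.snd C C'))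
    have h1 : ∀ p, SSet.toTop.map (fst (nerve C) (nerve C')) (SSet.toTop.map i p) =
        SSet.toTop.map (nerveMap (CategoryTheory.Prod.fst C C')) p := fun p => by
      rw [← ConcreteCategory.comp_apply, ← Functor.map_comp]
      rfl
    have h2 : ∀ p, SSet.toTop.map (snd (nerve C) (nerve C')) (SSet.toTop.map i p) =
        SSet.toTop.map (nerveMap (CategoryTheory.Prod.snd C C')) p := fun p => by
      rw [← ConcreteCategory.comp_apply, ← Functor.map_comp]
      rfl
    have h3 : Continuous fun q : unitInterval × SSet.toTop.obj (nerve (C × C')) =>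
        (SSet.toTop.map i q.2, q.1) := by fun_prop
    have h4 := (SSet.toTop.map (nerveProd C C')).hom.continuous.comp
      ((continuous_crossPt_collar (A := nerve C) (B := nerve C')).comp h3)
    have h5 : (fun q : unitInterval × SSet.toTop.obj (nerve (C × C')) =>
        SSet.toTop.map (nerveProd C C') (crossPt
          (collar q.1 (SSet.toTop.map (nerveMap (CategoryTheory.Prod.fst C C')) q.2))
          (SSet.toTop.map (nerveMap (CategoryTheory.Prod.snd C C')) q.2))) =
        fun q => SSet.toTop.map (nerveProd C C') (crossPt
          (collar q.1 (SSet.toTop.map (fst (nerve C) (nerve C')) (SSet.toTop.map i q.2)))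
          (SSet.toTop.map (snd (nerve C) (nerve C')) (SSet.toTop.map i q.2))) :=
      funext fun q => by rw [h1, h2]
    rw [h5]
    exact h4

lemma collarLift_zero (C C' : Type u) [Category.{u} C] [Category.{u} C']
    (p : SSet.toTop.obj (nerve (C × C'))) : collarLift C C' (0, p) = p := by
  let i : nerve (C × C') ⟶ nerve C ⊗ nerve C' := lift (nerveMap (CategoryTheory.Prod.fst C C'))
    (nerveMap (CategoryTheory.Prod.snd C C'))
  have h := congrArg (SSet.toTop.map (nerveProd C C')) (crossPt_fst_snd (SSet.toTop.map i p))
  rw [← ConcreteCategory.comp_apply (SSet.toTop.map i), ← Functor.map_comp, lift_fst,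
    ← ConcreteCategory.comp_apply (SSet.toTop.map i), ← Functor.map_comp, lift_snd,
    ← ConcreteCategory.comp_apply (SSet.toTop.map i), ← Functor.map_comp, lift_nerveProd,
    CategoryTheory.Functor.map_id] at h
  change SSet.toTop.map _ (crossPt (collar 0 _) _) = _
  rw [collar_zero]
  exact h

/-- The homotopy limit of `Δ ∘ D` is the colimit of the spaces `Δ (cod f ↓ S) × Δ (D (dom f))`,
which up to homotopy may be replaced by `Δ ((cod f ↓ S) × D (dom f))`. -/
lemma holim_homotopyEquiv (c : Cocone (prodDiagram D ⋙ realization)) (hc : IsColimit c) :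
    Nonempty (ContinuousMap.HomotopyEquiv (holim (D ⋙ realization.{u})) c.pt) := by
  let e : holim (D ⋙ realization.{u}) ≅ colimit (prodSpaceDiagram D) :=
    nLimIso realization.{u} (D ⋙ realization.{u}) (prodSpaceDiagram D)
      (fun f => TopCat.prodFst) (fun f => TopCat.prodSnd) (fun m => rfl) (fun m => rfl)
      (fun f => TopCat.prodBinaryFanIsLimit _ _) _ (colimit.isColimit _)
  have hproj : ∀ {f g : MorphismCat S} (m : f ⟶ g)
      (p : SSet.toTop.obj (nerve (Under f.cod × D.obj f.dom))),
      SSet.toTop.map (nerveMap (CategoryTheory.Prod.fst (Under g.cod) (D.obj g.dom)))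
        (SSet.toTop.map (nerveMap ((Under.map m.k).prod (D.map m.h).toFunctor)) p) =
        SSet.toTop.map (nerveMap (Under.map m.k))
        (SSet.toTop.map (nerveMap (CategoryTheory.Prod.fst (Under f.cod) (D.obj f.dom))) p) ∧
      SSet.toTop.map (nerveMap (CategoryTheory.Prod.snd (Under g.cod) (D.obj g.dom)))
        (SSet.toTop.map (nerveMap ((Under.map m.k).prod (D.map m.h).toFunctor)) p) =
        SSet.toTop.map (nerveMap (D.map m.h).toFunctor)
        (SSet.toTop.map (nerveMap (CategoryTheory.Prod.snd (Under f.cod) (D.obj f.dom))) p) :=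
      fun m p =>
    ⟨congrArg Prod.fst (ConcreteCategory.congr_hom ((toProd D).naturality m) p),
      congrArg Prod.snd (ConcreteCategory.congr_hom ((toProd D).naturality m) p)⟩
  have h : Nonempty (ContinuousMap.HomotopyEquiv c.pt (colimit (prodSpaceDiagram D) : TopCat)) := by
    refine homotopyEquiv_of_isColimit hc (colimit.isColimit _) (toProd D) (ofProd D)
      (fun f =>
        { toContinuousMap := collarLift (Under f.cod) (D.obj f.dom)
          map_zero_left := fun p => collarLift_zero _ _ p
          map_one_left := fun p => rfl }) ?_
      (fun f =>
        { toFun := fun q => (collar q.1 q.2.1, q.2.2)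
          continuous_toFun := (continuous_collar.comp (by fun_prop :
            Continuous fun q : unitInterval × (SSet.toTop.obj (nerve (Under f.cod)) ×
              SSet.toTop.obj (nerve (D.obj f.dom))) => (q.2.1, q.1))).prodMk
            (continuous_snd.comp continuous_snd)
          map_zero_left := fun p => Prod.ext (collar_zero p.1) rfl
          map_one_left := fun p => ?_ }) ?_
    · intro f g m t x
      change SSet.toTop.map (nerveProd (Under g.cod) (D.obj g.dom)) (crossPt
        (collar t (SSet.toTop.map (nerveMap (CategoryTheory.Prod.fst (Under g.cod) (D.obj g.dom)))
          (SSet.toTop.map (nerveMap ((Under.map m.k).prod (D.map m.h).toFunctor)) x)))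
        (SSet.toTop.map (nerveMap (CategoryTheory.Prod.snd (Under g.cod) (D.obj g.dom)))
          (SSet.toTop.map (nerveMap ((Under.map m.k).prod (D.map m.h).toFunctor)) x))) = _
      rw [(hproj m x).1, (hproj m x).2]
      exact (prodDiagram_map_crossPt m t _ _).symm
    · refine Prod.ext ?_ ?_
      · change _ = SSet.toTop.map (nerveMap (CategoryTheory.Prod.fst (Under f.cod) (D.obj f.dom)))
          (SSet.toTop.map (nerveProd (Under f.cod) (D.obj f.dom)) (crossPt (collar 1 p.1) p.2))
        rw [← ConcreteCategory.comp_apply, ← Functor.map_comp, nerveProd_fst, toTop_map_fst_crossPt]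
      · change _ = SSet.toTop.map (nerveMap (CategoryTheory.Prod.snd (Under f.cod) (D.obj f.dom)))
          (SSet.toTop.map (nerveProd (Under f.cod) (D.obj f.dom)) (crossPt (collar 1 p.1) p.2))
        rw [← ConcreteCategory.comp_apply, ← Functor.map_comp, nerveProd_snd, toTop_map_snd_crossPt]
    · intro f g m t x
      exact Prod.ext (toTop_map_collar _ (fun n z hz => nerveMap_mem_nonDegenerate _
        (underMap_reflects_id m.k) z hz) t x.1).symm rfl
  exact ⟨(TopCat.homeoOfIso e).toHomotopyEquiv.trans h.some.symm⟩

end Realization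

end ProductDiagram

/-! ### Edgewise subdivision -/

section Subdivision

open Simplicial Opposite MonoidalCategory CartesianMonoidalCategory

namespace Realization

/-- The monotone map of `[m] * [m] = [2 m + 1]` to a preorder which restricts to the given maps
on the two halves. -/
def halves {P : Type*} [Preorder P] {m : ℕ} (f g : Fin (m + 1) →o P) (h : ∀ i j, f i ≤ g j) :
    Fin (m + 1 + m + 1) →o P where
  toFun := Fin.addCases (m := m + 1) (n := m + 1) f g
  monotone' i j := by
    refine Fin.addCases (m := m + 1) (n := m + 1) (fun i => ?_) (fun i => ?_) i <;>
    refine Fin.addCases (m := m + 1) (n := m + 1) (fun j => ?_) (fun j => ?_) j <;>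
    intro hij <;> beta_reduce
    · rw [Fin.addCases_left, Fin.addCases_left]
      exact f.monotone hij
    · rw [Fin.addCases_left, Fin.addCases_right]
      exact h i j
    · exfalso
      have h1 : (Fin.natAdd (m + 1) i).val ≤ (Fin.castAdd (m + 1) j).val := hij
      have := j.2
      simp only [Fin.val_natAdd, Fin.val_castAdd] at h1
      omega
    · rw [Fin.addCases_right, Fin.addCases_right]
      exact g.monotone (by simpa using hij)

/-- The inclusion of `[m]` as the first half of `[2 m + 1]`. -/
def firstHalf (m : ℕ) : Fin (m + 1) →o Fin (m + 1 + m + 1) :=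
  ⟨Fin.castAdd (m + 1), fun _ _ h => h⟩

/-- The inclusion of `[m]` as the second half of `[2 m + 1]`. -/
def secondHalf (m : ℕ) : Fin (m + 1) →o Fin (m + 1 + m + 1) :=
  ⟨Fin.natAdd (m + 1), fun _ _ h => by simpa using h⟩

lemma firstHalf_le_secondHalf (m : ℕ) (i j : Fin (m + 1)) : firstHalf m i ≤ secondHalf m j := by
  change i.val ≤ m + 1 + j.val
  have := i.2
  omega

variable {P : Type*} [Preorder P] {m : ℕ}

lemma halves_firstHalf (f g : Fin (m + 1) →o P) (h : ∀ i j, f i ≤ g j) (i : Fin (m + 1)) :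
    halves f g h (firstHalf m i) = f i :=
  Fin.addCases_left (m := m + 1) (n := m + 1) (motive := fun _ => P) (left := f) (right := g) i

lemma halves_secondHalf (f g : Fin (m + 1) →o P) (h : ∀ i j, f i ≤ g j) (i : Fin (m + 1)) :
    halves f g h (secondHalf m i) = g i :=
  Fin.addCases_right (m := m + 1) (n := m + 1) (motive := fun _ => P) (left := f) (right := g) i

lemma orderHom_ext_halves {f g : Fin (m + 1 + m + 1) →o P}
    (h1 : ∀ i, f (firstHalf m i) = g (firstHalf m i))
    (h2 : ∀ i, f (secondHalf m i) = g (secondHalf m i)) : f = g := by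
  ext i
  exact Fin.addCases (m := m + 1) (n := m + 1) (motive := fun i => f i = g i) h1 h2 i

/-- The functoriality of `[m] * [m]`. -/
def double {m n : ℕ} (f : Fin (m + 1) →o Fin (n + 1)) :
    Fin (m + 1 + m + 1) →o Fin (n + 1 + n + 1) :=
  halves ((firstHalf n).comp f) ((secondHalf n).comp f) fun _ _ => firstHalf_le_secondHalf _ _ _

lemma double_firstHalf {m n : ℕ} (f : Fin (m + 1) →o Fin (n + 1)) (i : Fin (m + 1)) :
    double f (firstHalf m i) = firstHalf n (f i) := halves_firstHalf _ _ _ i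

lemma double_secondHalf {m n : ℕ} (f : Fin (m + 1) →o Fin (n + 1)) (i : Fin (m + 1)) :
    double f (secondHalf m i) = secondHalf n (f i) := halves_secondHalf _ _ _ i

lemma double_id (m : ℕ) : double (OrderHom.id : Fin (m + 1) →o Fin (m + 1)) = OrderHom.id :=
  orderHom_ext_halves (double_firstHalf _) (double_secondHalf _)

lemma double_comp {l m n : ℕ} (g : Fin (m + 1) →o Fin (n + 1)) (f : Fin (l + 1) →o Fin (m + 1)) :
    double (g.comp f) = (double g).comp (double f) :=
  orderHom_ext_halves
    (fun i => by
      rw [OrderHom.comp_coe, Function.comp_apply, double_firstHalf, double_firstHalf,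
        double_firstHalf]
      rfl)
    (fun i => by
      rw [OrderHom.comp_coe, Function.comp_apply, double_secondHalf, double_secondHalf,
        double_secondHalf]
      rfl)

/-- The doubling functor `[m] ↦ [m] * [m]` on the simplex category. -/
def doubling : SimplexCategory ⥤ SimplexCategory where
  obj a := SimplexCategory.mk (a.len + 1 + a.len)
  map f := SimplexCategory.mkHom (double f.toOrderHom)
  map_id _ := SimplexCategory.Hom.ext _ _ (double_id _)
  map_comp f g := SimplexCategory.Hom.ext _ _ (double_comp g.toOrderHom f.toOrderHom)

/-- The inclusions of the second halves. -/
def doublingSnd : 𝟭 _ ⟶ doubling where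
  app a := SimplexCategory.mkHom (secondHalf a.len)
  naturality _ _ f := SimplexCategory.Hom.ext _ _
    (OrderHom.ext _ _ (funext fun i => (double_secondHalf f.toOrderHom i).symm))

/-- The edgewise subdivision of simplicial sets: `(sd X) n = X (2 n + 1)`. -/
def sd : SSet.{u} ⥤ SSet.{u} := (Functor.whiskeringLeft _ _ _).obj doubling.op

/-- The map from the edgewise subdivision which restricts a simplex to its second half. -/
def sdSnd : sd.{u} ⟶ 𝟭 _ := (Functor.whiskeringLeft _ _ (Type u)).map (NatTrans.op doublingSnd)

/-- Convex combinations of probability measures. -/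
def mix {ι : Type*} [Fintype ι] (s : unitInterval) (a b : stdSimplex ℝ ι) : stdSimplex ℝ ι :=
  ⟨fun i => (1 - s) * a i + s * b i, fun i => add_nonneg
    (mul_nonneg (by linarith [s.2.2]) (stdSimplex.zero_le a i))
    (mul_nonneg s.2.1 (stdSimplex.zero_le b i)), by
    rw [Finset.sum_add_distrib, ← Finset.mul_sum, ← Finset.mul_sum]
    have h1 := stdSimplex.sum_eq_one a
    have h2 := stdSimplex.sum_eq_one b
    rw [h1, h2]
    ring⟩

lemma mix_apply {ι : Type*} [Fintype ι] (s : unitInterval) (a b : stdSimplex ℝ ι) (i : ι) :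
    mix s a b i = (1 - s) * a i + s * b i := rfl

lemma map_mix {ι κ : Type*} [Fintype ι] [Fintype κ] (f : ι → κ) (s : unitInterval)
    (a b : stdSimplex ℝ ι) :
    stdSimplex.map f (mix s a b) = mix s (stdSimplex.map f a) (stdSimplex.map f b) := by
  classical
  ext j
  rw [map_apply, mix_apply, map_apply, map_apply, Finset.mul_sum, Finset.mul_sum,
    ← Finset.sum_add_distrib]
  rfl

lemma mix_one {ι : Type*} [Fintype ι] (a b : stdSimplex ℝ ι) : mix 1 a b = b := by
  ext i
  simp [mix_apply]

/-- The point of the simplex on `[n] * [n]` with weight `1 - s` on the first half and `s` on the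
second half. -/
noncomputable def spread {n : ℕ} (s : unitInterval) (t : TopSimplex n) : TopSimplex (n + 1 + n) :=
  mix s (stdSimplex.map (firstHalf n) t) (stdSimplex.map (secondHalf n) t)

lemma continuous_spread {n : ℕ} :
    Continuous fun p : TopSimplex n × unitInterval => spread p.2 p.1 := by
  have h : ∀ θ : Fin (n + 1) →o Fin (n + 1 + n + 1), ∀ i,
      Continuous fun p : TopSimplex n × unitInterval => stdSimplex.map θ p.1 i := fun θ i =>
    (continuous_apply i).comp (continuous_subtype_val.comp
      ((stdSimplex.continuous_map _).comp continuous_fst))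
  refine Continuous.subtype_mk (continuous_pi fun i => ?_) _
  exact ((continuous_const.sub (continuous_subtype_val.comp continuous_snd)).mul (h _ i)).add
    ((continuous_subtype_val.comp continuous_snd).mul (h _ i))

lemma map_double_spread {m n : ℕ} (f : Fin (m + 1) →o Fin (n + 1)) (s : unitInterval)
    (t : TopSimplex m) :
    stdSimplex.map (double f) (spread s t) = spread s (stdSimplex.map f t) := by
  rw [spread, spread, map_mix]
  simp only [stdSimplex.map_comp_apply]
  congr 1
  · exact congrArg (fun g => stdSimplex.map g t) (funext fun i => double_firstHalf f i)
  · exact congrArg (fun g => stdSimplex.map g t) (funext fun i => double_secondHalf f i)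

lemma map_halves_spread {P : Type*} [Preorder P] [Fintype P] {m : ℕ} (f g : Fin (m + 1) →o P)
    (h : ∀ i j, f i ≤ g j) (s : unitInterval) (t : TopSimplex m) :
    stdSimplex.map (halves f g h) (spread s t) =
      mix s (stdSimplex.map f t) (stdSimplex.map g t) := by
  rw [spread, map_mix]
  simp only [stdSimplex.map_comp_apply]
  congr 1
  · exact congrArg (fun g => stdSimplex.map g t) (funext fun i => halves_firstHalf f g h i)
  · exact congrArg (fun g => stdSimplex.map g t) (funext fun i => halves_secondHalf f g h i)

variable {X Y : SSet.{u}}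

/-- The map `|sd X| → |X|` which sends the point `t` of a simplex `σ` of `sd X` to the point of `σ`
with weight `1 - s` on the first half and `s` on the second half. -/
noncomputable def sdToSelf (X : SSet.{u}) (s : unitInterval) :
    SSet.toTop.obj (sd.obj X) ⟶ SSet.toTop.obj X :=
  ptDesc (fun n x => ⟨fun t => pt X (n := n + 1 + n) x (spread s t),
      (pt X (n := n + 1 + n) x).continuous.comp (continuous_spread.comp
        (by fun_prop : Continuous fun t : TopSimplex n => (t, s)))⟩)
    (fun m n θ x t => by
      change pt X (n := m + 1 + m) (X.map (doubling.map θ).op x) (spread s t) =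
        pt X (n := n + 1 + n) x (spread s (stdSimplex.map θ t))
      have h := pt_map (X := X) (m := m + 1 + m) (n := n + 1 + n) (doubling.map θ) x (spread s t)
      refine h.trans ?_
      exact congrArg _ (map_double_spread θ.toOrderHom s t))

lemma sdToSelf_pt (s : unitInterval) {n : ℕ} (x : (sd.obj X) _⦋n⦌) (t : TopSimplex n) :
    sdToSelf X s (pt (sd.obj X) x t) = pt X (n := n + 1 + n) x (spread s t) :=
  ptDesc_pt _ _ x t

lemma sdToSelf_naturality (f : X ⟶ Y) (s : unitInterval) (p : SSet.toTop.obj (sd.obj X)) :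
    sdToSelf Y s (SSet.toTop.map (sd.map f) p) = SSet.toTop.map f (sdToSelf X s p) := by
  obtain ⟨n, x, t, rfl⟩ := pt_surjective p
  rw [toTop_map_pt, sdToSelf_pt, sdToSelf_pt]
  exact (toTop_map_pt (n := n + 1 + n) f x (spread s t)).symm

lemma sdToSelf_one (X : SSet.{u}) : sdToSelf X 1 = SSet.toTop.map (sdSnd.app X) := by
  ext p
  obtain ⟨n, x, t, rfl⟩ := pt_surjective p
  rw [toTop_map_pt, sdToSelf_pt, spread, mix_one]
  exact (pt_map (X := X) (m := n) (n := n + 1 + n) (doublingSnd.app ⦋n⦌) x t).symm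

lemma continuous_sdToSelf (X : SSet.{u}) :
    Continuous fun p : SSet.toTop.obj (sd.obj X) × unitInterval => sdToSelf X p.2 p.1 := by
  rw [continuous_prod_iff_pt]
  intro n x
  simp only [sdToSelf_pt]
  exact (pt X (n := n + 1 + n) x).continuous.comp continuous_spread

/-- The straight-line homotopy from the comparison map `|sd X| → |X|` to the realization of
`sd X ⟶ X`. -/
lemma sdToSelf_homotopic (X : SSet.{u}) (s : unitInterval) :
    (sdToSelf X s).hom.Homotopic (SSet.toTop.map (sdSnd.app X)).hom := by
  let f : C(unitInterval, unitInterval) :=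
    ⟨fun r => unitInterval.symm (unitInterval.symm r * unitInterval.symm s), by fun_prop⟩
  have h1 : Continuous fun p : unitInterval × SSet.toTop.obj (sd.obj X) => (p.2, f p.1) := by
    fun_prop
  have h := (continuous_sdToSelf X).comp h1
  refine ⟨⟨⟨_, h⟩, fun p => ?_, fun p => ?_⟩⟩
  · change sdToSelf X (f 0) p = sdToSelf X s p
    have : f 0 = s := by simp [f]
    rw [this]
  · change sdToSelf X (f 1) p = _
    have : f 1 = 1 := by simp [f]
    rw [this, sdToSelf_one]

section Simplex

/-- The measures `t` and `s` on a chain are separated if the support of `t` is before the support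
of `s`. -/
def Separated {n : ℕ} (t s : TopSimplex n) : Prop := ∀ i j, 0 < t i → 0 < s j → i ≤ j

/-- For separated measures the second has no mass before the first is exhausted; so the distribution
function of the first is determined by that of the sum. -/
lemma cdf_eq_of_separated {n : ℕ} {t s : TopSimplex n} (h : Separated t s) {k : ℕ}
    (hk : k ≤ n + 1) : cdf t k = min 1 (cdf t k + cdf s k) := by
  have ht := cdf_mem t hk
  have hs := cdf_mem s hk
  by_cases h0 : ∃ j : Fin (n + 1), j.val < k ∧ 0 < s j
  · obtain ⟨j, hjk, hj⟩ := h0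
    have : cdf t k = 1 := by
      rw [← stdSimplex.sum_eq_one t, cdf, Finset.sum_filter_of_ne]
      intro i _ hi
      exact lt_of_le_of_lt (h i j (lt_of_le_of_ne (stdSimplex.zero_le t i) (Ne.symm hi)) hj) hjk
    rw [this, min_eq_left (by linarith)]
  · have : cdf s k = 0 := Finset.sum_eq_zero fun j hj => by
      by_contra hne
      exact h0 ⟨j, by simpa using hj, lt_of_le_of_ne (stdSimplex.zero_le s j) (Ne.symm hne)⟩
    rw [this, add_zero, min_eq_right ht.2]

lemma cdf_mix {n : ℕ} (r : unitInterval) (t s : TopSimplex n) (k : ℕ) :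
    cdf (mix r t s) k = (1 - r) * cdf t k + r * cdf s k := by
  rw [cdf, cdf, cdf, Finset.mul_sum, Finset.mul_sum, ← Finset.sum_add_distrib]
  rfl

/-- The midpoint of the unit interval. -/
noncomputable def half : unitInterval := ⟨1 / 2, by norm_num, by norm_num⟩

lemma half_val : (half : ℝ) = 1 / 2 := rfl

lemma eq_of_mix_eq {n : ℕ} {t s t' s' : TopSimplex n} (h : Separated t s) (h' : Separated t' s')
    (hmix : mix half t s = mix half t' s') : t = t' ∧ s = s' := by
  have hc : ∀ k, cdf t k + cdf s k = cdf t' k + cdf s' k := fun k => by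
    have := congrArg (fun m => cdf m k) hmix
    simp only [cdf_mix, half_val] at this
    linarith
  have ht : ∀ k, k ≤ n + 1 → cdf t k = cdf t' k := fun k hk => by
    rw [cdf_eq_of_separated h hk, cdf_eq_of_separated h' hk, hc]
  have ht' : ∀ i, t i = t' i := fun i => by
    have h1 := ht i.val i.2.le
    have h2 := ht (i.val + 1) i.2
    rw [cdf_succ, cdf_succ] at h2
    linarith
  refine ⟨stdSimplex.ext (funext ht'), stdSimplex.ext (funext fun i => ?_)⟩
  have := congrArg (fun m : TopSimplex n => m i) hmix
  simp only [mix_apply, half_val, ht'] at this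
  linarith

/-- The measure whose distribution function is the image of that of `t` under `g`. -/
noncomputable def reweight {n : ℕ} (t : TopSimplex n) (g : ℝ → ℝ) (hg : Monotone g) (h0 : g 0 = 0)
    (h1 : g 1 = 1) : TopSimplex n :=
  ⟨fun i => g (cdf t (i.val + 1)) - g (cdf t i.val),
    fun i => sub_nonneg.2 (hg (cdf_mono t (Nat.le_succ _))), by
    rw [sum_telescope, h0, h1, sub_zero]⟩

/-- Every measure on a chain is the average of two separated measures. -/
lemma exists_separated {n : ℕ} (t : TopSimplex n) :
    ∃ a b : TopSimplex n, Separated a b ∧ mix half a b = t := by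
  -- the first half of the mass of `t`, and the second half
  refine ⟨reweight t (fun x => min 1 (2 * x)) (fun x y h => by dsimp only; gcongr) (by simp)
    (by norm_num), reweight t (fun x => max 0 (2 * x - 1)) (fun x y h => by dsimp only; gcongr)
    (by norm_num) (by norm_num), fun i j hi hj => ?_, ?_⟩
  · by_contra hij
    have h1 : cdf t (j.val + 1) ≤ cdf t i.val := cdf_mono t (not_le.1 hij)
    have h2 : cdf t i.val ≤ cdf t (i.val + 1) := cdf_mono t (Nat.le_succ _)
    have h3 : cdf t j.val ≤ cdf t (j.val + 1) := cdf_mono t (Nat.le_succ _)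
    have hi : 0 < min 1 (2 * cdf t (i.val + 1)) - min 1 (2 * cdf t i.val) := hi
    have hj : 0 < max 0 (2 * cdf t (j.val + 1) - 1) - max 0 (2 * cdf t j.val - 1) := hj
    rcases le_total (cdf t i.val) (1 / 2) with h | h
    · rw [max_eq_left (by linarith), max_eq_left (by linarith)] at hj
      linarith
    · rw [min_eq_left (by linarith), min_eq_left (by linarith)] at hi
      linarith
  · ext i
    rw [mix_apply, half_val]
    have h1 := cdf_succ t i
    change (1 - 1 / 2) * (min 1 (2 * cdf t (i.val + 1)) - min 1 (2 * cdf t i.val)) +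
      1 / 2 * (max 0 (2 * cdf t (i.val + 1) - 1) - max 0 (2 * cdf t i.val - 1)) = t i
    have key : ∀ x : ℝ, min 1 (2 * x) + max 0 (2 * x - 1) = 2 * x := fun x => by
      rcases le_total (2 * x) 1 with h | h
      · rw [min_eq_right h, max_eq_left (by linarith), add_zero]
      · rw [min_eq_left h, max_eq_right (by linarith)]
        ring
    have h2 := key (cdf t i.val)
    have h3 := key (cdf t (i.val + 1))
    linarith

/-- The vertices of a simplex of the subdivision of a simplex, as pairs of vertices. -/
def sdVertex (n k : ℕ) (y : (sd.obj (Δ[n] : SSet.{u})) _⦋k⦌) :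
    Fin (k + 1) →o Fin (n + 1) × Fin (n + 1) :=
  let f : Fin (k + 1 + k + 1) →o Fin (n + 1) :=
    (SSet.stdSimplex.objEquiv (n := ⦋n⦌) (m := op ⦋k + 1 + k⦌) y).toOrderHom
  (f.comp (firstHalf k)).prod (f.comp (secondHalf k))

lemma sdVertex_map (n : ℕ) {k l : ℕ} (θ : ⦋k⦌ ⟶ ⦋l⦌) (y : (sd.obj (Δ[n] : SSet.{u})) _⦋l⦌)
    (i : Fin (k + 1)) :
    sdVertex n k ((sd.obj (Δ[n] : SSet.{u})).map θ.op y) i = sdVertex n l y (θ i) :=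
  Prod.ext
    (congrArg (SSet.stdSimplex.objEquiv (n := ⦋n⦌) (m := op ⦋l + 1 + l⦌) y).toOrderHom
      (double_firstHalf θ.toOrderHom i))
    (congrArg (SSet.stdSimplex.objEquiv (n := ⦋n⦌) (m := op ⦋l + 1 + l⦌) y).toOrderHom
      (double_secondHalf θ.toOrderHom i))

lemma sdVertex_injective (n k : ℕ) : Function.Injective (sdVertex.{u} n k) := by
  intro y z h
  apply (SSet.stdSimplex.objEquiv (n := ⦋n⦌) (m := op ⦋k + 1 + k⦌)).injective
  apply SimplexCategory.Hom.ext
  exact orderHom_ext_halves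
    (fun i => congrArg (fun f : Fin (k + 1) →o Fin (n + 1) × Fin (n + 1) => (f i).1) h)
    (fun i => congrArg (fun f : Fin (k + 1) →o Fin (n + 1) × Fin (n + 1) => (f i).2) h)

/-- The simplex of `sd Δ[n]` given by a monotone map. -/
def sdSimplex {n k : ℕ} (f : Fin (k + 1 + k + 1) →o Fin (n + 1)) :
    (sd.obj (Δ[n] : SSet.{u})) _⦋k⦌ :=
  (SSet.stdSimplex.objEquiv (n := ⦋n⦌) (m := op ⦋k + 1 + k⦌)).symm (SimplexCategory.mkHom f)

lemma exists_sdSimplex {n k : ℕ} (y : (sd.obj (Δ[n] : SSet.{u})) _⦋k⦌) : ∃ f, sdSimplex f = y :=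
  ⟨(SSet.stdSimplex.objEquiv (n := ⦋n⦌) (m := op ⦋k + 1 + k⦌) y).toOrderHom,
    (SSet.stdSimplex.objEquiv (n := ⦋n⦌) (m := op ⦋k + 1 + k⦌)).symm_apply_apply y⟩

/-- The comparison map `|sd Δ[n]| → |Δ[n]|`, with values in the topological simplex. -/
noncomputable def sdMap (n : ℕ) (p : SSet.toTop.obj (sd.obj (Δ[n] : SSet.{u}))) : TopSimplex n :=
  let μ := (toMeasure (sdVertex n) (sdVertex_map n) p).down
  mix half (stdSimplex.map Prod.fst μ) (stdSimplex.map Prod.snd μ)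

lemma sdMap_pt' {n k : ℕ} (f : Fin (k + 1 + k + 1) →o Fin (n + 1)) (w : TopSimplex k) :
    sdMap.{u} n (pt _ (sdSimplex f) w) = mix half (stdSimplex.map (f.comp (firstHalf k)) w)
      (stdSimplex.map (f.comp (secondHalf k)) w) := by
  unfold sdMap
  rw [toMeasure_pt]
  simp only [stdSimplex.map_comp_apply]
  rfl

lemma sdMap_pt {n k : ℕ} (f : Fin (k + 1 + k + 1) →o Fin (n + 1)) (w : TopSimplex k) :
    sdMap.{u} n (pt _ (sdSimplex f) w) = stdSimplex.map f (spread half w) := by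
  rw [sdMap_pt', spread, map_mix, stdSimplex.map_comp_apply, stdSimplex.map_comp_apply]
  rfl

lemma continuous_sdMap (n : ℕ) : Continuous (sdMap.{u} n) := by
  have h : ∀ k : ℕ, ∀ f : Fin (k + 1 + k + 1) →o Fin (n + 1),
      Continuous fun w : TopSimplex k => stdSimplex.map f (spread half w) := fun k f =>
    (stdSimplex.continuous_map f).comp (continuous_spread.comp
      (by fun_prop : Continuous fun w : TopSimplex k => (w, half)))
  rw [continuous_iff_pt]
  intro k y
  obtain ⟨f, rfl⟩ := exists_sdSimplex y
  simp only [sdMap_pt]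
  exact h k f

lemma exists_pos_of_map_pos {ι κ : Type*} [Fintype ι] [Fintype κ] {f : ι → κ} {t : stdSimplex ℝ ι}
    {j : κ} (h : 0 < stdSimplex.map f t j) : ∃ i, f i = j := by
  by_contra hc
  exact h.ne' (map_apply_notMem_range t hc)

lemma separated_map {n k : ℕ} (f : Fin (k + 1 + k + 1) →o Fin (n + 1)) (w : TopSimplex k) :
    Separated (stdSimplex.map (f.comp (firstHalf k)) w)
      (stdSimplex.map (f.comp (secondHalf k)) w) := by
  intro i j hi hj
  obtain ⟨a, rfl⟩ := exists_pos_of_map_pos hi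
  obtain ⟨b, rfl⟩ := exists_pos_of_map_pos hj
  exact f.monotone (firstHalf_le_secondHalf k a b)

/-- A point of `Δⁿ` is the average of a unique separated pair of measures, and such a pair is the
same as a point of `|sd Δ[n]|`, by the monotone coupling. -/
lemma sdMap_bijective (n : ℕ) : Function.Bijective (sdMap.{u} n) := by
  constructor
  · intro p q h
    apply toMeasure_injective (sdVertex n) (sdVertex_map n) (sdVertex_injective n)
    apply ULift.ext
    obtain ⟨k, x, w, rfl⟩ := pt_surjective p
    obtain ⟨l, y, z, rfl⟩ := pt_surjective q
    obtain ⟨f, rfl⟩ := exists_sdSimplex x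
    obtain ⟨g, rfl⟩ := exists_sdSimplex y
    rw [sdMap_pt', sdMap_pt'] at h
    obtain ⟨h1, h2⟩ := eq_of_mix_eq (separated_map f w) (separated_map g z) h
    rw [toMeasure_pt, toMeasure_pt]
    refine eq_of_marginals_eq _ _ w z ?_ ?_
    · rw [stdSimplex.map_comp_apply, stdSimplex.map_comp_apply]
      exact h1
    · rw [stdSimplex.map_comp_apply, stdSimplex.map_comp_apply]
      exact h2
  · intro t
    obtain ⟨a, b, hab, rfl⟩ := exists_separated t
    obtain ⟨k, c, w, hpos, hc⟩ := exists_chain (coupling a b) (coupling_chain a b)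
    have hle : ∀ i j, OrderHom.fst.comp c i ≤ OrderHom.snd.comp c j := fun i j => by
      refine hab _ _ ?_ ?_
      · have := fst_pos_of_pos (hpos i)
        rwa [map_fst_coupling] at this
      · have := snd_pos_of_pos (hpos j)
        rwa [map_snd_coupling] at this
    refine ⟨pt _ (sdSimplex (halves (OrderHom.fst.comp c) (OrderHom.snd.comp c) hle)) w, ?_⟩
    have h1 := map_fst_coupling a b
    have h2 := map_snd_coupling a b
    rw [← hc, stdSimplex.map_comp_apply] at h1 h2
    rw [sdMap_pt, map_halves_spread]
    exact congrArg₂ (mix half) h1 h2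

/-- The realization of `sd Δ[n]` is a topological simplex. -/
noncomputable def sdHomeo (n : ℕ) : SSet.toTop.obj (sd.obj (Δ[n] : SSet.{u})) ≃ₜ TopSimplex n :=
  haveI : CompactSpace (SSet.toTop.obj (sd.obj (Δ[n] : SSet.{u}))) :=
    compactSpace_of_vertexMap _ (sdVertex_map n) (sdVertex_injective n)
  Continuous.homeoOfEquivCompactToT2 (f := Equiv.ofBijective _ (sdMap_bijective n))
    (continuous_sdMap n)

lemma sdHomeo_symm_apply {n k : ℕ} (f : Fin (k + 1 + k + 1) →o Fin (n + 1)) (w : TopSimplex k) :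
    (sdHomeo.{u} n).symm (stdSimplex.map f (spread half w)) = pt _ (sdSimplex f) w := by
  rw [Homeomorph.symm_apply_eq]
  exact (sdMap_pt f w).symm

lemma exists_spread {n : ℕ} (t : TopSimplex n) : ∃ (k : ℕ) (f : Fin (k + 1 + k + 1) →o Fin (n + 1))
    (w : TopSimplex k), stdSimplex.map f (spread half w) = t := by
  obtain ⟨p, rfl⟩ := (sdMap_bijective.{0} n).2 t
  obtain ⟨k, x, w, rfl⟩ := pt_surjective p
  obtain ⟨f, rfl⟩ := exists_sdSimplex x
  exact ⟨k, f, w, (sdMap_pt f w).symm⟩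

end Simplex

/-- A simplex of `X`, as a map to the realization of `sd X`. -/
noncomputable def sdCell {n : ℕ} (x : X _⦋n⦌) : C(TopSimplex n, SSet.toTop.obj (sd.obj X)) :=
  (SSet.toTop.map (sd.map (SSet.yonedaEquiv.symm x))).hom.comp (sdHomeo n).symm

lemma sdCell_map {n k : ℕ} (x : X _⦋n⦌) (f : Fin (k + 1 + k + 1) →o Fin (n + 1))
    (w : TopSimplex k) :
    sdCell x (stdSimplex.map f (spread half w)) =
      pt (sd.obj X) (n := k) (X.map (SimplexCategory.mkHom f).op x) w := by
  have h : sdCell x (stdSimplex.map f (spread half w)) =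
      SSet.toTop.map (sd.map (SSet.yonedaEquiv.symm x))
        ((sdHomeo n).symm (stdSimplex.map f (spread half w))) := rfl
  rw [h, sdHomeo_symm_apply, toTop_map_pt]
  rfl

/-- The inverse of the comparison map `|sd X| → |X|`. -/
noncomputable def sdInv (X : SSet.{u}) : SSet.toTop.obj X ⟶ SSet.toTop.obj (sd.obj X) :=
  ptDesc (fun n x => sdCell x) (fun m n θ x t => by
    obtain ⟨k, f, w, rfl⟩ := exists_spread t
    rw [sdCell_map]
    have h : stdSimplex.map θ (stdSimplex.map f (spread half w)) =
        stdSimplex.map (θ.toOrderHom.comp f) (spread half w) := by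
      rw [stdSimplex.map_comp_apply]
      rfl
    rw [h, sdCell_map, ← Functor.map_comp_apply]
    rfl)

lemma sdInv_pt {n : ℕ} (x : X _⦋n⦌) (t : TopSimplex n) : sdInv X (pt X x t) = sdCell x t :=
  ptDesc_pt _ _ x t

/-- Edgewise subdivision does not change the realization. -/
noncomputable def sdIso (X : SSet.{u}) : SSet.toTop.obj (sd.obj X) ≅ SSet.toTop.obj X where
  hom := sdToSelf X half
  inv := sdInv X
  hom_inv_id := by
    ext p
    obtain ⟨n, x, t, rfl⟩ := pt_surjective p
    rw [ConcreteCategory.comp_apply, sdToSelf_pt]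
    refine (sdInv_pt (n := n + 1 + n) x (spread half t)).trans ?_
    have h := sdCell_map (X := X) (n := n + 1 + n) x OrderHom.id t
    rw [show stdSimplex.map (OrderHom.id : Fin (n + 1 + n + 1) →o Fin (n + 1 + n + 1))
      (spread half t) = spread half t from stdSimplex.map_id_apply _] at h
    rw [h]
    exact congrArg (fun z => pt (sd.obj X) (n := n) z t) (X.map_id_apply _ x)
  inv_hom_id := by
    ext p
    obtain ⟨n, x, t, rfl⟩ := pt_surjective p
    obtain ⟨k, f, w, rfl⟩ := exists_spread t
    rw [ConcreteCategory.comp_apply, sdInv_pt, sdCell_map]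
    refine (sdToSelf_pt half (n := k) (X.map (SimplexCategory.mkHom f).op x) w).trans ?_
    exact pt_map (SimplexCategory.mkHom f) x (spread half w)

lemma sdIso_hom_homotopic (X : SSet.{u}) :
    (sdIso X).hom.hom.Homotopic (SSet.toTop.map (sdSnd.app X)).hom :=
  sdToSelf_homotopic X half

end Realization

end Subdivision

/-! ### Natural transformations and homotopies -/

section NaturalTransformations

open Simplicial Opposite MonoidalCategory CartesianMonoidalCategory

namespace Realization

variable {C C' E E' : Type u} [Category.{u} C] [Category.{u} C'] [Category.{u} E] [Category.{u} E']

/-- A natural transformation, as a functor on the cylinder `[1] × E`. -/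
def cylinder {F G : E ⥤ C} (φ : F ⟶ G) : Fin 2 × E ⥤ C :=
  CategoryTheory.Functor.uncurry.obj (ComposableArrows.mk₁ φ : Fin 2 ⥤ E ⥤ C)

/-- The simplicial homotopy of nerves induced by a natural transformation. -/
def nerveHomotopy {F G : E ⥤ C} (φ : F ⟶ G) : (Δ[1] : SSet.{u}) ⊗ nerve E ⟶ nerve C where
  app n := ↾fun x => (CategoryTheory.Functor.prod'
    (SSet.stdSimplex.objEquiv x.1).toOrderHom.monotone.functor x.2 :
      Fin (n.unop.len + 1) ⥤ Fin 2 × E) ⋙ cylinder φ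
  naturality _ _ _ := rfl

/-- The constant simplices of `Δ[1]`. -/
def constVertex (n : ℕ) (i : Fin 2) : ⦋n⦌ ⟶ ⦋1⦌ :=
  SimplexCategory.mkHom ⟨fun _ => i, fun _ _ _ => le_rfl⟩

lemma nerveHomotopy_zero {F G : E ⥤ C} (φ : F ⟶ G) {n : ℕ} (x : (nerve E) _⦋n⦌) :
    (nerveHomotopy φ).app _ (pairMk (A := Δ[1])
      (SSet.stdSimplex.objEquiv.symm (constVertex n 0)) x) =
      (nerveMap F).app _ x := by
  refine CategoryTheory.Functor.ext (fun _ => rfl) fun i j f => ?_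
  change 𝟙 _ ≫ F.map _ = 𝟙 _ ≫ F.map _ ≫ 𝟙 _
  rw [Category.comp_id]
  rfl

lemma nerveHomotopy_one {F G : E ⥤ C} (φ : F ⟶ G) {n : ℕ} (x : (nerve E) _⦋n⦌) :
    (nerveHomotopy φ).app _ (pairMk (A := Δ[1])
      (SSet.stdSimplex.objEquiv.symm (constVertex n 1)) x) =
      (nerveMap G).app _ x := by
  refine CategoryTheory.Functor.ext (fun _ => rfl) fun i j f => ?_
  change 𝟙 _ ≫ G.map _ = 𝟙 _ ≫ G.map _ ≫ 𝟙 _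
  rw [Category.comp_id]
  rfl

/-- The points of the topological `1`-simplex. -/
noncomputable def segment (s : unitInterval) : TopSimplex 1 :=
  ⟨![1 - s, s], fun i => by
    fin_cases i
    · simpa using s.2.2
    · simpa using s.2.1, by simp⟩

lemma continuous_segment : Continuous segment := by
  refine Continuous.subtype_mk (continuous_pi fun i => ?_) _
  fin_cases i
  · exact continuous_const.sub continuous_subtype_val
  · exact continuous_subtype_val

lemma map_constVertex_zero {n : ℕ} (w : TopSimplex n) :
    stdSimplex.map (constVertex n 0) w = segment 0 := by
  ext i
  fin_cases i
  · rw [map_apply, Finset.sum_filter]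
    refine (Finset.sum_congr rfl fun j _ => if_pos rfl).trans ?_
    rw [stdSimplex.sum_eq_one]
    simp only [segment, Set.Icc.coe_zero, sub_zero]
    rfl
  · refine (map_apply_notMem_range w ?_).trans ?_
    · rintro ⟨j, hj⟩
      exact absurd hj (by change (0 : Fin 2) ≠ 1; decide)
    · rfl

lemma map_constVertex_one {n : ℕ} (w : TopSimplex n) :
    stdSimplex.map (constVertex n 1) w = segment 1 := by
  ext i
  fin_cases i
  · refine (map_apply_notMem_range w ?_).trans ?_
    · rintro ⟨j, hj⟩
      exact absurd hj (by change (1 : Fin 2) ≠ 0; decide)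
    · simp only [segment, Set.Icc.coe_one, sub_self]
      rfl
  · rw [map_apply, Finset.sum_filter]
    refine (Finset.sum_congr rfl fun j _ => if_pos rfl).trans ?_
    rw [stdSimplex.sum_eq_one]
    rfl

/-- The inclusion of the slice of the realization of `Δ[1] ⊗ X` at time `s`. -/
noncomputable def slice (X : SSet.{u}) (s : unitInterval) (p : SSet.toTop.obj X) :
    SSet.toTop.obj (Δ[1] ⊗ X : SSet.{u}) :=
  crossPt (pt Δ[1] (SSet.stdSimplex.objEquiv.symm (𝟙 ⦋1⦌)) (segment s)) p

lemma continuous_slice (X : SSet.{u}) :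
    Continuous fun q : unitInterval × SSet.toTop.obj X => slice X q.1 q.2 := by
  have h1 : Continuous fun q : unitInterval × SSet.toTop.obj X => (segment q.1, q.2) :=
    (continuous_segment.comp continuous_fst).prodMk continuous_snd
  have h2 := (continuous_crossPt (A := Δ[1]) (B := X)
    (SSet.stdSimplex.objEquiv.{u}.symm (𝟙 ⦋1⦌))).comp h1
  exact h2

lemma slice_const {X : SSet.{u}} {n : ℕ} (x : X _⦋n⦌) (w : TopSimplex n) (i : Fin 2)
    (s : unitInterval) (h : stdSimplex.map (constVertex n i) w = segment s) :
    slice X s (pt X x w) = pt (Δ[1] ⊗ X)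
      (pairMk (A := Δ[1]) (SSet.stdSimplex.objEquiv.symm (constVertex n i)) x) w := by
  let a : (Δ[1] : SSet.{u}) _⦋1⦌ := SSet.stdSimplex.objEquiv.symm (𝟙 ⦋1⦌)
  have h0 : slice X s (pt X x w) = cross a x (segment s, w) := by
    unfold slice
    exact crossPt_pt a x (segment s) w
  have h1 : cross a x (stdSimplex.map (constVertex n i) w,
      stdSimplex.map (𝟙 ⦋n⦌ : ⦋n⦌ ⟶ ⦋n⦌) w) = pt (Δ[1] ⊗ X)
        (pairMk ((Δ[1] : SSet.{u}).map (constVertex n i).op a) (X.map (𝟙 ⦋n⦌).op x)) w :=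
    cross_map a x (constVertex n i) (𝟙 _) w
  have hid : stdSimplex.map (𝟙 ⦋n⦌ : ⦋n⦌ ⟶ ⦋n⦌) w = w := stdSimplex.map_id_apply w
  have hx : X.map (𝟙 ⦋n⦌).op x = x := X.map_id_apply _ x
  have ha : (Δ[1] : SSet.{u}).map (constVertex n i).op a =
      SSet.stdSimplex.objEquiv.symm (constVertex n i) := rfl
  rw [hid, h, hx, ha] at h1
  exact h0.trans h1

/-- The homotopy of realizations induced by a natural transformation. -/
noncomputable def homotopyOfNatTrans {F G : E ⥤ C} (φ : F ⟶ G) : ContinuousMap.Homotopy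
    (SSet.toTop.map (nerveMap F)).hom (SSet.toTop.map (nerveMap G)).hom where
  toFun q := SSet.toTop.map (nerveHomotopy φ) (slice (nerve E) q.1 q.2)
  continuous_toFun := (SSet.toTop.map (nerveHomotopy φ)).hom.continuous.comp (continuous_slice _)
  map_zero_left p := by
    obtain ⟨n, x, t, rfl⟩ := pt_surjective p
    rw [slice_const x t 0 0 (map_constVertex_zero t), toTop_map_pt, nerveHomotopy_zero]
    exact (toTop_map_pt (nerveMap F) x t).symm
  map_one_left p := by
    obtain ⟨n, x, t, rfl⟩ := pt_surjective p
    rw [slice_const x t 1 1 (map_constVertex_one t), toTop_map_pt, nerveHomotopy_one]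
    exact (toTop_map_pt (nerveMap G) x t).symm

lemma homotopyOfNatTrans_apply {F G : E ⥤ C} (φ : F ⟶ G) (s : unitInterval)
    (p : SSet.toTop.obj (nerve E)) : homotopyOfNatTrans φ (s, p) =
      SSet.toTop.map (nerveHomotopy φ) (slice (nerve E) s p) := rfl

/-- The functor `i ↦ (x (f i) ⟶ x (g i))` to the category of arrows. -/
def arrowsBetween {N k : ℕ} (x : Fin N ⥤ E) (f g : Fin k →o Fin N) (h : ∀ i, f i ≤ g i) :
    Fin k ⥤ Arrow E where
  obj i := Arrow.mk (x.map (homOfLE (h i)))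
  map {i j} m := Arrow.homMk (x.map (homOfLE (f.monotone m.le))) (x.map (homOfLE (g.monotone m.le)))
    (by
      change x.map _ ≫ x.map _ = x.map _ ≫ x.map _
      rw [← Functor.map_comp, ← Functor.map_comp]
      rfl)
  map_id i := by
    apply Arrow.hom_ext
    · exact x.map_id _
    · exact x.map_id _
  map_comp a b := by
    apply Arrow.hom_ext
    · exact (x.map_comp _ _)
    · exact (x.map_comp _ _)

/-- A simplex of `sd (N E)`, as a sequence of composable morphisms in the category of arrows of `E`:
the functor `i ↦ (x_i ⟶ x_{n + 1 + i})`. -/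
def sdToArrows (E : Type u) [Category.{u} E] : sd.obj (nerve E) ⟶ nerve (Arrow E) where
  app n := ↾fun x => arrowsBetween (N := n.unop.len + 1 + n.unop.len + 1) x
    (firstHalf n.unop.len) (secondHalf n.unop.len) fun i => firstHalf_le_secondHalf _ i i
  naturality m n θ := by
    ext x
    have hc : ∀ {N k : ℕ} (y : Fin N ⥤ E) (f g f' g' : Fin k →o Fin N) (h : ∀ i, f i ≤ g i)
        (h' : ∀ i, f' i ≤ g' i), f = f' → g = g' →
        arrowsBetween y f g h = arrowsBetween y f' g' h' := by
      rintro N k y f g _ _ h h' rfl rfl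
      rfl
    let f : Fin (n.unop.len + 1) →o Fin (m.unop.len + 1) := θ.unop.toOrderHom
    have h1 : (double f).comp (firstHalf _) = (firstHalf _).comp f :=
      OrderHom.ext _ _ (funext (double_firstHalf f))
    have h2 : (double f).comp (secondHalf _) = (secondHalf _).comp f :=
      OrderHom.ext _ _ (funext (double_secondHalf f))
    exact hc (N := m.unop.len + 1 + m.unop.len + 1) x ((double f).comp (firstHalf _))
      ((double f).comp (secondHalf _)) ((firstHalf _).comp f) ((secondHalf _).comp f)
      (fun i => (double f).monotone (firstHalf_le_secondHalf _ i i))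
      (fun i => firstHalf_le_secondHalf _ (f i) (f i)) h1 h2

lemma sdToArrows_rightFunc : sdToArrows E ≫ nerveMap Arrow.rightFunc = sdSnd.app (nerve E) := rfl

end Realization

end NaturalTransformations

/-! ### Functors to the Grothendieck construction -/

section GrothendieckConstruction

namespace Realization

variable {S : Type u} [SmallCategory S] {D : S ⥤ Cat.{u, u}}

lemma toFunctor_comp {a b c : S} (f : a ⟶ b) (g : b ⟶ c) (h : a ⟶ c) (w : f ≫ g = h) :
    (D.map f).toFunctor ⋙ (D.map g).toFunctor = (D.map h).toFunctor := by
  rw [← w, D.map_comp]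
  rfl

lemma toFunctor_obj {a b c : S} {f : a ⟶ b} {g : b ⟶ c} {h : a ⟶ c} (w : f ≫ g = h) (x : D.obj a) :
    (D.map g).toFunctor.obj ((D.map f).toFunctor.obj x) = (D.map h).toFunctor.obj x :=
  CategoryTheory.Functor.congr_obj (toFunctor_comp f g h w) x

lemma toFunctor_map_heq {a b c : S} {f : a ⟶ b} {g : b ⟶ c} {h : a ⟶ c} (w : f ≫ g = h)
    {x y : D.obj a} (m : x ⟶ y) :
    (D.map g).toFunctor.map ((D.map f).toFunctor.map m) ≍ (D.map h).toFunctor.map m := by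
  subst w
  rw [D.map_comp]
  rfl

lemma toFunctor_id_obj {a : S} (x : D.obj a) : (D.map (𝟙 a)).toFunctor.obj x = x := by
  rw [D.map_id]
  rfl

lemma toFunctor_id_map_heq {a : S} {x y : D.obj a} (m : x ⟶ y) :
    (D.map (𝟙 a)).toFunctor.map m ≍ m := by
  rw [D.map_id]
  rfl

lemma map_eqToHom_comp_heq {C E : Type u} [Category.{u} C] [Category.{u} E] (F : C ⥤ E) {x y z : C}
    (h : x = y) (m : y ⟶ z) : F.map (eqToHom h ≫ m) ≍ F.map m := by
  subst h
  rw [eqToHom_refl, Category.id_comp]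

lemma map_eqToHom_heq {C E : Type u} [Category.{u} C] [Category.{u} E] (F : C ⥤ E) {x y : C}
    (h : x = y) : F.map (eqToHom h) ≍ 𝟙 (F.obj y) := by
  subst h
  rw [eqToHom_refl, F.map_id]

lemma comp_heq_comp {C : Type u} [Category.{u} C] {x y z x' y' z' : C} (hx : x = x') (hy : y = y')
    (hz : z = z') {f : x ⟶ y} {g : y ⟶ z} {f' : x' ⟶ y'} {g' : y' ⟶ z'} (hf : f ≍ f')
    (hg : g ≍ g') : f ≫ g ≍ f' ≫ g' := by
  subst hx hy hz
  rw [eq_of_heq hf, eq_of_heq hg]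

lemma grothendieck_obj_ext {X Y : Grothendieck D} (h : X.base = Y.base) (h' : X.fiber ≍ Y.fiber) :
    X = Y := by
  obtain ⟨a, x⟩ := X
  obtain ⟨b, y⟩ := Y
  obtain rfl : a = b := h
  obtain rfl : x = y := eq_of_heq h'
  rfl

lemma grothendieck_hom_heq {X Y X' Y' : Grothendieck D} (hX : X = X') (hY : Y = Y') (f : X ⟶ Y)
    (f' : X' ⟶ Y') (hb : f.base ≍ f'.base) (hf : f.fiber ≍ f'.fiber) : f ≍ f' := by
  subst hX hY
  obtain ⟨b, m⟩ := f
  obtain ⟨b', m'⟩ := f'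
  obtain rfl : b = b' := eq_of_heq hb
  obtain rfl : m = m' := eq_of_heq hf
  rfl

lemma id_fiber_heq (X : Grothendieck D) : Grothendieck.Hom.fiber (𝟙 X) ≍ 𝟙 X.fiber :=
  (heq_of_eq (Grothendieck.id_fiber X)).trans (eqToHom_heq_id_cod _ _ (by simp))

variable (D) in
/-- The functor `(g, x) ↦ (cod g, D g x)` to the Grothendieck construction. -/
def total (b : S) : Under b × D.obj b ⥤ Grothendieck D where
  obj p := ⟨p.1.right, (D.map p.1.hom).toFunctor.obj p.2⟩
  map {p q} m := ⟨m.1.right, eqToHom (toFunctor_obj (Under.w m.1) p.2) ≫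
    (D.map q.1.hom).toFunctor.map m.2⟩
  map_id p := by
    refine Grothendieck.ext _ _ rfl (eq_of_heq ?_)
    refine (eqToHom_comp_heq _ _).trans ((eqToHom_comp_heq _ _).trans (HEq.trans ?_
      (id_fiber_heq _).symm))
    exact heq_of_eq ((D.map p.1.hom).toFunctor.map_id p.2)
  map_comp {p q r} m n := by
    refine Grothendieck.ext _ _ rfl (eq_of_heq ?_)
    refine (eqToHom_comp_heq _ _).trans ((eqToHom_comp_heq _ _).trans (HEq.trans ?_
      (eqToHom_comp_heq _ _).symm))
    refine (heq_of_eq ((D.map r.1.hom).toFunctor.map_comp m.2 n.2)).trans ?_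
    have ho : ∀ x, (D.map r.1.hom).toFunctor.obj x =
        (D.map n.1.right).toFunctor.obj ((D.map q.1.hom).toFunctor.obj x) := fun x =>
      (toFunctor_obj (Under.w n.1) x).symm
    exact comp_heq_comp ((ho p.2).trans (congrArg _ (toFunctor_obj (Under.w m.1) p.2).symm))
      (ho q.2) rfl ((toFunctor_map_heq (Under.w n.1) m.2).symm.trans
        (map_eqToHom_comp_heq _ (toFunctor_obj (Under.w m.1) p.2) _).symm)
      (eqToHom_comp_heq _ (toFunctor_obj (Under.w n.1) q.2)).symm

/-- The functors `total D b` are compatible with composition in the first variable and `D` in the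
second; this makes them into a cocone. -/
lemma total_under_map {a b : S} (k : a ⟶ b) :
    (Under.map k).prod (𝟭 _) ⋙ total D a = (𝟭 _).prod (D.map k).toFunctor ⋙ total D b := by
  have hobj : ∀ p, ((Under.map k).prod (𝟭 _) ⋙ total D a).obj p =
      ((𝟭 _).prod (D.map k).toFunctor ⋙ total D b).obj p := fun p =>
    grothendieck_obj_ext rfl (heq_of_eq (toFunctor_obj (f := k) (g := p.1.hom) rfl p.2).symm)
  refine CategoryTheory.Functor.hext hobj fun p q m => ?_
  refine grothendieck_hom_heq (hobj p) (hobj q) _ _ HEq.rfl ?_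
  refine (eqToHom_comp_heq _ _).trans (HEq.trans ?_ (eqToHom_comp_heq _ _).symm)
  exact (toFunctor_map_heq (f := k) (g := q.1.hom) rfl m.2).symm

section Push

variable {J : Type v} [Category.{w} J]

/-- Objects of the Grothendieck construction over `a`, pushed to the fiber over `a`. -/
def push (X : J ⥤ Grothendieck D) {a : S} (ν : ∀ j, (X.obj j).base ⟶ a)
    (hν : ∀ {i j} (f : i ⟶ j), (X.map f).base ≫ ν j = ν i) : J ⥤ D.obj a where
  obj j := (D.map (ν j)).toFunctor.obj (X.obj j).fiber
  map {i j} f := eqToHom (toFunctor_obj (hν f) _).symm ≫ (D.map (ν j)).toFunctor.map (X.map f).fiber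
  map_id j := by
    refine eq_of_heq ((eqToHom_comp_heq _ _).trans ?_)
    rw [Grothendieck.congr (X.map_id j)]
    exact (map_eqToHom_comp_heq _ _ _).trans (map_eqToHom_heq _ (by simp))
  map_comp {i j k} f g := by
    refine eq_of_heq ((eqToHom_comp_heq _ _).trans ?_)
    rw [Grothendieck.congr (X.map_comp f g)]
    refine (map_eqToHom_comp_heq _ _ _).trans ((map_eqToHom_comp_heq _ _ _).trans ?_)
    rw [Functor.map_comp]
    exact comp_heq_comp ((toFunctor_obj (hν g) _).trans (toFunctor_obj (hν f) _))
      (toFunctor_obj (hν g) _) rfl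
      ((toFunctor_map_heq (hν g) _).trans (eqToHom_comp_heq _ _).symm)
      (eqToHom_comp_heq _ _).symm

lemma push_comp (X : J ⥤ Grothendieck D) {a b : S} (ν : ∀ j, (X.obj j).base ⟶ a)
    (hν : ∀ {i j} (f : i ⟶ j), (X.map f).base ≫ ν j = ν i) (k : a ⟶ b)
    (ν' : ∀ j, (X.obj j).base ⟶ b)
    (hν' : ∀ {i j} (f : i ⟶ j), (X.map f).base ≫ ν' j = ν' i) (h : ∀ j, ν j ≫ k = ν' j) :
    push X ν hν ⋙ (D.map k).toFunctor = push X ν' hν' := by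
  refine CategoryTheory.Functor.hext (fun j => toFunctor_obj (h j) _) fun i j f => ?_
  refine (map_eqToHom_comp_heq _ _ _).trans (HEq.trans ?_ (eqToHom_comp_heq _ _).symm)
  exact toFunctor_map_heq (h j) _

lemma push_total {b a : S} (Y : J ⥤ Under b × D.obj b) (ν : ∀ j, ((Y ⋙ total D b).obj j).base ⟶ a)
    (hν : ∀ {i j} (f : i ⟶ j), ((Y ⋙ total D b).map f).base ≫ ν j = ν i) (k : b ⟶ a)
    (h : ∀ j, (Y.obj j).1.hom ≫ ν j = k) :
    push (Y ⋙ total D b) ν hν = (Y ⋙ CategoryTheory.Prod.snd _ _) ⋙ (D.map k).toFunctor := by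
  refine CategoryTheory.Functor.hext (fun j => toFunctor_obj (h j) _) fun i j f => ?_
  refine (eqToHom_comp_heq _ _).trans ((map_eqToHom_comp_heq _ _ _).trans ?_)
  exact toFunctor_map_heq (h j) _

end Push

lemma arrow_w_base {f g : Arrow (Grothendieck D)} (m : f ⟶ g) :
    f.hom.base ≫ m.right.base = m.left.base ≫ g.hom.base :=
  congrArg Grothendieck.Hom.base (Arrow.w m).symm

lemma arrow_push_obj {f g : Arrow (Grothendieck D)} (m : f ⟶ g) :
    (D.map m.right.base).toFunctor.obj ((D.map f.hom.base).toFunctor.obj f.left.fiber) =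
      (D.map g.hom.base).toFunctor.obj ((D.map m.left.base).toFunctor.obj f.left.fiber) :=
  (toFunctor_obj (D := D) rfl f.left.fiber).trans
    (toFunctor_obj (arrow_w_base m).symm f.left.fiber).symm

variable (D) in
/-- The functor `((t, x) ⟶ (t', x')) ↦ (t', D (t ⟶ t') x)` on the category of arrows of the
Grothendieck construction. -/
def pushArrow : Arrow (Grothendieck D) ⥤ Grothendieck D where
  obj f := ⟨f.right.base, (D.map f.hom.base).toFunctor.obj f.left.fiber⟩
  map {f g} m := ⟨m.right.base, eqToHom (arrow_push_obj m) ≫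
    (D.map g.hom.base).toFunctor.map m.left.fiber⟩
  map_id f := by
    refine Grothendieck.ext _ _ rfl (eq_of_heq ?_)
    refine (eqToHom_comp_heq _ _).trans ((eqToHom_comp_heq _ _).trans (HEq.trans ?_
      (id_fiber_heq _).symm))
    exact map_eqToHom_heq _ (by simp)
  map_comp {f g h} m n := by
    refine Grothendieck.ext _ _ rfl (eq_of_heq ?_)
    refine (eqToHom_comp_heq _ _).trans ((eqToHom_comp_heq _ _).trans (HEq.trans ?_
      (eqToHom_comp_heq _ _).symm))
    refine (map_eqToHom_comp_heq _ _ _).trans ?_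
    rw [Functor.map_comp]
    have hn := arrow_w_base n
    have hg : ∀ x, (D.map h.hom.base).toFunctor.obj ((D.map n.left.base).toFunctor.obj x) =
        (D.map n.right.base).toFunctor.obj ((D.map g.hom.base).toFunctor.obj x) := fun x =>
      (toFunctor_obj hn.symm x).trans (toFunctor_obj (D := D) rfl x).symm
    exact comp_heq_comp ((hg _).trans (congrArg _ (arrow_push_obj m).symm)) (hg _) rfl
      ((toFunctor_map_heq hn.symm _).trans ((toFunctor_map_heq (D := D) rfl _).symm.trans
        (map_eqToHom_comp_heq _ (arrow_push_obj m) _).symm))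
      (eqToHom_comp_heq _ (arrow_push_obj n)).symm

variable (D) in
/-- The transformation `(t', D (t ⟶ t') x) ⟶ (t', x')`. -/
def pushArrowToRight : pushArrow D ⟶ Arrow.rightFunc where
  app f := ⟨𝟙 _, eqToHom (toFunctor_id_obj _) ≫ f.hom.fiber⟩
  naturality f g m := by
    refine Grothendieck.ext _ _ ((Category.comp_id _).trans (Category.id_comp _).symm)
      (eq_of_heq ?_)
    refine (eqToHom_comp_heq _ _).trans ((eqToHom_comp_heq _ _).trans (HEq.trans ?_
      (eqToHom_comp_heq _ _).symm))
    have hw : (m.left ≫ g.hom).fiber ≍ (f.hom ≫ m.right).fiber := by rw [Arrow.w m]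
    have hw' : (D.map g.hom.base).toFunctor.map m.left.fiber ≫ g.hom.fiber ≍
        (D.map m.right.base).toFunctor.map f.hom.fiber ≫ m.right.fiber :=
      (eqToHom_comp_heq _ _).symm.trans (hw.trans (eqToHom_comp_heq _ _))
    refine HEq.trans ?_ (hw'.trans ?_)
    · refine comp_heq_comp ((toFunctor_id_obj _).trans (arrow_push_obj m)) (toFunctor_id_obj _) rfl
        ((toFunctor_id_map_heq _).trans (eqToHom_comp_heq _ _)) (eqToHom_comp_heq _ _)
    · exact comp_heq_comp (congrArg _ (toFunctor_id_obj _).symm) rfl rfl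
        (map_eqToHom_comp_heq _ (toFunctor_id_obj _) _).symm HEq.rfl

end Realization

end GrothendieckConstruction

/-! ### The nerve of the Grothendieck construction and the colimit of nerves -/

section Comparison

open Simplicial Opposite

namespace Realization

variable {S : Type u} [SmallCategory S] {D : S ⥤ Cat.{u, u}}

section Lifts

variable {J : Type v} [Category.{w} J]

/-- A cone over a diagram in `S`, as a diagram of objects under its vertex. -/
def underOf {a : S} (T : J ⥤ S) (μ : ∀ j, a ⟶ T.obj j)
    (hμ : ∀ {i j} (f : i ⟶ j), μ i ≫ T.map f = μ j) : J ⥤ Under a where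
  obj j := Under.mk (μ j)
  map f := Under.homMk (T.map f) (hμ f)

lemma underOf_map {b c : S} (Y : J ⥤ Under b) (k : b ⟶ c) (μ : ∀ j, c ⟶ (Y.obj j).right)
    (hμ : ∀ {i j} (f : i ⟶ j), μ i ≫ (Y ⋙ Under.forget b).map f = μ j)
    (h : ∀ j, k ≫ μ j = (Y.obj j).hom) :
    underOf (Y ⋙ Under.forget b) μ hμ ⋙ Under.map k = Y := by
  refine functor_eq_of_app_eq_eqToHom
    { app := fun j => Under.homMk (𝟙 (Y.obj j).right) ((Category.comp_id _).trans (h j))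
      naturality := fun i j f => ?_ } fun j => ?_
  · apply Under.UnderMorphism.ext
    exact (Category.comp_id _).trans (Category.id_comp _).symm
  · have : ∀ (Z W : Under b) (hr : Z.right = W.right) (m : Z ⟶ W), m.right = eqToHom hr →
        ∃ e : Z = W, m = eqToHom e := by
      rintro ⟨⟨⟨⟩⟩, z, q⟩ ⟨⟨⟨⟩⟩, w, r⟩ hr m hm
      obtain rfl : z = w := hr
      have hw : q ≫ m.right = r := Under.w m
      rw [hm] at hw
      obtain rfl : q = r := by simpa using hw
      exact ⟨rfl, Under.UnderMorphism.ext hm⟩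
    exact this (Under.mk (k ≫ μ j)) (Y.obj j) rfl
      (Under.homMk (𝟙 (Y.obj j).right) ((Category.comp_id _).trans (h j))) rfl

lemma underOf_push_total {a : S} (X : J ⥤ Arrow (Grothendieck D))
    (ν : ∀ j, (X.obj j).left.base ⟶ a)
    (hν : ∀ {i j} (f : i ⟶ j), ((X ⋙ Arrow.leftFunc).map f).base ≫ ν j = ν i)
    (μ : ∀ j, a ⟶ (X.obj j).right.base)
    (hμ : ∀ {i j} (f : i ⟶ j), μ i ≫ (X ⋙ Arrow.rightFunc ⋙ Grothendieck.forget D).map f = μ j)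
    (h : ∀ j, ν j ≫ μ j = (X.obj j).hom.base) :
    (underOf (X ⋙ Arrow.rightFunc ⋙ Grothendieck.forget D) μ hμ).prod'
      (push (X ⋙ Arrow.leftFunc) ν hν) ⋙ total D a = X ⋙ pushArrow D := by
  have hobj : ∀ j, ((underOf (X ⋙ Arrow.rightFunc ⋙ Grothendieck.forget D) μ hμ).prod'
      (push (X ⋙ Arrow.leftFunc) ν hν) ⋙ total D a).obj j = (X ⋙ pushArrow D).obj j := fun j =>
    grothendieck_obj_ext rfl (heq_of_eq (toFunctor_obj (h j) _))
  refine CategoryTheory.Functor.hext hobj fun i j f => ?_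
  refine grothendieck_hom_heq (hobj i) (hobj j) _ _ HEq.rfl ?_
  refine (eqToHom_comp_heq _ _).trans ((map_eqToHom_comp_heq _ _ _).trans (HEq.trans ?_
    (eqToHom_comp_heq _ _).symm))
  exact toFunctor_map_heq (h j) _

end Lifts

variable (D)

/-- The functors from the terms of `prodDiagram D` to the Grothendieck construction. -/
def totalOf (f : MorphismCat S) : Under f.cod × D.obj f.dom ⥤ Grothendieck D :=
  (𝟭 _).prod (D.map f.arr).toFunctor ⋙ total D f.cod

lemma totalOf_map {f g : MorphismCat S} (m : f ⟶ g) :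
    (Under.map m.k).prod (D.map m.h).toFunctor ⋙ totalOf D g = totalOf D f := by
  have h1 := congrArg (fun F => (𝟭 (Under f.cod)).prod
    ((D.map m.h).toFunctor ⋙ (D.map g.arr).toFunctor) ⋙ F) (total_under_map (D := D) m.k)
  have h2 : ((D.map m.h).toFunctor ⋙ (D.map g.arr).toFunctor) ⋙ (D.map m.k).toFunctor =
      (D.map f.arr).toFunctor := by
    rw [toFunctor_comp m.h g.arr _ rfl, toFunctor_comp _ m.k f.arr
      ((Category.assoc _ _ _).trans m.w)]
  have h3 : (𝟭 (Under f.cod)).prod ((D.map m.h).toFunctor ⋙ (D.map g.arr).toFunctor) ⋙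
      (𝟭 _).prod (D.map m.k).toFunctor ⋙ total D f.cod = totalOf D f := by
    rw [totalOf, ← h2]
    rfl
  exact h1.trans h3

/-- The cocone over `prodDiagram D` given by the Grothendieck construction. -/
def totalCocone : Cocone (prodDiagram D) where
  pt := Cat.of (Grothendieck D)
  ι :=
    { app := fun f => (totalOf D f).toCatHom
      naturality := fun _ _ m => Cat.ext (totalOf_map D m) }

/-- The diagram of nerves of the terms of `prodDiagram D`. -/
def nerveDiagram : MorphismCat S ⥤ SSet.{u} := prodDiagram D ⋙ nerveFunctor

/-- The comparison map from the colimit of the nerves to the nerve of the colimit. -/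
noncomputable def nerveComparison : colimit (nerveDiagram D) ⟶ nerve (Grothendieck D) :=
  colimit.desc (nerveDiagram D) (nerveFunctor.mapCocone (totalCocone D))

lemma ι_nerveComparison (f : MorphismCat S) :
    colimit.ι (nerveDiagram D) f ≫ nerveComparison D = nerveMap (totalOf D f) :=
  colimit.ι_desc _ f

variable {D}

/-- The class of a simplex of the nerve of `(cod f ↓ S) × D (dom f)` in the colimit. -/
noncomputable def cls (f : MorphismCat S) {n : ℕ} (x : Fin (n + 1) ⥤ Under f.cod)
    (y : Fin (n + 1) ⥤ D.obj f.dom) : (colimit (nerveDiagram D)) _⦋n⦌ :=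
  (colimit.ι (nerveDiagram D) f).app (op ⦋n⦌) (x.prod' y)

lemma cls_map {f g : MorphismCat S} (m : f ⟶ g) {n : ℕ} (x : Fin (n + 1) ⥤ Under f.cod)
    (y : Fin (n + 1) ⥤ D.obj f.dom) :
    cls g (x ⋙ Under.map m.k) (y ⋙ (D.map m.h).toFunctor) = cls f x y := by
  have h := congrArg (fun φ => φ.app (op ⦋n⦌) (x.prod' y)) (colimit.w (nerveDiagram D) m)
  exact h

section Factor

variable {n N : ℕ} (x : Fin N ⥤ Grothendieck D) (f g : Fin (n + 1) →o Fin N)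

lemma base_comp {i j k : Fin N} (a : i ⟶ j) (b : j ⟶ k) (c : i ⟶ k) :
    (x.map a).base ≫ (x.map b).base = (x.map c).base := by
  rw [Subsingleton.elim c (a ≫ b), x.map_comp]
  rfl

/-- The projections to `S` of the objects `x (g i)`, as objects under that of `x p`. -/
def underAt (p : Fin N) (hg : ∀ i, p ≤ g i) : Fin (n + 1) ⥤ Under (x.obj p).base :=
  underOf (g.monotone.functor ⋙ x ⋙ Grothendieck.forget D) (fun i => (x.map (homOfLE (hg i))).base)
    (fun _ => base_comp x _ _ _)

/-- The objects `x (f i)`, pushed to the fiber of `x p`. -/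
def pushAt (p : Fin N) (hf : ∀ i, f i ≤ p) : Fin (n + 1) ⥤ D.obj (x.obj p).base :=
  push (f.monotone.functor ⋙ x) (fun i => (x.map (homOfLE (hf i))).base)
    (fun _ => base_comp x _ _ _)

lemma underAt_map {p q : Fin N} (hpq : p ≤ q) (hg : ∀ i, q ≤ g i) :
    underAt x g q hg ⋙ Under.map (x.map (homOfLE hpq)).base =
      underAt x g p fun i => hpq.trans (hg i) :=
  underOf_map (underAt x g p fun i => hpq.trans (hg i)) _ _ (fun _ => base_comp x _ _ _)
    fun _ => base_comp x _ _ _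

lemma pushAt_map {p q : Fin N} (hpq : p ≤ q) (hf : ∀ i, f i ≤ p) :
    pushAt x f p hf ⋙ (D.map (x.map (homOfLE hpq)).base).toFunctor =
      pushAt x f q fun i => (hf i).trans hpq :=
  push_comp (f.monotone.functor ⋙ x) (fun i => (x.map (homOfLE (hf i))).base)
    (fun _ => base_comp x _ _ _) (x.map (homOfLE hpq)).base
    (fun i => (x.map (homOfLE ((hf i).trans hpq))).base) (fun _ => base_comp x _ _ _)
    fun _ => base_comp x _ _ _

/-- The simplex of the colimit defined by a sequence of morphisms of the Grothendieck construction
which factor over the object `x p`. -/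
noncomputable def factorCls (p : Fin N) (hf : ∀ i, f i ≤ p) (hg : ∀ i, p ≤ g i) :
    (colimit (nerveDiagram D)) _⦋n⦌ :=
  cls ⟨(x.obj p).base, (x.obj p).base, 𝟙 _⟩ (underAt x g p hg) (pushAt x f p hf)

lemma cls_congr (e : MorphismCat S) {n : ℕ} {x x' : Fin (n + 1) ⥤ Under e.cod}
    {y y' : Fin (n + 1) ⥤ D.obj e.dom} (hx : x = x') (hy : y = y') : cls e x y = cls e x' y' := by
  rw [hx, hy]

lemma comp_underMap_id {J : Type v} [Category.{w} J] {b : S} (x : J ⥤ Under b) :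
    x ⋙ Under.map (𝟙 b) = x := by
  rw [Under.mapId_eq]
  rfl

lemma comp_toFunctor_id {J : Type v} [Category.{w} J] {b : S} (x : J ⥤ D.obj b) :
    x ⋙ (D.map (𝟙 b)).toFunctor = x := by
  rw [D.map_id]
  rfl

/-- The simplex does not depend on the choice of the intermediate object: both choices come from the
morphism `x p ⟶ x q`, seen as an object of the morphism category. -/
lemma factorCls_eq {p q : Fin N} (hpq : p ≤ q) (hf : ∀ i, f i ≤ p) (hg : ∀ i, q ≤ g i) :
    factorCls x f g p hf (fun i => hpq.trans (hg i)) =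
      factorCls x f g q (fun i => (hf i).trans hpq) hg := by
  let k : (x.obj p).base ⟶ (x.obj q).base := (x.map (homOfLE hpq)).base
  let e : MorphismCat S := ⟨(x.obj p).base, (x.obj q).base, k⟩
  let m₁ : e ⟶ ⟨(x.obj p).base, (x.obj p).base, 𝟙 _⟩ := ⟨𝟙 _, k, by simp [e]⟩
  let m₂ : e ⟶ ⟨(x.obj q).base, (x.obj q).base, 𝟙 _⟩ := ⟨k, 𝟙 _, by simp [e]⟩
  refine Eq.trans ?_ (((cls_map m₁ (underAt x g q hg) (pushAt x f p hf)).trans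
    (cls_map m₂ (underAt x g q hg) (pushAt x f p hf)).symm).trans ?_)
  · exact cls_congr _ (underAt_map x g hpq hg).symm (comp_toFunctor_id _).symm
  · exact cls_congr _ (comp_underMap_id _) (pushAt_map x f hpq hf)

lemma map_factorCls {m : ℕ} (θ : ⦋m⦌ ⟶ ⦋n⦌) (p : Fin N) (hf : ∀ i, f i ≤ p) (hg : ∀ i, p ≤ g i) :
    (colimit (nerveDiagram D)).map θ.op (factorCls x f g p hf hg) =
      factorCls x (f.comp θ.toOrderHom) (g.comp θ.toOrderHom) p (fun _ => hf _) (fun _ => hg _) :=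
  ((colimit.ι (nerveDiagram D) _).naturality_apply θ.op _).symm

lemma factorCls_congr {f f' g g' : Fin (n + 1) →o Fin N} {p q : Fin N} (h1 : f = f') (h2 : g = g')
    (h3 : p = q) (hf : ∀ i, f i ≤ p) (hg : ∀ i, p ≤ g i) :
    factorCls x f g p hf hg = factorCls x f' g' q (fun i => h1 ▸ h3 ▸ hf i)
      (fun i => h2 ▸ h3 ▸ hg i) := by
  subst h1 h2 h3
  rfl

end Factor

variable (D) in
/-- The map from the edgewise subdivision of the nerve of the Grothendieck construction back to the
colimit of the nerves.  A simplex of the subdivision is a chain `x₀ ⟶ ⋯ ⟶ xₙ ⟶ y₀ ⟶ ⋯ ⟶ yₙ`, and is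
sent to the chain of the `yᵢ` in `S`, under the first of them, together with the chain of the `xᵢ`
pushed to the fiber over `y₀`. -/
noncomputable def fromSd : sd.obj (nerve (Grothendieck D)) ⟶ colimit (nerveDiagram D) where
  app n := ↾fun x => factorCls (N := n.unop.len + 1 + n.unop.len + 1) (n := n.unop.len) x
    (firstHalf n.unop.len) (secondHalf n.unop.len) (secondHalf _ 0)
    (fun _ => firstHalf_le_secondHalf _ _ _) (fun i => (secondHalf _).monotone (Fin.zero_le i))
  naturality m n θ := by
    ext x
    let f : Fin (n.unop.len + 1) →o Fin (m.unop.len + 1) := θ.unop.toOrderHom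
    have h1 : (double f).comp (firstHalf _) = (firstHalf _).comp f :=
      OrderHom.ext _ _ (funext (double_firstHalf f))
    have h2 : (double f).comp (secondHalf _) = (secondHalf _).comp f :=
      OrderHom.ext _ _ (funext (double_secondHalf f))
    have h3 := factorCls_congr (N := m.unop.len + 1 + m.unop.len + 1) x h1 h2
      (double_secondHalf f 0) (fun i => (double f).monotone (firstHalf_le_secondHalf _ i 0))
      (fun i => (double f).monotone ((secondHalf _).monotone (Fin.zero_le i)))
    have h4 := factorCls_eq (N := m.unop.len + 1 + m.unop.len + 1) x ((firstHalf _).comp f)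
      ((secondHalf _).comp f) ((secondHalf _).monotone (Fin.zero_le (f 0)))
      (fun i => firstHalf_le_secondHalf _ _ _)
      (fun i => (secondHalf _).monotone (f.monotone (Fin.zero_le i)))
    have h5 := map_factorCls (N := m.unop.len + 1 + m.unop.len + 1) x (firstHalf _) (secondHalf _)
      θ.unop (secondHalf _ 0) (fun _ => firstHalf_le_secondHalf _ _ _)
      (fun i => (secondHalf _).monotone (Fin.zero_le i))
    exact h3.trans (h4.symm.trans h5.symm)

lemma nerveComparison_cls (f : MorphismCat S) {n : ℕ} (x : Fin (n + 1) ⥤ Under f.cod)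
    (y : Fin (n + 1) ⥤ D.obj f.dom) : (nerveComparison D).app (op ⦋n⦌) (cls f x y) =
      (x.prod' (y ⋙ (D.map f.arr).toFunctor) ⋙ total D f.cod : Fin (n + 1) ⥤ Grothendieck D) :=
  congrArg (fun φ => φ.app (op ⦋n⦌) (x.prod' y)) (ι_nerveComparison D f)

lemma nerveComparison_factorCls {n N : ℕ} (x : Fin N ⥤ Grothendieck D) (f g : Fin (n + 1) →o Fin N)
    (p : Fin N) (hf : ∀ i, f i ≤ p) (hg : ∀ i, p ≤ g i) :
    (nerveComparison D).app (op ⦋n⦌) (factorCls x f g p hf hg) =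
      arrowsBetween x f g (fun i => (hf i).trans (hg i)) ⋙ pushArrow D := by
  refine (nerveComparison_cls _ _ _).trans ?_
  rw [comp_toFunctor_id]
  exact underOf_push_total (arrowsBetween x f g (fun i => (hf i).trans (hg i)))
    (fun i => (x.map (homOfLE (hf i))).base) (fun _ => base_comp x _ _ _)
    (fun i => (x.map (homOfLE (hg i))).base) (fun _ => base_comp x _ _ _)
    (fun _ => base_comp x _ _ _)

/-- The composite `sd N (Gr D) ⟶ W ⟶ N (Gr D)`, for the colimit `W` of the nerves. -/
lemma fromSd_nerveComparison : fromSd D ≫ nerveComparison D =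
    sdToArrows (Grothendieck D) ≫ nerveMap (pushArrow D) := by
  ext n x
  exact nerveComparison_factorCls (N := n.unop.len + 1 + n.unop.len + 1) x _ _ _ _ _

/-- The functor `((x, y) ⟶ (x', y')) ↦ (x', y)`. -/
def mixArrow (C C' : Type u) [Category.{u} C] [Category.{u} C'] : Arrow (C × C') ⥤ C × C' :=
  (Arrow.rightFunc ⋙ CategoryTheory.Prod.fst C C').prod'
    (Arrow.leftFunc ⋙ CategoryTheory.Prod.snd C C')

/-- The transformation `(x', y) ⟶ (x', y')`. -/
def mixArrowToRight (C C' : Type u) [Category.{u} C] [Category.{u} C'] :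
    mixArrow C C' ⟶ Arrow.rightFunc where
  app f := (𝟙 f.right.1, f.hom.2)
  naturality f g m := by
    refine Prod.ext ((Category.comp_id _).trans (Category.id_comp _).symm) ?_
    have h : (m.left ≫ g.hom).2 = (f.hom ≫ m.right).2 := by rw [Arrow.w m]
    exact h

lemma factorCls_totalOf (e : MorphismCat S) {n N : ℕ} (x : Fin N ⥤ Under e.cod × D.obj e.dom)
    (f g : Fin (n + 1) →o Fin N) (p : Fin N) (hf : ∀ i, f i ≤ p) (hg : ∀ i, p ≤ g i) :
    factorCls (x ⋙ totalOf D e) f g p hf hg = cls e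
      (g.monotone.functor ⋙ x ⋙ CategoryTheory.Prod.fst _ _)
      (f.monotone.functor ⋙ x ⋙ CategoryTheory.Prod.snd _ _) := by
  let k : e.cod ⟶ (x.obj p).1.right := (x.obj p).1.hom
  let e' : MorphismCat S := ⟨e.dom, (x.obj p).1.right, e.arr ≫ k⟩
  let m₁ : e' ⟶ ⟨(x.obj p).1.right, (x.obj p).1.right, 𝟙 _⟩ := ⟨e.arr ≫ k, 𝟙 _, by simp [e']⟩
  let m₂ : e' ⟶ e := ⟨𝟙 _, k, by simp [e']⟩
  let X : Fin (n + 1) ⥤ Under (x.obj p).1.right := underAt (x ⋙ totalOf D e) g p hg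
  let Y : Fin (n + 1) ⥤ D.obj e.dom := f.monotone.functor ⋙ x ⋙ CategoryTheory.Prod.snd _ _
  refine Eq.trans ?_ (((cls_map m₁ X Y).trans (cls_map m₂ X Y).symm).trans ?_)
  · refine cls_congr _ (comp_underMap_id _).symm ?_
    have h := push_total (f.monotone.functor ⋙ x ⋙ (𝟭 _).prod (D.map e.arr).toFunctor)
      (fun i => ((x ⋙ totalOf D e).map (homOfLE (hf i))).base)
      (fun _ => base_comp (x ⋙ totalOf D e) _ _ _) k (fun i => Under.w (x.map (homOfLE (hf i))).1)
    refine h.trans ?_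
    change Y ⋙ (D.map e.arr).toFunctor ⋙ (D.map k).toFunctor = _
    rw [toFunctor_comp e.arr k _ rfl]
  · refine cls_congr _ ?_ (comp_toFunctor_id _)
    exact underOf_map (g.monotone.functor ⋙ x ⋙ CategoryTheory.Prod.fst _ _) k
      (fun i => ((x ⋙ totalOf D e).map (homOfLE (hg i))).base)
      (fun _ => base_comp (x ⋙ totalOf D e) _ _ _) (fun i => Under.w (x.map (homOfLE (hg i))).1)

/-- The composite `sd N (C_f) ⟶ sd W ⟶ sd N (Gr D) ⟶ W`, for the colimit `W` of the nerves of the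
terms `C_f` of `prodDiagram D`. -/
lemma sd_map_totalOf_fromSd (f : MorphismCat S) :
    sd.map (nerveMap (totalOf D f)) ≫ fromSd D = sdToArrows (Under f.cod × D.obj f.dom) ≫
      nerveMap (mixArrow _ _) ≫ colimit.ι (nerveDiagram D) f := by
  ext n x
  exact factorCls_totalOf (N := n.unop.len + 1 + n.unop.len + 1) f x _ _ _ _ _

end Realization

end Comparison

/-! ### The comparison map is a homotopy equivalence -/

section Equivalence

open Simplicial Opposite MonoidalCategory CartesianMonoidalCategory

namespace Realization

variable {C C' E E' : Type u} [Category.{u} C] [Category.{u} C'] [Category.{u} E] [Category.{u} E']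

lemma cylinder_whiskerRight {F G : E ⥤ C} (φ : F ⟶ G) (K : C ⥤ C') :
    cylinder (Functor.whiskerRight φ K) = cylinder φ ⋙ K := by
  have hobj : ∀ p, (cylinder (Functor.whiskerRight φ K)).obj p = (cylinder φ ⋙ K).obj p := by
    rintro ⟨i, e⟩
    fin_cases i <;> rfl
  refine CategoryTheory.Functor.hext hobj ?_
  rintro ⟨i, e⟩ ⟨j, e'⟩ ⟨m, n⟩
  have hm := leOfHom m
  fin_cases i <;> fin_cases j
  · exact heq_of_eq (K.map_comp (𝟙 (F.obj e)) (F.map n) |>.trans (by rw [K.map_id]; rfl)).symm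
  · exact heq_of_eq (K.map_comp (φ.app e) (G.map n)).symm
  · exact absurd (show (1 : Fin 2) ≤ 0 from hm) (by decide)
  · exact heq_of_eq (K.map_comp (𝟙 (G.obj e)) (G.map n) |>.trans (by rw [K.map_id]; rfl)).symm

lemma cylinder_whiskerLeft {F G : E' ⥤ C} (φ : F ⟶ G) (H : E ⥤ E') :
    cylinder (Functor.whiskerLeft H φ) = (𝟭 (Fin 2)).prod H ⋙ cylinder φ := by
  have hobj : ∀ p, (cylinder (Functor.whiskerLeft H φ)).obj p =
      ((𝟭 (Fin 2)).prod H ⋙ cylinder φ).obj p := by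
    rintro ⟨i, e⟩
    fin_cases i <;> rfl
  refine CategoryTheory.Functor.hext hobj ?_
  rintro ⟨i, e⟩ ⟨j, e'⟩ ⟨m, n⟩
  have hm := leOfHom m
  fin_cases i <;> fin_cases j
  · rfl
  · rfl
  · exact absurd (show (1 : Fin 2) ≤ 0 from hm) (by decide)
  · rfl

lemma slice_naturality {X Y : SSet.{u}} (f : X ⟶ Y) (s : unitInterval) (p : SSet.toTop.obj X) :
    slice Y s (SSet.toTop.map f p) = SSet.toTop.map (𝟙 (Δ[1] : SSet.{u}) ⊗ₘ f) (slice X s p) := by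
  refine Eq.trans ?_ (toTop_map_tensor_crossPt (𝟙 (Δ[1] : SSet.{u})) f _ p).symm
  rw [SSet.toTop.map_id]
  rfl

lemma nerveHomotopy_whiskerLeft {F G : E' ⥤ C} (φ : F ⟶ G) (H : E ⥤ E') :
    (𝟙 (Δ[1] : SSet.{u}) ⊗ₘ nerveMap H) ≫ nerveHomotopy φ =
      nerveHomotopy (Functor.whiskerLeft H φ) := by
  ext n x
  exact congrArg (fun Z => (CategoryTheory.Functor.prod'
    (SSet.stdSimplex.objEquiv x.1).toOrderHom.monotone.functor x.2 :
      Fin (n.unop.len + 1) ⥤ Fin 2 × E) ⋙ Z) (cylinder_whiskerLeft φ H).symm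

lemma nerveHomotopy_whiskerRight {F G : E ⥤ C} (φ : F ⟶ G) (K : C ⥤ C') :
    nerveHomotopy φ ≫ nerveMap K = nerveHomotopy (Functor.whiskerRight φ K) := by
  ext n x
  exact congrArg (fun Z => (CategoryTheory.Functor.prod'
    (SSet.stdSimplex.objEquiv x.1).toOrderHom.monotone.functor x.2 :
      Fin (n.unop.len + 1) ⥤ Fin 2 × E) ⋙ Z) (cylinder_whiskerRight φ K).symm

lemma homotopyOfNatTrans_whiskerLeft {F G : E' ⥤ C} (φ : F ⟶ G) (H : E ⥤ E') (s : unitInterval)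
    (p : SSet.toTop.obj (nerve E)) : homotopyOfNatTrans φ (s, SSet.toTop.map (nerveMap H) p) =
      homotopyOfNatTrans (Functor.whiskerLeft H φ) (s, p) := by
  refine (congrArg _ (slice_naturality (nerveMap H) s p)).trans ?_
  rw [homotopyOfNatTrans_apply, ← nerveHomotopy_whiskerLeft, SSet.toTop.map_comp]
  rfl

lemma homotopyOfNatTrans_whiskerRight {F G : E ⥤ C} (φ : F ⟶ G) (K : C ⥤ C') (s : unitInterval)
    (p : SSet.toTop.obj (nerve E)) : SSet.toTop.map (nerveMap K) (homotopyOfNatTrans φ (s, p)) =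
      homotopyOfNatTrans (Functor.whiskerRight φ K) (s, p) := by
  rw [homotopyOfNatTrans_apply, homotopyOfNatTrans_apply, ← nerveHomotopy_whiskerRight,
    SSet.toTop.map_comp]
  rfl

lemma sdToArrows_naturality (H : E ⥤ E') :
    sd.map (nerveMap H) ≫ sdToArrows E' = sdToArrows E ≫ nerveMap H.mapArrow := rfl

lemma whisker_mixArrowToRight (F : C ⥤ E) (G : C' ⥤ E') :
    Functor.whiskerLeft (F.prod G).mapArrow (mixArrowToRight E E') =
      Functor.whiskerRight (mixArrowToRight C C') (F.prod G) := by
  ext f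
  · exact (F.map_id _).symm
  · rfl

variable {S : Type u} [SmallCategory S] (D : S ⥤ Cat.{u, u})

instance : PreservesColimitsOfSize.{v, u} sd.{u} :=
  inferInstanceAs (PreservesColimitsOfSize.{v, u}
    ((Functor.whiskeringLeft _ _ (Type u)).obj doubling.op))

lemma toTop_map_comp_apply {X Y Z : SSet.{u}} (f : X ⟶ Y) (g : Y ⟶ Z) (p : SSet.toTop.obj X) :
    SSet.toTop.map (f ≫ g) p = SSet.toTop.map g (SSet.toTop.map f p) := by
  rw [SSet.toTop.map_comp]
  rfl

/-- The simplicial maps `(x, y) ↦ (x'', y')` and `(x, y) ↦ (x'', y'')` on the edgewise subdivision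
of the nerve of a product, where `x'` and `x''` are the halves of `x`, have homotopic
realizations. -/
noncomputable def mixHomotopy {Z : SSet.{u}} (φ : nerve (C × C') ⟶ Z) : ContinuousMap.Homotopy
    (SSet.toTop.map (sdToArrows (C × C') ≫ nerveMap (mixArrow C C') ≫ φ)).hom
    (SSet.toTop.map (sdToArrows (C × C') ≫ nerveMap Arrow.rightFunc ≫ φ)).hom :=
  (((ContinuousMap.Homotopy.refl (SSet.toTop.map φ).hom).comp
    (homotopyOfNatTrans (mixArrowToRight C C'))).comp
      (ContinuousMap.Homotopy.refl (SSet.toTop.map (sdToArrows (C × C'))).hom)).cast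
    (by rw [SSet.toTop.map_comp, SSet.toTop.map_comp]; rfl)
    (by rw [SSet.toTop.map_comp, SSet.toTop.map_comp]; rfl)

lemma mixHomotopy_apply {Z : SSet.{u}} (φ : nerve (C × C') ⟶ Z) (t : unitInterval)
    (p : SSet.toTop.obj (sd.obj (nerve (C × C')))) :
    mixHomotopy φ (t, p) = SSet.toTop.map φ
      (homotopyOfNatTrans (mixArrowToRight C C') (t, SSet.toTop.map (sdToArrows _) p)) := rfl

lemma homotopyOfNatTrans_mixArrowToRight (F : C ⥤ E) (G : C' ⥤ E') (t : unitInterval)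
    (p : SSet.toTop.obj (nerve (Arrow (C × C')))) :
    homotopyOfNatTrans (mixArrowToRight E E')
      (t, SSet.toTop.map (nerveMap (F.prod G).mapArrow) p) = SSet.toTop.map (nerveMap (F.prod G))
        (homotopyOfNatTrans (mixArrowToRight C C') (t, p)) := by
  rw [homotopyOfNatTrans_whiskerLeft, homotopyOfNatTrans_whiskerRight]
  exact congrArg (fun φ : mixArrow C C' ⋙ F.prod G ⟶ Arrow.rightFunc ⋙ F.prod G =>
    homotopyOfNatTrans φ (t, p)) (whisker_mixArrowToRight F G)

lemma mixHomotopy_naturality {Z : SSet.{u}} (φ : nerve (C × C') ⟶ Z) (ψ : nerve (E × E') ⟶ Z)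
    (F : C ⥤ E) (G : C' ⥤ E') (h : nerveMap (F.prod G) ≫ ψ = φ) (t : unitInterval)
    (p : SSet.toTop.obj (sd.obj (nerve (C × C')))) :
    mixHomotopy ψ (t, SSet.toTop.map (sd.map (nerveMap (F.prod G))) p) = mixHomotopy φ (t, p) := by
  rw [mixHomotopy_apply, mixHomotopy_apply, ← toTop_map_comp_apply, sdToArrows_naturality,
    toTop_map_comp_apply, homotopyOfNatTrans_mixArrowToRight, ← toTop_map_comp_apply, h]

/-- The composite `sd W ⟶ sd N (Gr D) ⟶ W` is homotopic to `sdSnd`, for the colimit `W` of the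
nerves of the terms of `prodDiagram D`: it is so on each term, naturally. -/
lemma sd_nerveComparison_fromSd_homotopic :
    (SSet.toTop.map (sd.map (nerveComparison D) ≫ fromSd D)).hom.Homotopic
      (SSet.toTop.map (sdSnd.app (colimit (nerveDiagram D)))).hom := by
  have hc := isColimitOfPreserves (sd ⋙ SSet.toTop) (colimit.isColimit (nerveDiagram D))
  have key : ∀ {X : SSet.{u}} (f : MorphismCat S) (φ : colimit (nerveDiagram D) ⟶ X),
      SSet.toTop.map (sd.map (colimit.ι (nerveDiagram D) f ≫ φ)) =
        ((sd ⋙ SSet.toTop).mapCocone (colimit.cocone (nerveDiagram D))).ι.app f ≫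
          SSet.toTop.map (sd.map φ) := fun f φ => (sd ⋙ SSet.toTop).map_comp _ _
  refine homotopic_of_isColimit hc _ _ (fun f => (mixHomotopy (C := Under f.cod) (C' := D.obj f.dom)
    (colimit.ι (nerveDiagram D) f)).cast ?_ ?_) ?_
  · have h := congrArg (fun ψ => SSet.toTop.map (sd.map ψ)) (ι_nerveComparison D f)
    have h1 : ((sd ⋙ SSet.toTop).mapCocone (colimit.cocone (nerveDiagram D))).ι.app f ≫
        SSet.toTop.map (sd.map (nerveComparison D)) =
          SSet.toTop.map (sd.map (nerveMap (totalOf D f))) := (key f _).symm.trans h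
    refine (congrArg (fun ψ => (SSet.toTop.map ψ).hom)
      (sd_map_totalOf_fromSd (D := D) f).symm).trans
      ?_
    rw [SSet.toTop.map_comp, SSet.toTop.map_comp, ← h1]
    rfl
  · exact (congrArg (fun ψ => (SSet.toTop.map ψ).hom)
      (sdSnd.naturality (colimit.ι (nerveDiagram D) f)).symm).trans
      (congrArg TopCat.Hom.hom (SSet.toTop.map_comp _ _))
  · intro f g m t p
    exact mixHomotopy_naturality (C := Under f.cod) (C' := D.obj f.dom) (E := Under g.cod)
      (E' := D.obj g.dom) (colimit.ι (nerveDiagram D) f) (colimit.ι (nerveDiagram D) g)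
      (Under.map m.k) (D.map m.h).toFunctor (colimit.w (nerveDiagram D) m) t p

/-- The composite `sd N (Gr D) ⟶ W ⟶ N (Gr D)` is homotopic to `sdSnd`, for the colimit `W` of the
nerves of the terms of `prodDiagram D`. -/
lemma fromSd_nerveComparison_homotopic :
    (SSet.toTop.map (fromSd D ≫ nerveComparison D)).hom.Homotopic
      (SSet.toTop.map (sdSnd.app (nerve (Grothendieck D)))).hom := by
  rw [fromSd_nerveComparison, ← sdToArrows_rightFunc, SSet.toTop.map_comp, SSet.toTop.map_comp]
  exact ContinuousMap.Homotopic.comp ⟨homotopyOfNatTrans (pushArrowToRight D)⟩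
    (ContinuousMap.Homotopic.refl _)

/-- The comparison map from the colimit of the nerves realizes to a homotopy equivalence: up to the
homeomorphism `|sd X| ≅ |X|`, the inverse is the realization of `fromSd D`. -/
lemma nerveComparison_homotopyEquiv : Nonempty (ContinuousMap.HomotopyEquiv
    (SSet.toTop.obj (colimit (nerveDiagram D))) (SSet.toTop.obj (nerve (Grothendieck D)))) := by
  refine ⟨⟨(SSet.toTop.map (nerveComparison D)).hom,
    ((sdIso (nerve (Grothendieck D))).inv ≫ SSet.toTop.map (fromSd D)).hom, ?_, ?_⟩⟩
  · have h1 : SSet.toTop.map (nerveComparison D) ≫ (sdIso (nerve (Grothendieck D))).inv =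
        (sdIso _).inv ≫ SSet.toTop.map (sd.map (nerveComparison D)) := by
      rw [Iso.eq_inv_comp, ← Category.assoc, Iso.comp_inv_eq]
      ext p
      exact (sdToSelf_naturality (nerveComparison D) half p).symm
    have h2 := ((sd_nerveComparison_fromSd_homotopic D).trans
      (sdIso_hom_homotopic (colimit (nerveDiagram D))).symm).comp
        (ContinuousMap.Homotopic.refl (sdIso (colimit (nerveDiagram D))).inv.hom)
    have h3 : ((sdIso (nerve (Grothendieck D))).inv ≫ SSet.toTop.map (fromSd D)).hom.comp
        (SSet.toTop.map (nerveComparison D)).hom =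
        (SSet.toTop.map (sd.map (nerveComparison D) ≫ fromSd D)).hom.comp
          (sdIso (colimit (nerveDiagram D))).inv.hom := by
      have h4 := congrArg (fun ψ => (ψ ≫ SSet.toTop.map (fromSd D)).hom) h1
      rw [SSet.toTop.map_comp]
      exact h4
    rw [h3]
    refine h2.trans ?_
    have h5 := congrArg TopCat.Hom.hom (sdIso (colimit (nerveDiagram D))).inv_hom_id
    rw [← TopCat.hom_comp, h5]
    exact ContinuousMap.Homotopic.refl _
  · have h2 := ((fromSd_nerveComparison_homotopic D).trans
      (sdIso_hom_homotopic (nerve (Grothendieck D))).symm).comp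
        (ContinuousMap.Homotopic.refl (sdIso (nerve (Grothendieck D))).inv.hom)
    have h5 := congrArg TopCat.Hom.hom (sdIso (nerve (Grothendieck D))).inv_hom_id
    rw [SSet.toTop.map_comp] at h2
    rw [← TopCat.hom_comp, ← TopCat.hom_comp, h5] at h2
    rw [← TopCat.hom_comp, Category.assoc]
    exact h2

end Realization

end Equivalence

/-! ### The poset limit as a Grothendieck construction -/

section PosetLimit

namespace Realization

variable {S : Type u} [SmallCategory S] {D : S ⥤ Cat.{u, u}} {T : Type u} [Category.{u} T]

lemma map_heq_map {C : Type u} [Category.{u} C] (F : C ⥤ T) {x y x' y' : C} (hx : x = x')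
    (hy : y = y') {f : x ⟶ y} {f' : x' ⟶ y'} (h : f ≍ f') : F.map f ≍ F.map f' := by
  subst hx hy
  rw [eq_of_heq h]

lemma prod_mk_heq {C C' : Type u} [Category.{u} C] [Category.{u} C'] {x y x₁ y₁ : C}
    {x' y' x₁' y₁' : C'} (hx : x = x₁) (hy : y = y₁) (hx' : x' = x₁') (hy' : y' = y₁') {f : x ⟶ y}
    {f₁ : x₁ ⟶ y₁} {f' : x' ⟶ y'} {f₁' : x₁' ⟶ y₁'} (h : f ≍ f₁) (h' : f' ≍ f₁') :
    (Prod.mkHom f f' : (x, x') ⟶ (y, y')) ≍ (Prod.mkHom f₁ f₁' : (x₁, x₁') ⟶ (y₁, y₁')) := by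
  subst hx hy hx' hy'
  rw [eq_of_heq h, eq_of_heq h']

variable (D T) in
/-- A family of functors `(a ↓ S) × D a ⥤ T` that agree on `(b ↓ S) × D a` for every `a ⟶ b`: the
same as a cocone over `prodDiagram D`, in terms of its components at the identities of `S`. -/
structure UnderFamily where
  /-- the functors -/
  fn (a : S) : Under a × D.obj a ⥤ T
  /-- the compatibility condition -/
  w {a b : S} (k : a ⟶ b) : (Under.map k).prod (𝟭 (D.obj a)) ⋙ fn a =
    (𝟭 (Under b)).prod (D.map k).toFunctor ⋙ fn b

namespace UnderFamily

variable (G : UnderFamily D T)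

lemma obj_eq {a b : S} (k : a ⟶ b) (u : Under b) (x : D.obj a) :
    (G.fn a).obj ((Under.map k).obj u, x) = (G.fn b).obj (u, (D.map k).toFunctor.obj x) :=
  CategoryTheory.Functor.congr_obj (G.w k) (u, x)

lemma map_heq {a b : S} (k : a ⟶ b) {u v : Under b} (m : u ⟶ v) {x y : D.obj a} (n : x ⟶ y) :
    (G.fn a).map (Prod.mkHom ((Under.map k).map m) n) ≍
      (G.fn b).map (Prod.mkHom m ((D.map k).toFunctor.map n)) :=
  CategoryTheory.Functor.hcongr_hom (G.w k) (X := (u, x)) (Y := (v, y)) (Prod.mkHom m n)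

lemma mkHom_comp {a : S} {u v w : Under a} {x y z : D.obj a} (m : u ⟶ v) (m' : v ⟶ w) (n : x ⟶ y)
    (n' : y ⟶ z) : (G.fn a).map (Prod.mkHom m n) ≫ (G.fn a).map (Prod.mkHom m' n') =
      (G.fn a).map (Prod.mkHom (m ≫ m') (n ≫ n')) :=
  ((G.fn a).map_comp _ _).symm

/-- The morphism `𝟙 ⟶ k` of objects under `a`. -/
abbrev fromId {a b : S} (k : a ⟶ b) : Under.mk (𝟙 a) ⟶ (Under.map k).obj (Under.mk (𝟙 b)) :=
  Under.homMk k (by simp)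

lemma under_hom_heq {a : S} {u v u' v' : Under a} (hu : u = u') (hv : v = v') {f : u ⟶ v}
    {f' : u' ⟶ v'} (h : f.right ≍ f'.right) : f ≍ f' := by
  subst hu hv
  exact heq_of_eq (Under.UnderMorphism.ext (eq_of_heq h))

lemma under_map_mk_id {a b : S} (k : a ⟶ b) : (Under.map k).obj (Under.mk (𝟙 b)) = Under.mk k :=
  congrArg Under.mk (Category.comp_id k)

/-- The transition maps of the functor induced on the Grothendieck construction. -/
def transition {a b : S} (k : a ⟶ b) :
    Prod.sectR (Under.mk (𝟙 a)) (D.obj a) ⋙ G.fn a ⟶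
      (D.map k).toFunctor ⋙ Prod.sectR (Under.mk (𝟙 b)) (D.obj b) ⋙ G.fn b where
  app x := (G.fn a).map (Prod.mkHom (fromId k) (𝟙 x)) ≫ eqToHom (G.obj_eq k (Under.mk (𝟙 b)) x)
  naturality x y n := by
    have h1 : (G.fn a).map (Prod.mkHom (𝟙 (Under.mk (𝟙 a))) n) ≫
        (G.fn a).map (Prod.mkHom (fromId k) (𝟙 y)) = (G.fn a).map (Prod.mkHom (fromId k) (𝟙 x)) ≫
          (G.fn a).map (Prod.mkHom (𝟙 _) n) := by
      rw [mkHom_comp, mkHom_comp, Category.id_comp, Category.id_comp, Category.comp_id,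
        Category.comp_id]
    have h2 := G.map_heq k (𝟙 (Under.mk (𝟙 b))) n
    rw [CategoryTheory.Functor.map_id] at h2
    have h3 : (G.fn a).map (Prod.mkHom (𝟙 ((Under.map k).obj (Under.mk (𝟙 b)))) n) ≫
        eqToHom (G.obj_eq k (Under.mk (𝟙 b)) y) = eqToHom (G.obj_eq k (Under.mk (𝟙 b)) x) ≫
          (G.fn b).map (Prod.mkHom (𝟙 (Under.mk (𝟙 b))) ((D.map k).toFunctor.map n)) :=
      eq_of_heq ((comp_eqToHom_heq _ _).trans (h2.trans (eqToHom_comp_heq _ _).symm))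
    refine (Category.assoc _ _ _).symm.trans ?_
    refine (congrArg (· ≫ eqToHom _) h1).trans ?_
    refine (Category.assoc _ _ _).trans ((congrArg (_ ≫ ·) h3).trans (Category.assoc _ _ _).symm)

lemma transition_app_heq {a b : S} (k : a ⟶ b) (x : D.obj a) : (G.transition k).app x ≍
    (G.fn a).map (Prod.mkHom (fromId k) (𝟙 x)) := comp_eqToHom_heq _ _

/-- The functor on the Grothendieck construction induced by a compatible family. -/
def desc : Grothendieck D ⥤ T :=
  Grothendieck.functorFrom (fun a => Prod.sectR (Under.mk (𝟙 a)) (D.obj a) ⋙ G.fn a)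
    (fun k => G.transition k)
    (fun a => by
      ext x
      rw [eqToHom_app]
      refine eq_of_heq ((G.transition_app_heq (𝟙 a) x).trans (HEq.trans ?_
        (eqToHom_heq_id_dom _ _ _).symm))
      have h : Prod.mkHom (fromId (𝟙 a)) (𝟙 x) ≍ 𝟙 (Under.mk (𝟙 a), x) :=
        prod_mk_heq rfl (under_map_mk_id _) rfl rfl
          (under_hom_heq rfl (under_map_mk_id _) HEq.rfl) HEq.rfl
      refine (map_heq_map (G.fn a) rfl (congrArg (·, x) (under_map_mk_id _)) h).trans ?_
      rw [CategoryTheory.Functor.map_id]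
      rfl)
    (fun a b c k l => by
      ext x
      rw [NatTrans.comp_app, NatTrans.comp_app, eqToHom_app]
      refine eq_of_heq ((G.transition_app_heq (k ≫ l) x).trans (HEq.trans ?_
        (heq_of_eq (Category.assoc _ _ _))))
      refine HEq.trans ?_ (comp_eqToHom_heq _ _).symm
      have h1 : (Under.map k).obj ((Under.map l).obj (Under.mk (𝟙 c))) =
          (Under.map (k ≫ l)).obj (Under.mk (𝟙 c)) := congrArg Under.mk (Category.assoc _ _ _).symm
      have h2 := G.map_heq k (fromId l) (𝟙 x)
      rw [CategoryTheory.Functor.map_id] at h2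
      have h3 : Prod.mkHom (fromId (k ≫ l)) (𝟙 x) ≍
          Prod.mkHom (fromId k ≫ (Under.map k).map (fromId l)) (𝟙 x ≫ 𝟙 x) :=
        prod_mk_heq rfl h1.symm rfl rfl (under_hom_heq rfl h1.symm HEq.rfl)
          (heq_of_eq (Category.comp_id _).symm)
      refine (map_heq_map (G.fn a) rfl (congrArg (·, x) h1.symm) h3).trans ?_
      rw [← mkHom_comp]
      exact comp_heq_comp rfl (G.obj_eq k _ x) ((G.obj_eq k _ x).trans (G.obj_eq l _ _))
        (G.transition_app_heq k x).symm (h2.trans (G.transition_app_heq l _).symm))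

/-- The induced functor restricts to the given ones. -/
lemma total_desc (a : S) : total D a ⋙ G.desc = G.fn a := by
  have hobj : ∀ p, (total D a ⋙ G.desc).obj p = (G.fn a).obj p := fun p =>
    (G.obj_eq p.1.hom (Under.mk (𝟙 _)) p.2).symm.trans
      (congrArg (fun u => (G.fn a).obj (u, p.2)) (under_map_mk_id p.1.hom))
  refine CategoryTheory.Functor.hext hobj fun p q m => ?_
  have hr : (Under.map p.1.hom).obj ((Under.map m.1.right).obj (Under.mk (𝟙 _))) = q.1 := by
    refine congrArg Under.mk (Eq.trans ?_ (Under.w m.1))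
    exact congrArg (p.1.hom ≫ ·) (Category.comp_id m.1.right)
  have h1 : (G.transition m.1.right).app ((D.map p.1.hom).toFunctor.obj p.2) ≍
      (G.fn a).map (Prod.mkHom m.1 (𝟙 p.2)) := by
    have h := G.map_heq p.1.hom (fromId m.1.right) (𝟙 p.2)
    rw [CategoryTheory.Functor.map_id] at h
    refine (G.transition_app_heq _ _).trans (h.symm.trans ?_)
    exact map_heq_map (G.fn a) (congrArg (·, p.2) (under_map_mk_id p.1.hom))
      (congrArg (·, p.2) hr) (prod_mk_heq (under_map_mk_id p.1.hom) hr rfl rfl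
        (under_hom_heq (under_map_mk_id p.1.hom) hr HEq.rfl) HEq.rfl)
  have h2 : (G.fn q.1.right).map (Prod.mkHom (𝟙 (Under.mk (𝟙 _))) ((total D a).map m).fiber) ≍
      (G.fn a).map (Prod.mkHom (𝟙 q.1) m.2) := by
    have h := G.map_heq q.1.hom (𝟙 (Under.mk (𝟙 _))) m.2
    rw [CategoryTheory.Functor.map_id] at h
    have he := toFunctor_obj (Under.w m.1) p.2
    refine (map_heq_map (G.fn q.1.right) (congrArg (Under.mk (𝟙 _), ·) he) rfl
      (prod_mk_heq rfl rfl he rfl HEq.rfl (eqToHom_comp_heq _ _))).trans (h.symm.trans ?_)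
    have hq := under_map_mk_id q.1.hom
    exact map_heq_map (G.fn a) (congrArg (·, p.2) hq) (congrArg (·, q.2) hq)
      (prod_mk_heq hq hq rfl rfl (under_hom_heq hq hq HEq.rfl) HEq.rfl)
  have h3 : (G.fn a).map (Prod.mkHom m.1 (𝟙 p.2)) ≫ (G.fn a).map (Prod.mkHom (𝟙 q.1) m.2) =
      (G.fn a).map m := by
    rw [mkHom_comp, Category.comp_id, Category.id_comp]
    rfl
  rw [← h3]
  refine comp_heq_comp (hobj p) ?_ (hobj q) h1 h2
  have he := toFunctor_obj (Under.w m.1) p.2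
  exact (congrArg (fun x => (G.fn q.1.right).obj (Under.mk (𝟙 _), x)) he).trans (hobj (q.1, p.2))

end UnderFamily

/-- The Grothendieck construction is covered by the functors `total D a`: a morphism `(f, m)`
factors as `(f, 𝟙)`, which comes from `a ↓ S`, followed by `(𝟙, m)`, which comes from a fiber. -/
lemma functor_ext_of_total {F F' : Grothendieck D ⥤ T}
    (h : ∀ a, total D a ⋙ F = total D a ⋙ F') : F = F' := by
  have hX : ∀ X : Grothendieck D, (total D X.base).obj (Under.mk (𝟙 _), X.fiber) = X := fun X =>
    grothendieck_obj_ext rfl (heq_of_eq (toFunctor_id_obj _))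
  have hobj : ∀ X, F.obj X = F'.obj X := fun X => by
    rw [← hX X]
    exact CategoryTheory.Functor.congr_obj (h X.base) _
  have hmap : ∀ {a : S} {p q : Under a × D.obj a} (m : p ⟶ q) {X Y : Grothendieck D} (f : X ⟶ Y),
      (total D a).obj p = X → (total D a).obj q = Y → (total D a).map m ≍ f →
      F.map f ≍ F'.map f := by
    rintro a p q m _ _ f rfl rfl hf
    rw [← eq_of_heq hf]
    exact CategoryTheory.Functor.hcongr_hom (h a) m
  refine CategoryTheory.Functor.hext hobj fun X Y f => ?_
  let Z : Grothendieck D := ⟨Y.base, (D.map f.base).toFunctor.obj X.fiber⟩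
  let f₁ : X ⟶ Z := ⟨f.base, 𝟙 _⟩
  let f₂ : Z ⟶ Y := ⟨𝟙 _, eqToHom (toFunctor_id_obj _) ≫ f.fiber⟩
  have hf : f = f₁ ≫ f₂ := by
    refine Grothendieck.ext _ _ (Category.comp_id _).symm (eq_of_heq ?_)
    refine (eqToHom_comp_heq _ _).trans (HEq.trans ?_ (eqToHom_comp_heq _ _).symm)
    have h1 : (D.map f₂.base).toFunctor.map f₁.fiber ≫ f₂.fiber = f₂.fiber :=
      (congrArg (· ≫ f₂.fiber) ((D.map f₂.base).toFunctor.map_id _)).trans (Category.id_comp _)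
    rw [h1]
    exact (eqToHom_comp_heq _ _).symm
  have h₁ : F.map f₁ ≍ F'.map f₁ := by
    refine hmap (Prod.mkHom (Under.homMk f.base (by simp) : Under.mk (𝟙 X.base) ⟶ Under.mk f.base)
      (𝟙 X.fiber)) f₁ (hX X) rfl ?_
    refine grothendieck_hom_heq (hX X) rfl _ _ HEq.rfl ?_
    exact (eqToHom_comp_heq _ _).trans (heq_of_eq ((D.map f.base).toFunctor.map_id _))
  have h₂ : F.map f₂ ≍ F'.map f₂ := by
    refine hmap (Prod.mkHom (𝟙 (Under.mk (𝟙 Y.base))) f.fiber) f₂ (hX Z) (hX Y) ?_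
    refine grothendieck_hom_heq (hX Z) (hX Y) _ _ HEq.rfl ?_
    exact (eqToHom_comp_heq _ _).trans ((toFunctor_id_map_heq _).trans (eqToHom_comp_heq _ _).symm)
  rw [hf, Functor.map_comp, Functor.map_comp]
  exact comp_heq_comp (hobj X) (hobj Z) (hobj Y) h₁ h₂

/-- The compatible family of functors underlying a cocone. -/
def familyOfCocone (s : Cocone (prodDiagram D)) : UnderFamily D s.pt where
  fn a := (s.ι.app ⟨a, a, 𝟙 a⟩).toFunctor
  w {a b} k := by
    let e : MorphismCat S := ⟨a, b, k⟩
    let m₁ : e ⟶ ⟨a, a, 𝟙 a⟩ := ⟨𝟙 a, k, by simp [e]⟩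
    let m₂ : e ⟶ ⟨b, b, 𝟙 b⟩ := ⟨k, 𝟙 b, by simp [e]⟩
    have h := congrArg Cat.Hom.toFunctor ((s.w m₁).trans (s.w m₂).symm)
    have h₁ : ((prodDiagram D).map m₁).toFunctor = (Under.map k).prod (𝟭 (D.obj a)) :=
      congrArg (Under.map k).prod (congrArg Cat.Hom.toFunctor (D.map_id a))
    have h₂ : ((prodDiagram D).map m₂).toFunctor = (𝟭 (Under b)).prod (D.map k).toFunctor :=
      congrArg (fun Z : Under b ⥤ Under b => Z.prod (D.map k).toFunctor) (Under.mapId_eq b)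
    rw [← h₁, ← h₂]
    exact h

lemma totalOf_id (a : S) : totalOf D ⟨a, a, 𝟙 a⟩ = total D a := by
  have h : (D.map (𝟙 a)).toFunctor = 𝟭 (D.obj a) := congrArg Cat.Hom.toFunctor (D.map_id a)
  change (𝟭 (Under a)).prod (D.map (𝟙 a)).toFunctor ⋙ total D a = _
  rw [h]
  rfl

variable (D) in
/-- The Grothendieck construction is the colimit of the categories `(cod f ↓ S) × D (dom f)`. -/
def isColimitTotalCocone : IsColimit (totalCocone D) where
  desc s := (familyOfCocone s).desc.toCatHom
  fac s f := by
    let m : f ⟶ ⟨f.dom, f.dom, 𝟙 f.dom⟩ := ⟨𝟙 _, f.arr, by simp⟩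
    have h : (totalCocone D).ι.app ⟨f.dom, f.dom, 𝟙 _⟩ ≫ (familyOfCocone s).desc.toCatHom =
        s.ι.app ⟨f.dom, f.dom, 𝟙 _⟩ := by
      refine Cat.ext ?_
      change totalOf D _ ⋙ _ = _
      rw [totalOf_id]
      exact (familyOfCocone s).total_desc f.dom
    rw [← (totalCocone D).w m, ← s.w m]
    exact (Category.assoc _ _ _).trans (congrArg ((prodDiagram D).map m ≫ ·) h)
  uniq s φ hφ := by
    refine Cat.ext (functor_ext_of_total fun a => ?_)
    refine Eq.trans ?_ ((familyOfCocone s).total_desc a).symm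
    rw [← totalOf_id]
    exact congrArg Cat.Hom.toFunctor (hφ ⟨a, a, 𝟙 a⟩)

variable (D) in
/-- The poset limit of a diagram of categories is its Grothendieck construction. -/
noncomputable def posetLimitIso : posetLimit D ≅ Cat.of (Grothendieck D) :=
  nLimIso (𝟭 Cat.{u, u}) D (prodDiagram D)
    (fun f => (CategoryTheory.Prod.fst (Under f.cod) (D.obj f.dom)).toCatHom)
    (fun f => (CategoryTheory.Prod.snd (Under f.cod) (D.obj f.dom)).toCatHom) (fun _ => rfl)
    (fun _ => rfl) (fun f => Cat.isLimitProdCone (Cat.of (Under f.cod)) (D.obj f.dom))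
    (totalCocone D) (isColimitTotalCocone D)

end Realization

end PosetLimit

/-- For every diagram `D` of small categories, the homotopy limit of the diagram of realizations
`Δ ∘ D` is homotopy equivalent to the realization of the poset limit of `D`. -/
theorem mainTheorem6 {S : Type u} [SmallCategory S] (D : S ⥤ Cat.{u, u}) :
    Nonempty (ContinuousMap.HomotopyEquiv
      (holim (D ⋙ realization.{u})) (realization.{u}.obj (posetLimit D))) := by
  have hc : IsColimit (SSet.toTop.mapCocone (colimit.cocone (Realization.nerveDiagram D))) :=
    isColimitOfPreserves SSet.toTop (colimit.isColimit _)
  exact ⟨((Realization.holim_homotopyEquiv D _ hc).some.trans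
    (Realization.nerveComparison_homotopyEquiv D).some).trans
      (TopCat.homeoOfIso
        (realization.{u}.mapIso (Realization.posetLimitIso D))).symm.toHomotopyEquiv⟩
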